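/- **Setting.** A directed graph with integer keys as vertices is kept in a shared memory accessed by an arbitrary set of threads. A *vertex node* has fields $val$, $vnext$, $EdgeHead$, $marked$ and a lock; an *edge node* has fields $val$, $enext$, $status\in\{transit,marked,added\}$ and a lock. The vertex nodes form a linked list sorted by key from the sentinel $VertexHead$ ($-\infty$) to a sentinel with value $+\infty$; each vertex node has an edge list, sorted by key, between two sentinels $EdgeHead$ ($-\infty$) and $EdgeTail$ ($+\infty$), whose edge nodes carry the keys of the out-neighbours. New edge nodes have status $transit$; the edge sentinels carry one fixed status other than $marked$. Initially only the sentinels are present. Every read or write of a field, every acquisition or release of a lock and every allocation of a node is one atomic event, and so are the invocation and the response of a method; in an execution, the events of the threads interleave arbitrarily, each thread executing one method call at a time. The methods are as follows; all searches run without locks. * $LocateVertex(key)$: search the vertex list from $VertexHead$ for adjacent nodes $v_1,v_2$ with $v_2$ the first one met with $v_2.val\ge key$; lock $v_1$, then $v_2$; check that neither is marked and $v_1.vnext=v_2$, otherwise unlock both and retry. * $AddVertex(key)$: $LocateVertex$; if $v_2.val\neq key$, create an unmarked node $v_3$ with this key and an empty edge list, set $v_3.vnext\gets v_2$, $v_1.vnext\gets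 v_3$; unlock. $RemoveVertex(key)$: $LocateVertex$; if $v_2.val=key$, set $v_2.marked\gets true$, then $v_1.vnext\gets v_2.vnext$; unlock. $ContainsVertex(key)$ searches and reports whether an unmarked node with this key is found. * $HelpSearchEdge(key_1,key_2)$: search the vertex list for the smaller key (for $key_2$ if the keys are equal), then, from the successor of the node found, for the other key; return $false$ if a node is not found or is found marked; otherwise return the two nodes as $v_1$ (for $key_1$) and $v_2$ (for $key_2$). * Edge location in $v_1$: search the edge list of $v_1$ for adjacent nodes $e_1,e_2$ with $e_2$ the first one met with $e_2.val\ge key_2$; lock $e_1$, then $e_2$; check the status of both and $e_1.enext=e_2$; if this fails, unlock both and retry. The status check asks for $added$ in $AcyclicRemoveEdge$ and for "not $marked$" in $AcyclicAddEdge$. * $AcyclicAddEdge(key_1,key_2)$: $HelpSearchEdge$; return $false$ if it fails or if now $v_1$ or $v_2$ is marked. Locate $e_1,e_2$. Read $e_2.val$ (event $A$). If it equals $key_2$, unlock and return $true$. Otherwise create an edge node $e_3$ with key $key_2$ and status $transit$, set $e_3.enext\gets e_2$, $e_1.enext\gets e_3$, unlock $e_1,e_2$, and call $PathExists(key_2,key_1)$.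 If it returns $false$, set $e_3.status\gets added$ (event $B$) and return $true$. If it returns $true$, locate and lock again in $v_1$ the position $(ne_1,ne_2)$ of $key_2$, set $e_3.status\gets marked$, $ne_1.enext\gets e_3.enext$, unlock $ne_1,ne_2$, and return $false$. * $PathExists(a,b)$: keep a local set $R$ of reached keys, initially empty, and explore $a$; then, as long as $R$ contains an unexplored key, explore one such key; return $false$ when there is none. To explore a key, search its vertex node from $VertexHead$; if it is absent or marked, nothing is added; otherwise traverse its edge list, putting into $R$ the values of all nodes before $EdgeTail$ whose status is not $marked$, and then return $true$ if $b\in R$. * $AcyclicRemoveEdge(key_1,key_2)$: $HelpSearchEdge$; return $false$ if it fails or if now $v_1$ or $v_2$ is marked. Locate $e_1,e_2$; if $e_2.val=key_2$, set $e_2.status\gets marked$, then $e_1.enext\gets e_2.enext$; unlock and return $true$. $AcyclicContainsEdge(key_1,key_2)$: $HelpSearchEdge$, then search the edge list of $v_1$ and report whether an edge node with key $key_2$ and status $added$ is found. **Abstract graph.** In a global state $S$, the vertices of the abstract graph are the keys that have an unmarked vertex node reachable from $VertexHead$. There is an edge $(k,l)$ if $k$ and $l$ are vertices and an edge node with key $l$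 and status $added$ is reachable from $EdgeHead$ of an unmarked reachable vertex node with key $k$. The graph is acyclic if it has no directed cycle (loops included). **Linearization point.** Consider a call $AcyclicAddEdge(key_1,key_2)$ that returns $true$, and let $v_1,v_2$ be the vertex nodes that it has located. Its linearization point is the earlier of the following two points of its execution interval: (1) the last of the events $A$ and $B$ that the call executes; (2) if during the call some $RemoveVertex$ marks $v_1$ or $v_2$, the point immediately before the first such event (both the pre-state and the post-state are then the state right before that event). **Lemma.** In every execution, if a call $AcyclicAddEdge(key_1,key_2)$ returns $true$, then its linearization point exists, and in the pre-state and in the post-state of the linearization point both $key_1$ and $key_2$ are vertices of the abstract graph, and the abstract graph is acyclic. -/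

import Mathlib

namespace ConcGraph

/-! ## Nodes and shared memory -/

/-- Addresses of vertex nodes and (in a separate space) of edge nodes. -/
abbrev Addr := ℕ

/-- The address `0` is never allocated: it is the null pointer. -/
def null : Addr := 0

/-- Values of the `val` field: the integers with `-∞` and `+∞` for the sentinels. -/
abbrev Val := WithBot (WithTop ℤ)

/-- An integer key as a value of the `val` field. -/
def key (k : ℤ) : Val := ((k : WithTop ℤ) : WithBot (WithTop ℤ))

/-- The status of an edge node. -/
inductive Status
  | transit
  | marked
  | added
  deriving DecidableEq

/-- A vertex node. `ehead` is the address of its `EdgeHead` sentinel; `EdgeTail` is the last node of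
the list that starts there. Its lock is kept in `Mem.vlock`. -/
structure VNode where
  val : Val
  vnext : Addr
  ehead : Addr
  marked : Bool

/-- An edge node. Its lock is kept in `Mem.elock`. -/
structure ENode where
  val : Val
  enext : Addr
  status : Status

/-- The shared memory of the threads `T`: vertex nodes, edge nodes, and the holders of their locks. -/
structure Mem (T : Type*) where
  vn : Addr → Option VNode
  en : Addr → Option ENode
  vlock : Addr → Option T
  elock : Addr → Option T

/-- The static addresses of the sentinels `VertexHead` (`-∞`) and `VertexTail` (`+∞`). -/
def vHead : Addr := 1
def vTail : Addr := 2

/-- The empty graph: only the two vertex sentinels, each with an empty edge list. The edge sentinels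
carry the status `sent`. -/
def initMem (T : Type*) (sent : Status) : Mem T where
  vn := fun a =>
    if a = vHead then some ⟨⊥, vTail, 1, false⟩
    else if a = vTail then some ⟨⊤, null, 3, false⟩
    else none
  en := fun a =>
    if a = 1 then some ⟨⊥, 2, sent⟩
    else if a = 2 then some ⟨⊤, null, sent⟩
    else if a = 3 then some ⟨⊥, 4, sent⟩
    else if a = 4 then some ⟨⊤, null, sent⟩
    else none
  vlock := fun _ => none
  elock := fun _ => none

/-! ## The methods as a program of atomic instructions -/

/-- The exported methods with their arguments. -/
inductive Op
  | addVertex (k : ℤ)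
  | removeVertex (k : ℤ)
  | containsVertex (k : ℤ)
  | acyclicAddEdge (k l : ℤ)
  | acyclicRemoveEdge (k l : ℤ)
  | acyclicContainsEdge (k l : ℤ)

/-- The caller of `LocateVertex`. -/
inductive VCaller
  | add
  | rem

/-- The caller of `HelpSearchEdge`. -/
inductive ECaller
  | add
  | rem
  | con

/-- The caller of the edge-locating loop: `AcyclicLocateEdge` in `AcyclicAddEdge` (`ins`) or in
`AcyclicRemoveEdge` (`del`), or `NewLocateEdge` when `AcyclicAddEdge` takes back its node `e₃`
(`undo e₃`). -/
inductive LCaller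
  | ins
  | del
  | undo (e₃ : Addr)

/-- Control points, together with the values of the local variables that are live there. -/
inductive PC
  -- LocateVertex(key, v₁, v₂), with ValidateVertex at `lvChk`
  | lvStart (c : VCaller) (k : ℤ)
  | lvTest (c : VCaller) (k : ℤ) (v₁ v₂ : Addr)
  | lvNext (c : VCaller) (k : ℤ) (v₁ v₂ : Addr)
  | lvLock1 (c : VCaller) (k : ℤ) (v₁ v₂ : Addr)
  | lvLock2 (c : VCaller) (k : ℤ) (v₁ v₂ : Addr)
  | lvChk1 (c : VCaller) (k : ℤ) (v₁ v₂ : Addr)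
  | lvChk2 (c : VCaller) (k : ℤ) (v₁ v₂ : Addr)
  | lvChk3 (c : VCaller) (k : ℤ) (v₁ v₂ : Addr)
  | lvFail1 (c : VCaller) (k : ℤ) (v₁ v₂ : Addr)
  | lvFail2 (c : VCaller) (k : ℤ) (v₂ : Addr)
  -- AddVertex(key)
  | avTest (k : ℤ) (v₁ v₂ : Addr)
  | avNew (k : ℤ) (v₁ v₂ : Addr)
  | avInit (k : ℤ) (v₁ v₂ v₃ : Addr)
  | avLink (k : ℤ) (v₁ v₂ v₃ : Addr)
  -- RemoveVertex(key)
  | rvTest (k : ℤ) (v₁ v₂ : Addr)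
  | rvMark (k : ℤ) (v₁ v₂ : Addr)
  | rvRead (k : ℤ) (v₁ v₂ : Addr)
  | rvUnlink (k : ℤ) (v₁ v₂ n : Addr)
  -- release of the vertex locks, then return
  | vRel1 (flag : Bool) (v₁ v₂ : Addr)
  | vRel2 (flag : Bool) (v₂ : Addr)
  -- ContainsVertex(key)
  | cvTest (k : ℤ) (v : Addr)
  | cvNext (k : ℤ) (v : Addr)
  | cvVal (k : ℤ) (v : Addr)
  | cvMark (k : ℤ) (v : Addr)
  -- HelpSearchEdge(key₁, key₂, v₁, v₂): the smaller key first, the larger from there on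
  | hsTest1 (c : ECaller) (k l : ℤ) (a : Addr)
  | hsNext1 (c : ECaller) (k l : ℤ) (a : Addr)
  | hsVal1 (c : ECaller) (k l : ℤ) (a : Addr)
  | hsMark1 (c : ECaller) (k l : ℤ) (a : Addr)
  | hsStart2 (c : ECaller) (k l : ℤ) (a : Addr)
  | hsTest2 (c : ECaller) (k l : ℤ) (a b : Addr)
  | hsNext2 (c : ECaller) (k l : ℤ) (a b : Addr)
  | hsVal2 (c : ECaller) (k l : ℤ) (a b : Addr)
  | hsMark2 (c : ECaller) (k l : ℤ) (a b : Addr)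
  -- AcyclicLocateEdge: the second test of the marks
  | alMark1 (c : LCaller) (k l : ℤ) (v₁ v₂ : Addr)
  | alMark2 (c : LCaller) (k l : ℤ) (v₁ v₂ : Addr)
  -- AcyclicLocateEdge / NewLocateEdge: the loop, with the validation at `leChk`
  | leStart (c : LCaller) (k l : ℤ) (v₁ v₂ : Addr)
  | leFirst (c : LCaller) (k l : ℤ) (v₁ v₂ e₁ : Addr)
  | leTest (c : LCaller) (k l : ℤ) (v₁ v₂ e₁ e₂ : Addr)
  | leNext (c : LCaller) (k l : ℤ) (v₁ v₂ e₁ e₂ : Addr)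
  | leLock1 (c : LCaller) (k l : ℤ) (v₁ v₂ e₁ e₂ : Addr)
  | leLock2 (c : LCaller) (k l : ℤ) (v₁ v₂ e₁ e₂ : Addr)
  | leChk1 (c : LCaller) (k l : ℤ) (v₁ v₂ e₁ e₂ : Addr)
  | leChk2 (c : LCaller) (k l : ℤ) (v₁ v₂ e₁ e₂ : Addr)
  | leChk3 (c : LCaller) (k l : ℤ) (v₁ v₂ e₁ e₂ : Addr)
  | leFail1 (c : LCaller) (k l : ℤ) (v₁ v₂ e₁ e₂ : Addr)
  | leFail2 (c : LCaller) (k l : ℤ) (v₁ v₂ e₂ : Addr)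
  -- AcyclicAddEdge(key₁, key₂)
  | aeTest (k l : ℤ) (v₁ v₂ e₁ e₂ : Addr)
  | aeNew (k l : ℤ) (v₁ v₂ e₁ e₂ : Addr)
  | aeInit (k l : ℤ) (v₁ v₂ e₁ e₂ e₃ : Addr)
  | aeLink (k l : ℤ) (v₁ v₂ e₁ e₂ e₃ : Addr)
  | aeRel1 (k l : ℤ) (v₁ v₂ e₁ e₂ e₃ : Addr)
  | aeRel2 (k l : ℤ) (v₁ v₂ e₂ e₃ : Addr)
  | aeAdded (k l : ℤ) (v₁ v₂ e₃ : Addr)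
  | aeMark (k l : ℤ) (v₁ v₂ e₃ ne₁ ne₂ : Addr)
  | aeRead (k l : ℤ) (v₁ v₂ e₃ ne₁ ne₂ : Addr)
  | aeUnlink (k l : ℤ) (v₁ v₂ e₃ ne₁ ne₂ n : Addr)
  -- PathExists(key₂, key₁) as called by AcyclicAddEdge(key₁, key₂); `x` is the key being explored,
  -- `R` is the local set of reached keys, `X` the set of explored ones
  | peTest (k l : ℤ) (v₁ v₂ e₃ : Addr) (x : Val) (R X : Finset Val) (v : Addr)
  | peNext (k l : ℤ) (v₁ v₂ e₃ : Addr) (x : Val) (R X : Finset Val) (v : Addr)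
  | peVal (k l : ℤ) (v₁ v₂ e₃ : Addr) (x : Val) (R X : Finset Val) (v : Addr)
  | peMark (k l : ℤ) (v₁ v₂ e₃ : Addr) (x : Val) (R X : Finset Val) (v : Addr)
  | peHead (k l : ℤ) (v₁ v₂ e₃ : Addr) (x : Val) (R X : Finset Val) (v : Addr)
  | peEnd (k l : ℤ) (v₁ v₂ e₃ : Addr) (x : Val) (R X : Finset Val) (e : Addr)
  | peStatus (k l : ℤ) (v₁ v₂ e₃ : Addr) (x : Val) (R X : Finset Val) (e : Addr)
  | peEVal (k l : ℤ) (v₁ v₂ e₃ : Addr) (x : Val) (R X : Finset Val) (e : Addr)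
  | peENext (k l : ℤ) (v₁ v₂ e₃ : Addr) (x : Val) (R X : Finset Val) (e : Addr)
  | peLoop (k l : ℤ) (v₁ v₂ e₃ : Addr) (R X : Finset Val)
  -- AcyclicRemoveEdge(key₁, key₂)
  | reTest (k l : ℤ) (e₁ e₂ : Addr)
  | reMark (k l : ℤ) (e₁ e₂ : Addr)
  | reRead (k l : ℤ) (e₁ e₂ : Addr)
  | reUnlink (k l : ℤ) (e₁ e₂ n : Addr)
  -- release of the edge locks, then return
  | eRel1 (flag : Bool) (e₁ e₂ : Addr)
  | eRel2 (flag : Bool) (e₂ : Addr)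
  -- AcyclicContainsEdge(key₁, key₂)
  | ceStart (k l : ℤ) (v₁ : Addr)
  | ceTest (k l : ℤ) (e : Addr)
  | ceNext (k l : ℤ) (e : Addr)
  | ceVal (k l : ℤ) (e : Addr)
  | ceStatus (k l : ℤ) (e : Addr)
  -- about to return `flag`
  | done (flag : Bool)

/-- Atomic instructions, with their continuations. -/
inductive Instr
  | rdVVal (a : Addr) (cont : Val → PC)
  | rdVNext (a : Addr) (cont : Addr → PC)
  | rdEHead (a : Addr) (cont : Addr → PC)
  | rdMarked (a : Addr) (cont : Bool → PC)
  | rdEVal (a : Addr) (cont : Val → PC)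
  | rdENext (a : Addr) (cont : Addr → PC)
  | rdStatus (a : Addr) (cont : Status → PC)
  | wrVNext (a b : Addr) (cont : PC)
  | wrMarked (a : Addr) (cont : PC)
  | wrENext (a b : Addr) (cont : PC)
  | wrStatus (a : Addr) (s : Status) (cont : PC)
  | newV (k : ℤ) (cont : Addr → PC)
  | newE (k : ℤ) (cont : Addr → PC)
  | lockV (a : Addr) (cont : PC)
  | unlockV (a : Addr) (cont : PC)
  | lockE (a : Addr) (cont : PC)
  | unlockE (a : Addr) (cont : PC)
  /-- a local step: pick any member of `A`; if there is none, go on with `last` -/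
  | pick (A : Finset Val) (cont : Val → PC) (last : PC)
  | ret (flag : Bool)

/-- The first control point of a method. -/
def start : Op → PC
  | .addVertex k => .lvStart .add k
  | .removeVertex k => .lvStart .rem k
  | .containsVertex k => .cvTest k vHead
  | .acyclicAddEdge k l => .hsTest1 .add k l vHead
  | .acyclicRemoveEdge k l => .hsTest1 .rem k l vHead
  | .acyclicContainsEdge k l => .hsTest1 .con k l vHead

/-- Where `HelpSearchEdge` returns to when it has found both vertices. -/
def afterHelp (c : ECaller) (k l : ℤ) (v₁ v₂ : Addr) : PC :=
  match c with
  | .add => .alMark1 .ins k l v₁ v₂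
  | .rem => .alMark1 .del k l v₁ v₂
  | .con => .ceStart k l v₁

/-- Whether the validation accepts the status of a locked edge node: `AcyclicValidateEdge` asks for
`added`, `ModifiedValidateEdge` only for not `marked`. -/
def accepts : LCaller → Status → Bool
  | .del, s => decide (s = Status.added)
  | .ins, s => decide (s ≠ Status.marked)
  | .undo _, s => decide (s ≠ Status.marked)

/-- Where the edge-locating loop returns to. -/
def afterLocate (c : LCaller) (k l : ℤ) (v₁ v₂ e₁ e₂ : Addr) : PC :=
  match c with
  | .ins => .aeTest k l v₁ v₂ e₁ e₂
  | .del => .reTest k l e₁ e₂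
  | .undo e₃ => .aeMark k l v₁ v₂ e₃ e₁ e₂

/-- The program text. -/
noncomputable def code : PC → Instr
  -- LocateVertex
  | .lvStart c k => .rdVNext vHead fun b => .lvTest c k vHead b
  | .lvTest c k a b => .rdVVal b fun x => if x < key k then .lvNext c k a b else .lvLock1 c k a b
  | .lvNext c k _ b => .rdVNext b fun n => .lvTest c k b n
  | .lvLock1 c k a b => .lockV a (.lvLock2 c k a b)
  | .lvLock2 c k a b => .lockV b (.lvChk1 c k a b)
  | .lvChk1 c k a b => .rdMarked a fun m => if m then .lvFail1 c k a b else .lvChk2 c k a b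
  | .lvChk2 c k a b => .rdMarked b fun m => if m then .lvFail1 c k a b else .lvChk3 c k a b
  | .lvChk3 c k a b => .rdVNext a fun n =>
      if n = b then
        match c with
        | .add => .avTest k a b
        | .rem => .rvTest k a b
      else .lvFail1 c k a b
  | .lvFail1 c k a b => .unlockV a (.lvFail2 c k b)
  | .lvFail2 c k b => .unlockV b (.lvStart c k)
  -- AddVertex
  | .avTest k a b => .rdVVal b fun x => if x ≠ key k then .avNew k a b else .vRel1 false a b
  | .avNew k a b => .newV k fun n => .avInit k a b n
  | .avInit k a b n => .wrVNext n b (.avLink k a b n)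
  | .avLink _ a b n => .wrVNext a n (.vRel1 true a b)
  -- RemoveVertex
  | .rvTest k a b => .rdVVal b fun x => if x = key k then .rvMark k a b else .vRel1 false a b
  | .rvMark k a b => .wrMarked b (.rvRead k a b)
  | .rvRead k a b => .rdVNext b fun n => .rvUnlink k a b n
  | .rvUnlink _ a b n => .wrVNext a n (.vRel1 true a b)
  | .vRel1 f a b => .unlockV a (.vRel2 f b)
  | .vRel2 f b => .unlockV b (.done f)
  -- ContainsVertex
  | .cvTest k a => .rdVVal a fun x => if x < key k then .cvNext k a else .cvVal k a
  | .cvNext k a => .rdVNext a fun n => .cvTest k n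
  | .cvVal k a => .rdVVal a fun x => if x ≠ key k then .done false else .cvMark k a
  | .cvMark _ a => .rdMarked a fun m => .done (!m)
  -- HelpSearchEdge
  | .hsTest1 c k l a => .rdVVal a fun x =>
      if x < key (min k l) then .hsNext1 c k l a else .hsVal1 c k l a
  | .hsNext1 c k l a => .rdVNext a fun n => .hsTest1 c k l n
  | .hsVal1 c k l a => .rdVVal a fun x =>
      if x ≠ key (min k l) then .done false else .hsMark1 c k l a
  | .hsMark1 c k l a => .rdMarked a fun m => if m then .done false else .hsStart2 c k l a
  | .hsStart2 c k l a => .rdVNext a fun n => .hsTest2 c k l a n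
  | .hsTest2 c k l a b => .rdVVal b fun x =>
      if x < key (max k l) then .hsNext2 c k l a b else .hsVal2 c k l a b
  | .hsNext2 c k l a b => .rdVNext b fun n => .hsTest2 c k l a n
  | .hsVal2 c k l a b => .rdVVal b fun x =>
      if x ≠ key (max k l) then .done false else .hsMark2 c k l a b
  | .hsMark2 c k l a b => .rdMarked b fun m =>
      if m then .done false
      else if k < l then afterHelp c k l a b else afterHelp c k l b a
  -- AcyclicLocateEdge and NewLocateEdge
  | .alMark1 c k l v w => .rdMarked v fun m => if m then .done false else .alMark2 c k l v w
  | .alMark2 c k l v w => .rdMarked w fun m => if m then .done false else .leStart c k l v w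
  | .leStart c k l v w => .rdEHead v fun e => .leFirst c k l v w e
  | .leFirst c k l v w e => .rdENext e fun n => .leTest c k l v w e n
  | .leTest c k l v w e f => .rdEVal f fun x =>
      if x < key l then .leNext c k l v w e f else .leLock1 c k l v w e f
  | .leNext c k l v w _ f => .rdENext f fun n => .leTest c k l v w f n
  | .leLock1 c k l v w e f => .lockE e (.leLock2 c k l v w e f)
  | .leLock2 c k l v w e f => .lockE f (.leChk1 c k l v w e f)
  | .leChk1 c k l v w e f => .rdStatus e fun s =>
      if accepts c s then .leChk2 c k l v w e f else .leFail1 c k l v w e f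
  | .leChk2 c k l v w e f => .rdStatus f fun s =>
      if accepts c s then .leChk3 c k l v w e f else .leFail1 c k l v w e f
  | .leChk3 c k l v w e f => .rdENext e fun n =>
      if n = f then afterLocate c k l v w e f else .leFail1 c k l v w e f
  | .leFail1 c k l v w e f => .unlockE e (.leFail2 c k l v w f)
  | .leFail2 c k l v w f => .unlockE f (.leStart c k l v w)
  -- AcyclicAddEdge
  | .aeTest k l v w e f => .rdEVal f fun x =>
      if x ≠ key l then .aeNew k l v w e f else .eRel1 true e f
  | .aeNew k l v w e f => .newE l fun n => .aeInit k l v w e f n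
  | .aeInit k l v w e f n => .wrENext n f (.aeLink k l v w e f n)
  | .aeLink k l v w e f n => .wrENext e n (.aeRel1 k l v w e f n)
  | .aeRel1 k l v w e f n => .unlockE e (.aeRel2 k l v w f n)
  | .aeRel2 k l v w f n => .unlockE f (.peTest k l v w n (key l) ∅ ∅ vHead)
  | .aeAdded _ _ _ _ n => .wrStatus n Status.added (.done true)
  | .aeMark k l v w n e f => .wrStatus n Status.marked (.aeRead k l v w n e f)
  | .aeRead k l v w n e f => .rdENext n fun g => .aeUnlink k l v w n e f g
  | .aeUnlink _ _ _ _ _ e f g => .wrENext e g (.eRel1 false e f)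
  -- PathExists
  | .peTest k l v w n x R X a => .rdVVal a fun y =>
      if y < x then .peNext k l v w n x R X a else .peVal k l v w n x R X a
  | .peNext k l v w n x R X a => .rdVNext a fun b => .peTest k l v w n x R X b
  | .peVal k l v w n x R X a => .rdVVal a fun y =>
      if y ≠ x then .peLoop k l v w n R (insert x X) else .peMark k l v w n x R X a
  | .peMark k l v w n x R X a => .rdMarked a fun m =>
      if m then .peLoop k l v w n R (insert x X) else .peHead k l v w n x R X a
  | .peHead k l v w n x R X a => .rdEHead a fun e => .peEnd k l v w n x R X e
  | .peEnd k l v w n x R X e => .rdENext e fun g =>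
      if g ≠ null then .peStatus k l v w n x R X e
      else if key k ∈ R then .leStart (.undo n) k l v w
      else .peLoop k l v w n R (insert x X)
  | .peStatus k l v w n x R X e => .rdStatus e fun s =>
      if s ≠ Status.marked then .peEVal k l v w n x R X e else .peENext k l v w n x R X e
  | .peEVal k l v w n x R X e => .rdEVal e fun y => .peENext k l v w n x (insert y R) X e
  | .peENext k l v w n x R X e => .rdENext e fun g => .peEnd k l v w n x R X g
  | .peLoop k l v w n R X =>
      .pick (R \ X) (fun x => .peTest k l v w n x R X vHead) (.aeAdded k l v w n)
  -- AcyclicRemoveEdge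
  | .reTest k l e f => .rdEVal f fun x => if x = key l then .reMark k l e f else .eRel1 true e f
  | .reMark k l e f => .wrStatus f Status.marked (.reRead k l e f)
  | .reRead k l e f => .rdENext f fun n => .reUnlink k l e f n
  | .reUnlink _ _ e f n => .wrENext e n (.eRel1 true e f)
  | .eRel1 b e f => .unlockE e (.eRel2 b f)
  | .eRel2 b f => .unlockE f (.done b)
  -- AcyclicContainsEdge
  | .ceStart k l v => .rdEHead v fun e => .ceTest k l e
  | .ceTest k l e => .rdEVal e fun x => if x < key l then .ceNext k l e else .ceVal k l e
  | .ceNext k l e => .rdENext e fun n => .ceTest k l n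
  | .ceVal k l e => .rdEVal e fun x => if x ≠ key l then .done false else .ceStatus k l e
  | .ceStatus _ _ e => .rdStatus e fun s => .done (decide (s = Status.added))
  | .done b => .ret b

/-! ## Semantics -/

/-- `Exec sent t ins M M' p`: thread `t` can execute the atomic instruction `ins` in memory `M`, which
leads to `M'` and control point `p`. A dereferenced address must be allocated, a lock is acquired
only while free and released only by its holder, allocation returns unused addresses. A new vertex
node comes with an empty edge list whose two sentinels have status `sent`. -/
inductive Exec {T : Type*} (sent : Status) (t : T) : Instr → Mem T → Mem T → PC → Prop
  | rdVVal {M : Mem T} {a : Addr} {x : VNode} {c : Val → PC} (h : M.vn a = some x) :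
      Exec sent t (.rdVVal a c) M M (c x.val)
  | rdVNext {M : Mem T} {a : Addr} {x : VNode} {c : Addr → PC} (h : M.vn a = some x) :
      Exec sent t (.rdVNext a c) M M (c x.vnext)
  | rdEHead {M : Mem T} {a : Addr} {x : VNode} {c : Addr → PC} (h : M.vn a = some x) :
      Exec sent t (.rdEHead a c) M M (c x.ehead)
  | rdMarked {M : Mem T} {a : Addr} {x : VNode} {c : Bool → PC} (h : M.vn a = some x) :
      Exec sent t (.rdMarked a c) M M (c x.marked)
  | rdEVal {M : Mem T} {a : Addr} {x : ENode} {c : Val → PC} (h : M.en a = some x) :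
      Exec sent t (.rdEVal a c) M M (c x.val)
  | rdENext {M : Mem T} {a : Addr} {x : ENode} {c : Addr → PC} (h : M.en a = some x) :
      Exec sent t (.rdENext a c) M M (c x.enext)
  | rdStatus {M : Mem T} {a : Addr} {x : ENode} {c : Status → PC} (h : M.en a = some x) :
      Exec sent t (.rdStatus a c) M M (c x.status)
  | wrVNext {M : Mem T} {a b : Addr} {x : VNode} {c : PC} (h : M.vn a = some x) :
      Exec sent t (.wrVNext a b c) M
        { M with vn := Function.update M.vn a (some { x with vnext := b }) } c
  | wrMarked {M : Mem T} {a : Addr} {x : VNode} {c : PC} (h : M.vn a = some x) :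
      Exec sent t (.wrMarked a c) M
        { M with vn := Function.update M.vn a (some { x with marked := true }) } c
  | wrENext {M : Mem T} {a b : Addr} {x : ENode} {c : PC} (h : M.en a = some x) :
      Exec sent t (.wrENext a b c) M
        { M with en := Function.update M.en a (some { x with enext := b }) } c
  | wrStatus {M : Mem T} {a : Addr} {s : Status} {x : ENode} {c : PC} (h : M.en a = some x) :
      Exec sent t (.wrStatus a s c) M
        { M with en := Function.update M.en a (some { x with status := s }) } c
  | newV {M : Mem T} {k : ℤ} {a e f : Addr} {c : Addr → PC}
      (ha : a ≠ null) (he : e ≠ null) (hf : f ≠ null) (hef : e ≠ f)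
      (ha' : M.vn a = none) (he' : M.en e = none) (hf' : M.en f = none) :
      Exec sent t (.newV k c) M
        { M with
          vn := Function.update M.vn a (some ⟨key k, null, e, false⟩)
          en := Function.update (Function.update M.en e (some ⟨⊥, f, sent⟩)) f
            (some ⟨⊤, null, sent⟩) } (c a)
  | newE {M : Mem T} {k : ℤ} {e : Addr} {c : Addr → PC}
      (he : e ≠ null) (he' : M.en e = none) :
      Exec sent t (.newE k c) M
        { M with en := Function.update M.en e (some ⟨key k, null, Status.transit⟩) } (c e)
  | lockV {M : Mem T} {a : Addr} {x : VNode} {c : PC} (h : M.vn a = some x)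
      (hl : M.vlock a = none) :
      Exec sent t (.lockV a c) M { M with vlock := Function.update M.vlock a (some t) } c
  | unlockV {M : Mem T} {a : Addr} {c : PC} (hl : M.vlock a = some t) :
      Exec sent t (.unlockV a c) M { M with vlock := Function.update M.vlock a none } c
  | lockE {M : Mem T} {a : Addr} {x : ENode} {c : PC} (h : M.en a = some x)
      (hl : M.elock a = none) :
      Exec sent t (.lockE a c) M { M with elock := Function.update M.elock a (some t) } c
  | unlockE {M : Mem T} {a : Addr} {c : PC} (hl : M.elock a = some t) :
      Exec sent t (.unlockE a c) M { M with elock := Function.update M.elock a none } c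
  | pick {M : Mem T} {A : Finset Val} {x : Val} {c : Val → PC} {s : PC} (h : x ∈ A) :
      Exec sent t (.pick A c s) M M (c x)
  | pickStop {M : Mem T} {A : Finset Val} {c : Val → PC} {s : PC} (h : A = ∅) :
      Exec sent t (.pick A c s) M M s

/-- A global state: the shared memory and the control point of every thread (`none`: the thread is
not executing any method). -/
structure State (T : Type*) where
  mem : Mem T
  pc : T → Option PC

/-- The initial global state. -/
def initState (T : Type*) (sent : Status) : State T := ⟨initMem T sent, fun _ => none⟩

/-- One atomic event of thread `t`: an invocation, an instruction, or a response. -/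
inductive Step {T : Type*} [DecidableEq T] (sent : Status) (t : T) : State T → State T → Prop
  | invoke {S : State T} (op : Op) (h : S.pc t = none) :
      Step sent t S { S with pc := Function.update S.pc t (some (start op)) }
  | exec {S : State T} {p p' : PC} {M : Mem T} (h : S.pc t = some p)
      (hx : Exec sent t (code p) S.mem M p') :
      Step sent t S ⟨M, Function.update S.pc t (some p')⟩
  | respond {S : State T} {p : PC} {b : Bool} (h : S.pc t = some p) (hb : code p = .ret b) :
      Step sent t S { S with pc := Function.update S.pc t none }

/-- An execution with `len` events, starting from the initial state. Event number `i < len` is an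
event of thread `who i`, with pre-state `st i` and post-state `st (i + 1)`. -/
structure Execution (T : Type*) [DecidableEq T] (sent : Status) where
  len : ℕ
  st : ℕ → State T
  who : ℕ → T
  init : st 0 = initState T sent
  step : ∀ i < len, Step sent (who i) (st i) (st (i + 1))

/-! ## The abstract graph -/

/-- The successor relation of the vertex list. -/
def vSucc {T : Type*} (M : Mem T) (a b : Addr) : Prop := ∃ x, M.vn a = some x ∧ x.vnext = b

/-- The successor relation of the edge lists. -/
def eSucc {T : Type*} (M : Mem T) (e f : Addr) : Prop := ∃ x, M.en e = some x ∧ x.enext = f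

/-- `x` is the content of an unmarked vertex node that is reachable from `VertexHead`. -/
def IsLiveVNode {T : Type*} (M : Mem T) (x : VNode) : Prop :=
  ∃ a, Relation.ReflTransGen (vSucc M) vHead a ∧ M.vn a = some x ∧ x.marked = false

/-- The vertices of the abstract graph: the key `k` has an unmarked reachable vertex node. -/
def absV {T : Type*} (S : State T) : Set ℤ := {k | ∃ x, IsLiveVNode S.mem x ∧ x.val = key k}

/-- The edges of the abstract graph: both `k` and `l` are vertices, and the edge list of the
vertex node of `k` has an edge node with key `l` and status `added`. -/
def absE {T : Type*} (S : State T) (k l : ℤ) : Prop :=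
  l ∈ absV S ∧
    ∃ x, IsLiveVNode S.mem x ∧ x.val = key k ∧
      ∃ e y, Relation.ReflTransGen (eSucc S.mem) x.ehead e ∧ S.mem.en e = some y ∧
        y.val = key l ∧ y.status = Status.added

/-- The abstract graph has no directed cycle (in particular, no loop). -/
def AbsAcyclic {T : Type*} (S : State T) : Prop := ∀ k, ¬ Relation.TransGen (absE S) k k

/-! ## Method calls and linearization points -/

variable {T : Type*} [DecidableEq T] {sent : Status}

/-- In `E`, thread `t` invokes `AcyclicAddEdge(k, l)` at event `i`, and this call returns `b` at
event `j`. -/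
def IsAddEdgeCall (E : Execution T sent) (t : T) (k l : ℤ) (b : Bool) (i j : ℕ) : Prop :=
  i < j ∧ j < E.len ∧
    E.who i = t ∧ (E.st i).pc t = none ∧
    (E.st (i + 1)).pc t = some (start (.acyclicAddEdge k l)) ∧
    (∀ m, i < m → m ≤ j → (E.st m).pc t ≠ none) ∧
    E.who j = t ∧ (E.st j).pc t = some (.done b)

/-- Event `m` of thread `t` is `read(e₂.val)` in `AcyclicAddEdge`, or `write(e₃.status, added)`;
`v₁`, `v₂` are the vertex nodes that the call has located. -/
def IsCodePoint (E : Execution T sent) (t : T) (m : ℕ) (v₁ v₂ : Addr) : Prop :=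
  E.who m = t ∧
    ((∃ k l e₁ e₂, (E.st m).pc t = some (.aeTest k l v₁ v₂ e₁ e₂)) ∨
      ∃ k l e₃, (E.st m).pc t = some (.aeAdded k l v₁ v₂ e₃))

/-- Event `m` is the linearization point of a successful `RemoveVertex` of the vertex node `v`: the
event that marks `v`. -/
def IsRemoval (E : Execution T sent) (m : ℕ) (v : Addr) : Prop :=
  ∃ k u, (E.st m).pc (E.who m) = some (.rvMark k u v)

/-- `p` and `q` are the indices of the pre-state and of the post-state of the linearization point
of a successful `AcyclicAddEdge` call of thread `t`, invoked at event `i` and returning at event `j`.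
With `c` the last of the events `read(e₂.val)` and `write(e₃.status, added)` of the call, this is
`c` itself, or the point immediately before the first removal of one of the two vertices within the
call, whichever is earlier. -/
def IsLinPoint (E : Execution T sent) (t : T) (i j p q : ℕ) : Prop :=
  ∃ c v₁ v₂, i < c ∧ c < j ∧ IsCodePoint E t c v₁ v₂ ∧
    (∀ m, c < m → m < j → ∀ v w, ¬ IsCodePoint E t m v w) ∧
    ((p = c ∧ q = c + 1 ∧ ∀ r, i < r → r < c → ¬ (IsRemoval E r v₁ ∨ IsRemoval E r v₂)) ∨
      (p = q ∧ i < p ∧ p < c ∧ (IsRemoval E p v₁ ∨ IsRemoval E p v₂) ∧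
        ∀ r, i < r → r < p → ¬ (IsRemoval E r v₁ ∨ IsRemoval E r v₂)))

end ConcGraph

namespace ConcGraph

/-! Acyclicity holds in every global state; the linearization point matters only for the two
vertices. An invariant about `added` edges alone is not inductive, since a call finishes its search
before it writes the status. Consider instead all edge nodes, in transit or added, that are not
marked and lie in the list of an unmarked vertex node. Cycles of such edges do occur. The invariant
`CyclesNoticed` says that each of them, taken as a strongly connected set of edge nodes, contains a
node whose creator is at a control point from which it can only end by marking that node, as long as
the cycle persists.

An event closes a new cycle only by linking an edge node, and the creator of that node then still
has its whole search before it. The search cannot miss a cycle that persists: the relevant vertex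
and edge nodes stay ahead of the traversals, each explored key contributes the targets of its cycle
edges to `R`, and once every reached key is explored, `R` contains the key looked for
(`Cyclic.mem_of_closed`). So the call never gets to write `added` (`Noticing.next`). A cycle of the
abstract graph consists of added edges, whereas the noticed node is still in transit, a
contradiction (`absAcyclic_of_noticed`).

The basis is a theory of sorted lists with locks, used for the vertex list and for the edge lists.
Values are constant, marks are permanent, a marked node keeps its outgoing pointer, and a linked
node stays reachable from wherever it was reachable until it is marked (`LStep.reach_mono`). The
program is tied to this theory by auxiliary variables and one assertion per control point, in the
style of Owicki and Gries: `leads` treats the acting thread and `TInv.stable` the interference with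
the others. It is essential that a node in transit can be marked by its creator only, because
removal accepts only `added`.

For the vertices, the call has read that both located nodes are unmarked. Marks are permanent, only
removals set them, and unmarked linked nodes are reachable; so both keys are present up to the code
point or the first removal (`SeenUnmarked.unmarked`). -/

/-! ## Sorted linked lists with logical deletion -/

/-- The part of a node that matters for the structure of its list. -/
structure LNode where
  val : Val
  next : Addr
  dead : Bool

/-- A memory of list nodes. -/
abbrev Heap := Addr → Option LNode

/-- The successor relation of a heap. -/
def hSucc (h : Heap) (a b : Addr) : Prop := ∃ x, h a = some x ∧ x.next = b

/-- Reachability along `next`. -/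
abbrev Reach (h : Heap) : Addr → Addr → Prop := Relation.ReflTransGen (hSucc h)

/-- A family of linked lists with locks, together with the auxiliary variables of the proof: the
head of the list of each owner, the nodes that have ever been linked, the owner of each node, and
the thread that allocated it. -/
structure LS (T : Type*) where
  h : Heap
  lock : Addr → Option T
  hd : Addr → Option Addr
  pub : Set Addr
  own : Addr → Addr
  cr : Addr → Option T

variable {T : Type*}

/-- The effect of an event of thread `t` on a family of lists. -/
inductive LStep (t : T) (L : LS T) : LS T → Prop
  | idle (lock' : Addr → Option T)
      (hl : ∀ u ≠ t, ∀ a, L.lock a = some u → lock' a = some u) :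
      LStep t L { L with lock := lock' }
  | alloc (n : Addr) (k : Val) (o : Addr) (hn : L.h n = none) (hn0 : n ≠ null) :
      LStep t L { L with
        h := Function.update L.h n (some ⟨k, null, false⟩)
        own := Function.update L.own n o
        cr := Function.update L.cr n (some t) }
  | sentinels (o e f : Addr) (he : L.h e = none) (hf : L.h f = none) (he0 : e ≠ null)
      (hf0 : f ≠ null) (hef : e ≠ f) (ho : L.hd o = none) :
      LStep t L { L with
        h := Function.update (Function.update L.h e (some ⟨⊥, f, false⟩)) f
          (some ⟨⊤, null, false⟩)
        hd := Function.update L.hd o (some e)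
        pub := insert e (insert f L.pub)
        own := Function.update (Function.update L.own e o) f o }
  | init (n b : Addr) (k : Val) (hc : L.cr n = some t) (hp : n ∉ L.pub)
      (hn : L.h n = some ⟨k, null, false⟩) :
      LStep t L { L with h := Function.update L.h n (some ⟨k, b, false⟩) }
  | link (a n b : Addr) (ka kn : Val) (xb : LNode) (hc : L.cr n = some t) (hp : n ∉ L.pub)
      (hn : L.h n = some ⟨kn, b, false⟩) (ha : L.h a = some ⟨ka, b, false⟩) (hpa : a ∈ L.pub)
      (hpb : b ∈ L.pub) (hb : L.h b = some xb) (hla : L.lock a = some t)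
      (ho : L.own n = L.own a) (h1 : ka < kn) (h2 : kn < xb.val) :
      LStep t L { L with
        h := Function.update L.h a (some ⟨ka, n, false⟩)
        pub := insert n L.pub }
  | mark (b : Addr) (xb : LNode) (hpb : b ∈ L.pub) (hb : L.h b = some xb)
      (hlb : L.lock b = some t) :
      LStep t L { L with h := Function.update L.h b (some { xb with dead := true }) }
  | unlink (a b z : Addr) (ka kb : Val) (hpa : a ∈ L.pub) (hla : L.lock a = some t)
      (ha : L.h a = some ⟨ka, b, false⟩) (hb : L.h b = some ⟨kb, z, true⟩) (hk : kb ≠ ⊤) :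
      LStep t L { L with h := Function.update L.h a (some ⟨ka, z, false⟩) }

/-- The invariant of a family of lists. -/
structure LInv (L : LS T) : Prop where
  null : L.h null = none
  alloc : ∀ a ∈ L.pub, ∃ x, L.h a = some x
  next : ∀ a ∈ L.pub, ∀ x, L.h a = some x → (x.next = ConcGraph.null ∧ x.val = ⊤) ∨
    (x.next ∈ L.pub ∧ L.own x.next = L.own a ∧ ∃ y, L.h x.next = some y ∧ x.val < y.val)
  reach : ∀ a ∈ L.pub, ∀ x, L.h a = some x → x.dead = false →
    ∃ r, L.hd (L.own a) = some r ∧ Reach L.h r a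
  root : ∀ o r, L.hd o = some r → r ∈ L.pub ∧ L.own r = o ∧ ∃ x, L.h r = some x ∧ x.val = ⊥

/-! ### Sorted lists under a single event -/

section lists

variable {t u : T} {L L' : LS T}

theorem Reach.null_left {h : Heap} (h0 : h null = none) {c : Addr} (hr : Reach h null c) :
    c = null := by
  rcases Relation.ReflTransGen.cases_head hr with h | ⟨d, ⟨x, hx, -⟩, -⟩
  · exact h.symm
  · simp [h0] at hx

/-- A node other than the target reaches it through its successor. -/
theorem Reach.tail_of_ne {h : Heap} {a c : Addr} {x : LNode} (hr : Reach h a c)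
    (hx : h a = some x) (hne : a ≠ c) : Reach h x.next c := by
  rcases Relation.ReflTransGen.cases_head hr with h' | ⟨d, ⟨y, hy, rfl⟩, hd⟩
  · exact absurd h' hne
  · rw [hx] at hy
    cases hy
    exact hd

/-- The successor of a linked node is null or is linked with the same owner, and null has no
successor. So a traversal never strays into another list. -/
theorem LInv.reach_closed (I : LInv L) {a c : Addr} (ha : a ∈ L.pub) (hr : Reach L.h a c)
    (hc : c ≠ ConcGraph.null) : c ∈ L.pub ∧ L.own c = L.own a := by
  induction hr using Relation.ReflTransGen.head_induction_on with
  | refl => exact ⟨ha, rfl⟩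
  | head h1 h2 ih =>
    obtain ⟨x, hx, rfl⟩ := h1
    rcases I.next _ ha x hx with ⟨h0, -⟩ | ⟨h3, h4, -⟩
    · rw [h0] at h2
      exact absurd (Reach.null_left I.null h2) hc
    · obtain ⟨h5, h6⟩ := ih h3
      exact ⟨h5, h6.trans h4⟩

/-- Values increase strictly along `next`, so a nonempty path ends at a larger value. -/
theorem LInv.reach_val (I : LInv L) {a c : Addr} {x y : LNode} (ha : a ∈ L.pub)
    (hr : Reach L.h a c) (hx : L.h a = some x) (hy : L.h c = some y) :
    a = c ∨ x.val < y.val := by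
  induction hr using Relation.ReflTransGen.head_induction_on generalizing x with
  | refl => exact Or.inl rfl
  | head h1 h2 ih =>
    obtain ⟨x', hx', rfl⟩ := h1
    rw [hx] at hx'
    cases hx'
    rcases I.next _ ha x hx with ⟨h0, -⟩ | ⟨h3, -, z, hz, hlt⟩
    · rw [h0] at h2
      have := Reach.null_left I.null h2
      rw [this, I.null] at hy
      cases hy
    · rcases ih h3 hz with h5 | h5
      · rw [h5, hy] at hz
        cases hz
        exact Or.inr hlt
      · exact Or.inr (hlt.trans h5)

/-- Two nodes reachable from the same node are comparable. -/
theorem Reach.comparable {h : Heap} {r a b : Addr} (ha : Reach h r a) (hb : Reach h r b) :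
    Reach h a b ∨ Reach h b a := by
  refine Relation.ReflTransGen.total_of_right_unique ?_ ha hb
  rintro x y z ⟨u, hu, rfl⟩ ⟨v, hv, rfl⟩
  rw [hu] at hv
  cases hv
  rfl

/-- In the list of one owner, the position of a key that is present holds that key. -/
theorem LInv.position_eq (I : LInv L) {a n : Addr} {xa xb xn : LNode}
    (ha : a ∈ L.pub) (hn : n ∈ L.pub) (ho : L.own a = L.own n) (hxa : L.h a = some xa)
    (hxn : L.h n = some xn) (hma : xa.dead = false) (hmn : xn.dead = false)
    (hxb : L.h xa.next = some xb) (h1 : xa.val < xn.val) (h2 : xn.val ≤ xb.val) :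
    xa.next = n := by
  obtain ⟨r, hr, hra⟩ := I.reach a ha xa hxa hma
  obtain ⟨r', hr', hrn⟩ := I.reach n hn xn hxn hmn
  rw [← ho, hr] at hr'
  cases hr'
  have hb : xa.next ∈ L.pub := by
    rcases I.next a ha xa hxa with ⟨h0, -⟩ | h
    · rw [h0, I.null] at hxb
      cases hxb
    · exact h.1
  have han : Reach L.h a n := by
    rcases Reach.comparable hra hrn with h | h
    · exact h
    · rcases I.reach_val hn h hxn hxa with h | h
      · exact h ▸ .refl
      · exact absurd h h1.asymm
  have hne : a ≠ n := by
    rintro rfl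
    rw [hxa] at hxn
    cases hxn
    exact lt_irrefl _ h1
  -- The successor of `a` reaches `n` and its value is not below that of `n`, so it is `n`.
  rcases I.reach_val hb (han.tail_of_ne hxa hne) hxb hxn with h | h
  · exact h
  · exact absurd h h2.not_gt

theorem hSucc_update {h : Heap} {a b n : Addr} {x : LNode} (hs : hSucc h a b) (hn : a ≠ n) :
    hSucc (Function.update h n (some x)) a b := by
  obtain ⟨y, hy, rfl⟩ := hs
  exact ⟨y, by rw [Function.update_of_ne hn, hy], rfl⟩

theorem hSucc_update_self {h : Heap} {n : Addr} {x : LNode} :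
    hSucc (Function.update h n (some x)) n x.next := ⟨x, by simp, rfl⟩

theorem hSucc.eq {h : Heap} {a b : Addr} {x : LNode} (hs : hSucc h a b) (hx : h a = some x) :
    b = x.next := by
  obtain ⟨y, hy, rfl⟩ := hs
  rw [hx] at hy
  cases hy
  rfl

theorem Reach.alloc {h : Heap} {n : Addr} {x : LNode} (hn : h n = none) {a c : Addr}
    (hr : Reach h a c) : Reach (Function.update h n (some x)) a c := by
  refine Relation.ReflTransGen.mono ?_ _ _ hr
  intro a b hs
  refine hSucc_update hs ?_
  rintro rfl
  obtain ⟨y, hy, -⟩ := hs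
  rw [hn] at hy
  cases hy

theorem LStep.lock_other (s : LStep t L L') (hu : u ≠ t) {a : Addr} (h : L.lock a = some u) :
    L'.lock a = some u := by
  cases s <;> first | exact h | (rename_i hl; exact hl u hu a h)

theorem LStep.pub_mono (s : LStep t L L') {a : Addr} (h : a ∈ L.pub) : a ∈ L'.pub := by
  cases s <;> simp_all

theorem LStep.own_eq (s : LStep t L L') {a : Addr} {x : LNode} (h : L.h a = some x) :
    L'.own a = L.own a := by
  cases s with
  | alloc n k o hn hn0 =>
    exact Function.update_of_ne (by rintro rfl; simp_all) _ _
  | sentinels o e f he hf he0 hf0 hef ho =>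
    have h1 : a ≠ f := by rintro rfl; simp_all
    have h2 : a ≠ e := by rintro rfl; simp_all
    simp [Function.update_of_ne, h1, h2]
  | _ => rfl

/-- The values of nodes are constant and marks are never withdrawn. -/
theorem LStep.val_eq (s : LStep t L L') {a : Addr} {x : LNode} (h : L.h a = some x) :
    ∃ x', L'.h a = some x' ∧ x'.val = x.val ∧ (x.dead = true → x'.dead = true) := by
  -- Apart from the creation of sentinels, an event overwrites at most one node, so it suffices to
  -- compare the contents there.
  have key : ∀ (h' : Heap) (n : Addr) (y : LNode),
      (∀ z, h' n = some z → y.val = z.val ∧ (z.dead = true → y.dead = true)) → h' a = some x →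
      ∃ x', Function.update h' n (some y) a = some x' ∧ x'.val = x.val ∧
        (x.dead = true → x'.dead = true) := by
    intro h' n y hy hx
    by_cases hn : a = n
    · subst hn
      exact ⟨y, by simp, hy x hx⟩
    · exact ⟨x, by rw [Function.update_of_ne hn, hx], rfl, id⟩
  cases s with
  | idle => exact ⟨x, h, rfl, id⟩
  | sentinels o e f he hf he0 hf0 hef ho =>
    have h1 : a ≠ f := by rintro rfl; simp_all
    have h2 : a ≠ e := by rintro rfl; simp_all
    exact ⟨x, by simp [Function.update_of_ne, h1, h2, h], rfl, id⟩
  | _ => exact key _ _ _ (by simp_all) h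

/-- A linked node is not changed by other threads while a thread holds its lock. -/
theorem LStep.held_eq (s : LStep t L L') (hu : u ≠ t) {a : Addr} {x : LNode} (hp : a ∈ L.pub)
    (hl : L.lock a = some u) (h : L.h a = some x) : L'.h a = some x := by
  cases s with
  | idle => exact h
  | alloc n k o hn hn0 =>
    have h1 : a ≠ n := by rintro rfl; simp_all
    simp [Function.update_of_ne, h1, h]
  | sentinels o e f he hf he0 hf0 hef ho =>
    have h1 : a ≠ f := by rintro rfl; simp_all
    have h2 : a ≠ e := by rintro rfl; simp_all
    simp [Function.update_of_ne, h1, h2, h]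
  | init n b k hc hp' hn =>
    have h1 : a ≠ n := by rintro rfl; simp_all
    simp [Function.update_of_ne, h1, h]
  | link a' n b ka kn xb hc hp' hn ha hpa hpb hb hla ho h1 h2 =>
    have h1 : a ≠ a' := by rintro rfl; simp_all
    simp [Function.update_of_ne, h1, h]
  | mark b xb hpb hb hlb =>
    have h1 : a ≠ b := by rintro rfl; simp_all
    simp [Function.update_of_ne, h1, h]
  | unlink a' b z ka kb hpa hla ha hb hk =>
    have h1 : a ≠ a' := by rintro rfl; simp_all
    simp [Function.update_of_ne, h1, h]

theorem LStep.cr_eq (s : LStep t L L') {n : Addr} {x : LNode} (h : L.h n = some x) :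
    L'.cr n = L.cr n := by
  cases s with
  | alloc n' k o hn hn0 =>
    exact Function.update_of_ne (by rintro rfl; simp_all) _ _
  | _ => rfl

/-- A node that is not yet linked is not changed by threads other than its creator. -/
theorem LStep.private_eq (s : LStep t L L') (hu : u ≠ t) {n : Addr} {x : LNode}
    (hp : n ∉ L.pub) (hc : L.cr n = some u) (h : L.h n = some x) :
    n ∉ L'.pub ∧ L'.h n = some x := by
  cases s with
  | idle => exact ⟨hp, h⟩
  | alloc n' k o hn hn0 =>
    have h1 : n ≠ n' := by rintro rfl; simp_all
    simp [Function.update_of_ne, h1, h, hp]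
  | sentinels o e f he hf he0 hf0 hef ho =>
    have h1 : n ≠ f := by rintro rfl; simp_all
    have h2 : n ≠ e := by rintro rfl; simp_all
    simp [Function.update_of_ne, h1, h2, h, hp]
  | init n' b k hc hp' hn =>
    have h1 : n ≠ n' := by rintro rfl; simp_all
    simp [Function.update_of_ne, h1, h, hp]
  | link a' n' b ka kn xb hc hp' hn ha hpa hpb hb hla ho h1 h2 =>
    have h1 : n ≠ a' := by rintro rfl; simp_all
    have h2 : n ≠ n' := by rintro rfl; simp_all
    simp [Function.update_of_ne, h1, h2, h, hp]
  | mark b xb hpb hb hlb =>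
    have h1 : n ≠ b := by rintro rfl; simp_all
    simp [Function.update_of_ne, h1, h, hp]
  | unlink a' b z ka kb hpa hla ha hb hk =>
    have h1 : n ≠ a' := by rintro rfl; simp_all
    simp [Function.update_of_ne, h1, h, hp]

/-- Linked nodes stay reachable until they are marked. -/
theorem LStep.reach_mono (s : LStep t L L') (I : LInv L) {a c : Addr} (hr : Reach L.h a c)
    (hc : c ∈ L.pub) (hm : ∀ x, L'.h c = some x → x.dead = false) : Reach L'.h a c := by
  cases s with
  | idle => exact hr
  | alloc n k o hn hn0 => exact hr.alloc hn
  | sentinels o e f he hf he0 hf0 hef ho =>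
    exact (hr.alloc he).alloc (by rw [Function.update_of_ne hef.symm, hf])
  | init n b k hcr hp hn =>
    have hc0 : c ≠ null := by
      rintro rfl
      obtain ⟨x, hx⟩ := I.alloc _ hc
      rw [I.null] at hx
      cases hx
    induction hr using Relation.ReflTransGen.head_induction_on with
    | refl => exact .refl
    | @head d d' h1 h2 ih =>
      -- The private node still points to null, so no path to a linked node leads through it.
      by_cases hd : d = n
      · subst hd
        rw [h1.eq hn] at h2
        exact absurd (Reach.null_left I.null h2) hc0
      · exact .head (hSucc_update h1 hd) ih
  | link a' n b ka kn xb hcr hp hn ha hpa hpb hb hla ho hlt hlt' =>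
    have hna : n ≠ a' := by rintro rfl; exact hp hpa
    induction hr using Relation.ReflTransGen.head_induction_on with
    | refl => exact .refl
    | @head d d' h1 h2 ih =>
      by_cases hd : d = a'
      · subst hd
        rw [h1.eq ha] at ih
        -- The old path makes a detour through the new node.
        exact .head hSucc_update_self (.head (hSucc_update ⟨_, hn, rfl⟩ hna) ih)
      · exact .head (hSucc_update h1 hd) ih
  | mark b xb hpb hb hlb =>
    refine Relation.ReflTransGen.mono ?_ _ _ hr
    intro d d' hs
    by_cases hd : d = b
    · subst hd
      rw [hs.eq hb]
      exact hSucc_update_self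
    · exact hSucc_update hs hd
  | unlink a' b z ka kb hpa hla ha hb hk =>
    have hba : b ≠ a' := by
      rintro rfl
      rw [ha] at hb
      cases hb
    -- The bypassed node is marked and the target is not, so the path may skip it.
    have hcb : c ≠ b := by
      rintro rfl
      cases hm _ ((Function.update_of_ne hba _ _).trans hb)
    induction hr using Relation.ReflTransGen.head_induction_on with
    | refl => exact .refl
    | @head d d' h1 h2 ih =>
      by_cases hd : d = a'
      · subst hd
        rw [h1.eq ha] at ih
        refine .head hSucc_update_self ?_
        exact ih.tail_of_ne (x := ⟨kb, z, true⟩)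
          ((Function.update_of_ne hba _ _).trans hb) hcb.symm
      · exact .head (hSucc_update h1 hd) ih

/-- Old paths survive by `LStep.reach_mono`, and values and owners are constant. Only freshly linked
nodes and freshly written pointers need an argument of their own. -/
theorem LStep.inv (s : LStep t L L') (I : LInv L) : LInv L' := by
  have hne0 : ∀ a ∈ L.pub, a ≠ null := by
    rintro a ha rfl
    obtain ⟨x, hx⟩ := I.alloc _ ha
    rw [I.null] at hx
    cases hx
  -- the clauses about nodes that were linked before follow from the general facts
  have hal : ∀ a ∈ L.pub, ∃ x, L'.h a = some x := by
    intro a ha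
    obtain ⟨x, hx⟩ := I.alloc a ha
    obtain ⟨x', hx', -⟩ := s.val_eq hx
    exact ⟨x', hx'⟩
  have hhd : ∀ o r, L.hd o = some r → L'.hd o = some r := by
    intro o r h
    cases s <;> first | exact h | skip
    rename_i o' e f he hf he0 hf0 hef ho
    exact (Function.update_of_ne (by rintro rfl; simp_all) _ _).trans h
  have hre : ∀ a ∈ L.pub, ∀ x, L'.h a = some x → x.dead = false →
      ∃ r, L'.hd (L'.own a) = some r ∧ Reach L'.h r a := by
    intro a ha x hx hm
    obtain ⟨y, hy⟩ := I.alloc a ha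
    obtain ⟨x', hx', -, hxm⟩ := s.val_eq hy
    rw [hx] at hx'
    cases hx'
    have hym : y.dead = false := by
      cases hh : y.dead
      · rfl
      · rw [hxm hh] at hm
        cases hm
    obtain ⟨r, hr, hra⟩ := I.reach a ha y hy hym
    refine ⟨r, by rw [s.own_eq hy]; exact hhd _ _ hr, s.reach_mono I hra ha ?_⟩
    intro z hz
    rw [hx] at hz
    cases hz
    exact hm
  have hro : ∀ o r, L.hd o = some r →
      r ∈ L'.pub ∧ L'.own r = o ∧ ∃ x, L'.h r = some x ∧ x.val = ⊥ := by
    intro o r h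
    obtain ⟨h1, h2, x, h3, h4⟩ := I.root o r h
    obtain ⟨x', hx', hv, -⟩ := s.val_eq h3
    exact ⟨s.pub_mono h1, by rw [s.own_eq h3, h2], x', hx', hv.trans h4⟩
  -- likewise for the successors of nodes whose `next` has not changed
  have hnx : ∀ a ∈ L.pub, ∀ x, L'.h a = some x → (∃ y, L.h a = some y ∧ y.next = x.next) →
      (x.next = ConcGraph.null ∧ x.val = ⊤) ∨
      (x.next ∈ L'.pub ∧ L'.own x.next = L'.own a ∧
        ∃ y, L'.h x.next = some y ∧ x.val < y.val) := by
    rintro a ha x hx ⟨y, hy, hyx⟩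
    obtain ⟨x', hx', hv, -⟩ := s.val_eq hy
    rw [hx] at hx'
    cases hx'
    rw [← hyx, hv, s.own_eq hy]
    rcases I.next a ha y hy with h | ⟨h1, h2, z, hz, hlt⟩
    · exact Or.inl h
    · obtain ⟨z', hz', hv', -⟩ := s.val_eq hz
      exact Or.inr ⟨s.pub_mono h1, by rw [s.own_eq hz, h2], z', hz', by rw [hv']; exact hlt⟩
  have hnull : L'.h null = none := by
    have h0 := I.null
    cases s with
    | idle => exact h0
    | alloc n k o hn hn0 => exact (Function.update_of_ne hn0.symm _ _).trans h0
    | sentinels o e f he hf he0 hf0 hef ho =>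
      simp [Function.update_of_ne, he0.symm, hf0.symm, h0]
    | init n b k hcr hp hn =>
      exact (Function.update_of_ne (by rintro rfl; simp_all) _ _).trans h0
    | link a' n b ka kn xb hcr hp hn ha hpa hpb hb hla ho hlt hlt' =>
      exact (Function.update_of_ne (hne0 _ hpa).symm _ _).trans h0
    | mark b xb hpb hb hlb =>
      exact (Function.update_of_ne (hne0 _ hpb).symm _ _).trans h0
    | unlink a' b z ka kb hpa hla ha hb hk =>
      exact (Function.update_of_ne (hne0 _ hpa).symm _ _).trans h0
  cases s with
  | idle => exact ⟨hnull, hal, I.next, hre, hro⟩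
  | alloc n k o hn hn0 =>
    refine ⟨hnull, hal, fun a ha x hx => hnx a ha x hx ⟨x, ?_, rfl⟩, hre, hro⟩
    dsimp only at hx
    rwa [Function.update_of_ne] at hx
    rintro rfl
    obtain ⟨y, hy⟩ := I.alloc _ ha
    simp_all
  | sentinels o e f he hf he0 hf0 hef ho =>
    have hae : ∀ a ∈ L.pub, a ≠ e ∧ a ≠ f := by
      intro a ha
      obtain ⟨y, hy⟩ := I.alloc _ ha
      constructor <;> rintro rfl <;> simp_all
    refine ⟨hnull, ?_, ?_, ?_, ?_⟩
    · rintro a (rfl | rfl | ha)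
      · exact ⟨⟨⊥, f, false⟩, by simp [Function.update_of_ne hef]⟩
      · exact ⟨_, by simp; rfl⟩
      · exact hal a ha
    · rintro a (rfl | rfl | ha) x hx
      · simp only [Function.update_of_ne hef, Function.update_self, Option.some.injEq] at hx
        subst hx
        refine Or.inr ⟨Or.inr (Or.inl rfl), by simp [Function.update_of_ne hef], ⟨⊤, null, false⟩,
          by simp, bot_lt_top⟩
      · simp only [Function.update_self, Option.some.injEq] at hx
        subst hx
        exact Or.inl ⟨rfl, rfl⟩
      · refine hnx a ha x hx ⟨x, ?_, rfl⟩
        simpa [Function.update_of_ne, hae a ha] using hx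
    · rintro a (rfl | rfl | ha) x hx hm
      · exact ⟨a, by simp [Function.update_of_ne hef], .refl⟩
      · refine ⟨e, by simp, .single ⟨⟨⊥, a, false⟩, by simp [Function.update_of_ne hef], rfl⟩⟩
      · exact hre a ha x hx hm
    · intro o' r hr
      by_cases h : o' = o
      · subst h
        simp only [Function.update_self, Option.some.injEq] at hr
        subst hr
        exact ⟨Or.inl rfl, by simp [Function.update_of_ne hef], ⟨⊥, f, false⟩,
          by simp [Function.update_of_ne hef], rfl⟩
      · exact hro o' r (by simpa [Function.update_of_ne h] using hr)
  | init n b k hcr hp hn =>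
    refine ⟨hnull, hal, fun a ha x hx => hnx a ha x hx ⟨x, ?_, rfl⟩, hre, hro⟩
    dsimp only at hx
    rwa [Function.update_of_ne] at hx
    rintro rfl
    exact hp ha
  | link a' n b ka kn xb hcr hp hn ha' hpa hpb hb hla ho hlt hlt' =>
    have hna : n ≠ a' := by rintro rfl; exact hp hpa
    have hba : b ≠ a' := by
      rintro rfl
      rw [ha'] at hb
      cases hb
      exact (hlt.trans hlt').false
    have hown : L.own b = L.own a' := by
      rcases I.next a' hpa _ ha' with ⟨h0, -⟩ | h
      · exact absurd h0 (hne0 b hpb)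
      · exact h.2.1
    refine ⟨hnull, ?_, ?_, ?_, hro⟩
    · rintro a (rfl | ha)
      · exact ⟨_, (Function.update_of_ne hna _ _).trans hn⟩
      · exact hal a ha
    · rintro a (rfl | ha) x hx
      · dsimp only at hx
        rw [Function.update_of_ne hna, hn] at hx
        cases hx
        exact Or.inr ⟨Or.inr hpb, hown.trans ho.symm, xb,
          (Function.update_of_ne hba _ _).trans hb, hlt'⟩
      · by_cases h : a = a'
        · subst h
          simp only [Function.update_self, Option.some.injEq] at hx
          subst hx
          exact Or.inr ⟨Or.inl rfl, ho, _, (Function.update_of_ne hna _ _).trans hn, hlt⟩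
        · exact hnx a ha x hx ⟨x, by dsimp only at hx; rwa [Function.update_of_ne h] at hx, rfl⟩
    · rintro a (rfl | ha) x hx hm
      -- The new node is reached through its predecessor, which is unmarked.
      · obtain ⟨r, hr, hra⟩ := hre a' hpa ⟨ka, a, false⟩ (by simp) rfl
        exact ⟨r, by rw [← hr]; exact congrArg L.hd ho, hra.tail hSucc_update_self⟩
      · exact hre a ha x hx hm
  | mark b xb hpb hb hlb =>
    refine ⟨hnull, hal, fun a ha x hx => hnx a ha x hx ?_, hre, hro⟩
    by_cases h : a = b
    · subst h
      simp only [Function.update_self, Option.some.injEq] at hx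
      subst hx
      exact ⟨xb, hb, rfl⟩
    · exact ⟨x, by dsimp only at hx; rwa [Function.update_of_ne h] at hx, rfl⟩
  | unlink a' b z ka kb hpa hla ha' hb hk =>
    have hpb : b ∈ L.pub ∧ L.own b = L.own a' ∧ ka < kb := by
      rcases I.next a' hpa _ ha' with ⟨h0, -⟩ | ⟨h1, h2, y, hy, hlt⟩
      · simp only at h0
        rw [h0, I.null] at hb
        cases hb
      · simp only at hy
        rw [hb] at hy
        cases hy
        exact ⟨h1, h2, hlt⟩
    refine ⟨hnull, hal, fun a ha x hx => ?_, hre, hro⟩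
    by_cases h : a = a'
    · subst h
      simp only [Function.update_self, Option.some.injEq] at hx
      subst hx
      -- Only a node with value `⊤` ends a list, and such a node is never removed; so `z` is a
      -- linked node.
      rcases I.next b hpb.1 _ hb with ⟨-, h0⟩ | ⟨h1, h2, y, hy, hlt⟩
      · exact absurd h0 hk
      · refine Or.inr ⟨h1, h2.trans hpb.2.1, ?_⟩
        have hza : z ≠ a := by
          rintro rfl
          simp only at hy
          rw [ha'] at hy
          cases hy
          exact (hpb.2.2.trans hlt).false
        exact ⟨y, (Function.update_of_ne hza _ _).trans hy, hpb.2.2.trans hlt⟩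
    · exact hnx a ha x hx ⟨x, by dsimp only at hx; rwa [Function.update_of_ne h] at hx, rfl⟩

end lists

/-! ## Assertions about lists -/

section assertions

/-- `a` has been linked and its value satisfies `P`. -/
def LS.Has (L : LS T) (a : Addr) (P : Val → Prop) : Prop :=
  a ∈ L.pub ∧ ∃ x, L.h a = some x ∧ P x.val

/-- Like `LS.Has`, for a node of the list of `o`. -/
def LS.HasO (L : LS T) (o a : Addr) (P : Val → Prop) : Prop := L.Has a P ∧ L.own a = o

/-- Thread `t` holds the lock of the linked node `a`, whose content is `x`. -/
def LS.Hold (L : LS T) (t : T) (a : Addr) (x : LNode) : Prop :=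
  a ∈ L.pub ∧ L.lock a = some t ∧ L.h a = some x

/-- `a` and `b` enclose the key `k`. -/
def LS.Range (L : LS T) (k : ℤ) (a b : Addr) : Prop :=
  L.Has a (· < key k) ∧ L.Has b (key k ≤ ·)

def LS.RangeO (L : LS T) (k : ℤ) (o a b : Addr) : Prop :=
  L.HasO o a (· < key k) ∧ L.HasO o b (key k ≤ ·)

/-- Thread `t` holds the lock of an unmarked node. -/
def LS.LockedLive (L : LS T) (t : T) (a : Addr) : Prop := ∃ x, L.Hold t a x ∧ x.dead = false

/-- Thread `t` has locked the position of the key `k`. -/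
def LS.Pos (L : LS T) (t : T) (k : ℤ) (a b : Addr) : Prop :=
  ∃ ka xb, L.Hold t a ⟨ka, b, false⟩ ∧ L.Hold t b xb ∧ xb.dead = false ∧ ka < key k ∧
    key k ≤ xb.val

/-- Thread `t` has locked the position of the key `k`, which is absent. -/
def LS.Ins (L : LS T) (t : T) (k : ℤ) (a b : Addr) : Prop :=
  ∃ ka xb, L.Hold t a ⟨ka, b, false⟩ ∧ L.Hold t b xb ∧ ka < key k ∧ key k < xb.val

/-- Thread `t` has locked the node `b` with key `k` and its predecessor `a`. -/
def LS.Del (L : LS T) (t : T) (k : ℤ) (a b z : Addr) (d : Bool) : Prop :=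
  ∃ ka, L.Hold t a ⟨ka, b, false⟩ ∧ L.Hold t b ⟨key k, z, d⟩

/-- The node `n` has been allocated by thread `t` and is not yet linked. -/
def LS.Priv (L : LS T) (t : T) (n o : Addr) (x : LNode) : Prop :=
  n ∉ L.pub ∧ L.cr n = some t ∧ L.own n = o ∧ L.h n = some x

variable {t u : T} {L L' : LS T} {a b n o z : Addr} {k : ℤ} {d : Bool} {P : Val → Prop}
  {x : LNode}

/-- Being linked and having a certain value never expire, so no lock is needed and it does not
matter which thread acts. -/
theorem LS.Has.mono (s : LStep t L L') (h : L.Has a P) : L'.Has a P := by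
  obtain ⟨hp, x, hx, hP⟩ := h
  obtain ⟨x', hx', hv, -⟩ := s.val_eq hx
  exact ⟨s.pub_mono hp, x', hx', hv ▸ hP⟩

theorem LS.HasO.mono (s : LStep t L L') (h : L.HasO o a P) : L'.HasO o a P := by
  obtain ⟨h, rfl⟩ := h
  obtain ⟨x, hx, -⟩ := h.2
  exact ⟨h.mono s, s.own_eq hx⟩

theorem LS.Range.mono (s : LStep t L L') (h : L.Range k a b) : L'.Range k a b :=
  ⟨h.1.mono s, h.2.mono s⟩

theorem LS.RangeO.mono (s : LStep t L L') (h : L.RangeO k o a b) : L'.RangeO k o a b :=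
  ⟨h.1.mono s, h.2.mono s⟩

/-- The lock freezes the content of the node against all other threads. The assertions built on
`LS.Hold` inherit their stability from this. -/
theorem LS.Hold.stable (s : LStep t L L') (hu : u ≠ t) (h : L.Hold u a x) : L'.Hold u a x :=
  ⟨s.pub_mono h.1, s.lock_other hu h.2.1, s.held_eq hu h.1 h.2.1 h.2.2⟩

theorem LS.LockedLive.stable (s : LStep t L L') (hu : u ≠ t) (h : L.LockedLive u a) :
    L'.LockedLive u a := by
  obtain ⟨x, h1, h2⟩ := h
  exact ⟨x, h1.stable s hu, h2⟩

theorem LS.Pos.stable (s : LStep t L L') (hu : u ≠ t) (h : L.Pos u k a b) : L'.Pos u k a b := by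
  obtain ⟨ka, xb, h1, h2, h3⟩ := h
  exact ⟨ka, xb, h1.stable s hu, h2.stable s hu, h3⟩

theorem LS.Ins.stable (s : LStep t L L') (hu : u ≠ t) (h : L.Ins u k a b) : L'.Ins u k a b := by
  obtain ⟨ka, xb, h1, h2, h3⟩ := h
  exact ⟨ka, xb, h1.stable s hu, h2.stable s hu, h3⟩

theorem LS.Del.stable (s : LStep t L L') (hu : u ≠ t) (h : L.Del u k a b z d) :
    L'.Del u k a b z d := by
  obtain ⟨ka, h1, h2⟩ := h
  exact ⟨ka, h1.stable s hu, h2.stable s hu⟩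

theorem LS.Priv.stable (s : LStep t L L') (hu : u ≠ t) (h : L.Priv u n o x) :
    L'.Priv u n o x := by
  obtain ⟨h1, h2, h3, h4⟩ := h
  obtain ⟨h5, h6⟩ := s.private_eq hu h1 h2 h4
  exact ⟨h5, (s.cr_eq h4).trans h2, (s.own_eq h4).trans h3, h6⟩

theorem LS.Has.val (h : L.Has a P) (hx : L.h a = some x) : P x.val := by
  obtain ⟨-, y, hy, hP⟩ := h
  rw [hx] at hy
  cases hy
  exact hP

theorem LS.Has.and (h : L.Has a P) (hx : L.h a = some x) {Q : Val → Prop} (hQ : Q x.val) :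
    L.Has a Q := ⟨h.1, x, hx, hQ⟩

/-- The position of a key is not affected by changes of unlinked nodes. -/
theorem LS.Ins.congr (h : L.Ins t k a b) (hp : L'.pub = L.pub) (hl : L'.lock = L.lock)
    (hh : ∀ a ∈ L.pub, L'.h a = L.h a) : L'.Ins t k a b := by
  obtain ⟨ka, xb, ⟨h1, h2, h3⟩, ⟨h4, h5, h6⟩, h7⟩ := h
  exact ⟨ka, xb, ⟨hp ▸ h1, hl ▸ h2, (hh _ h1).trans h3⟩, ⟨hp ▸ h4, hl ▸ h5, (hh _ h4).trans h6⟩, h7⟩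

theorem LS.Pos.del (h : L.Pos t k a b) (hx : L.h b = some x) (hv : x.val = key k) :
    L.Del t k a b x.next false := by
  obtain ⟨ka, xb, h1, ⟨h2, h3, h4⟩, h5, -⟩ := h
  rw [hx] at h4
  cases h4
  refine ⟨ka, h1, h2, h3, ?_⟩
  rw [hx, ← hv, ← h5]

theorem LS.Pos.ins (h : L.Pos t k a b) (hx : L.h b = some x) (hv : x.val ≠ key k) :
    L.Ins t k a b := by
  obtain ⟨ka, xb, h1, ⟨h2, h3, h4⟩, h5, h6, h7⟩ := h
  rw [hx] at h4
  cases h4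
  exact ⟨ka, x, h1, ⟨h2, h3, hx⟩, h6, lt_of_le_of_ne h7 (Ne.symm hv)⟩

/-- This is what validation achieves: the search without locks provides only the constant values,
and the reads under both locks add adjacency and the absence of marks. -/
theorem LS.Range.pos (h : L.Range k a b) (ha : L.LockedLive t a) (hb : L.LockedLive t b)
    (hx : L.h a = some x) (hn : x.next = b) : L.Pos t k a b := by
  obtain ⟨xa, ha, hda⟩ := ha
  obtain ⟨xb, hb, hdb⟩ := hb
  have h3 := ha.2.2
  rw [hx] at h3
  cases h3
  refine ⟨x.val, xb, ?_, hb, hdb, h.1.val hx, h.2.val hb.2.2⟩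
  rw [← hn, ← hda]
  exact ha

end assertions

/-! ## The invariant -/

/-- The auxiliary variables of one kind of lists. -/
structure LGhost (T : Type*) where
  pub : Set Addr
  own : Addr → Addr
  cr : Addr → Option T

/-- The auxiliary variables. The vertex list has the owner `0`, and the owner of an edge node is
the address of its vertex node. -/
structure Ghost (T : Type*) where
  v : LGhost T
  e : LGhost T

def vHeapOf (f : Addr → Option VNode) : Heap :=
  fun a => (f a).map fun x => ⟨x.val, x.vnext, x.marked⟩

/-- Nodes in transit count as alive, so the write of `added` is invisible at the level of lists. -/
def eHeapOf (f : Addr → Option ENode) : Heap :=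
  fun a => (f a).map fun x => ⟨x.val, x.enext, decide (x.status = Status.marked)⟩

def headOf (f : Addr → Option VNode) : Addr → Option Addr := fun a => (f a).map VNode.ehead

/-- The vertex list. -/
def vLS (M : Mem T) (g : Ghost T) : LS T :=
  ⟨vHeapOf M.vn, M.vlock, fun o => if o = 0 then some vHead else none, g.v.pub, g.v.own, g.v.cr⟩

/-- The edge lists. -/
def eLS (M : Mem T) (g : Ghost T) : LS T :=
  ⟨eHeapOf M.en, M.elock, headOf M.vn, g.e.pub, g.e.own, g.e.cr⟩

/-- The call has located the vertex nodes `v` and `w`. -/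
def Located (M : Mem T) (g : Ghost T) (k l : ℤ) (v w : Addr) : Prop :=
  (vLS M g).Has v (· = key k) ∧ (vLS M g).Has w (· = key l)

/-- `n` is the edge node, with key `l` and status `transit`, that thread `t` has linked in the list
of `v`. -/
def InTransit (M : Mem T) (g : Ghost T) (t : T) (l : ℤ) (v n : Addr) : Prop :=
  n ∈ g.e.pub ∧ g.e.own n = v ∧ g.e.cr n = some t ∧
    ∃ x, M.en n = some x ∧ x.val = key l ∧ x.status = Status.transit

/-- Only a call that takes back its node has to know that this node is still in transit, in order to
recognize it at the position found. -/
def LCaller.Inv (M : Mem T) (g : Ghost T) (t : T) (l : ℤ) (v : Addr) : LCaller → Prop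
  | .undo n => InTransit M g t l v n
  | _ => True

/-- Thread `t` holds the lock of the edge node `e`, whose status the validation accepts. -/
def Accepted (M : Mem T) (g : Ghost T) (t : T) (c : LCaller) (e : Addr) : Prop :=
  e ∈ g.e.pub ∧ M.elock e = some t ∧ ∃ x, M.en e = some x ∧ accepts c x.status = true

/-- Supplements `LS.Priv`, which cannot tell transit from added. -/
def HasTransit (M : Mem T) (n : Addr) : Prop :=
  ∃ x, M.en n = some x ∧ x.status = Status.transit

/-- What holds while thread `t` is at a control point. -/
def TInv (M : Mem T) (g : Ghost T) (t : T) : PC → Prop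
  | .lvTest _ k a b => (vLS M g).Has a (· < key k) ∧ (vLS M g).Has b fun _ => True
  | .lvNext _ k _ b => (vLS M g).Has b (· < key k)
  | .lvLock1 _ k a b => (vLS M g).Range k a b
  | .lvLock2 _ k a b => (vLS M g).Range k a b ∧ M.vlock a = some t
  | .lvChk1 _ k a b => (vLS M g).Range k a b ∧ M.vlock a = some t ∧ M.vlock b = some t
  | .lvChk2 _ k a b => (vLS M g).Range k a b ∧ (vLS M g).LockedLive t a ∧ M.vlock b = some t
  | .lvChk3 _ k a b =>
      (vLS M g).Range k a b ∧ (vLS M g).LockedLive t a ∧ (vLS M g).LockedLive t b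
  | .avTest k a b | .rvTest k a b => (vLS M g).Pos t k a b
  | .avNew k a b => (vLS M g).Ins t k a b
  | .avInit k a b n => (vLS M g).Ins t k a b ∧ (vLS M g).Priv t n 0 ⟨key k, null, false⟩
  | .avLink k a b n => (vLS M g).Ins t k a b ∧ (vLS M g).Priv t n 0 ⟨key k, b, false⟩
  | .rvMark k a b => ∃ z, (vLS M g).Del t k a b z false
  | .rvRead k a b => ∃ z, (vLS M g).Del t k a b z true
  | .rvUnlink k a b z => (vLS M g).Del t k a b z true
  | .hsTest1 _ _ _ a => (vLS M g).Has a fun _ => True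
  | .hsNext1 _ k l a => (vLS M g).Has a (· < key (min k l))
  | .hsVal1 _ _ _ a => (vLS M g).Has a fun _ => True
  | .hsMark1 _ k l a => (vLS M g).Has a (· = key (min k l))
  | .hsStart2 _ k l a => (vLS M g).Has a (· = key (min k l))
  | .hsTest2 _ k l a b =>
      (vLS M g).Has a (· = key (min k l)) ∧ (vLS M g).Has b fun _ => True
  | .hsNext2 _ k l a b =>
      (vLS M g).Has a (· = key (min k l)) ∧ (vLS M g).Has b (· < key (max k l))
  | .hsVal2 _ k l a b =>
      (vLS M g).Has a (· = key (min k l)) ∧ (vLS M g).Has b fun _ => True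
  | .hsMark2 _ k l a b =>
      (vLS M g).Has a (· = key (min k l)) ∧ (vLS M g).Has b (· = key (max k l))
  | .alMark1 c k l v w | .alMark2 c k l v w | .leStart c k l v w | .leFail1 c k l v w _ _
  | .leFail2 c k l v w _ =>
      -- The trailing `True` keeps the middle assertion at the projection `.2.1`, as at the control
      -- points where further conjuncts follow.
      Located M g k l v w ∧ (c.Inv M g t l v ∧ True)
  | .leFirst c k l v w e =>
      Located M g k l v w ∧ c.Inv M g t l v ∧ (eLS M g).HasO v e (· < key l)
  | .leTest c k l v w e f =>
      Located M g k l v w ∧ c.Inv M g t l v ∧ (eLS M g).HasO v e (· < key l) ∧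
        (eLS M g).HasO v f fun _ => True
  | .leNext c k l v w _ f =>
      Located M g k l v w ∧ c.Inv M g t l v ∧ (eLS M g).HasO v f (· < key l)
  | .leLock1 c k l v w e f =>
      Located M g k l v w ∧ c.Inv M g t l v ∧ (eLS M g).RangeO l v e f
  | .leLock2 c k l v w e f =>
      Located M g k l v w ∧ c.Inv M g t l v ∧ (eLS M g).RangeO l v e f ∧ M.elock e = some t
  | .leChk1 c k l v w e f =>
      Located M g k l v w ∧ c.Inv M g t l v ∧ (eLS M g).RangeO l v e f ∧ M.elock e = some t ∧
        M.elock f = some t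
  | .leChk2 c k l v w e f =>
      Located M g k l v w ∧ c.Inv M g t l v ∧ (eLS M g).RangeO l v e f ∧
        Accepted M g t c e ∧ M.elock f = some t
  | .leChk3 c k l v w e f =>
      Located M g k l v w ∧ c.Inv M g t l v ∧ (eLS M g).RangeO l v e f ∧
        Accepted M g t c e ∧ Accepted M g t c f
  | .aeTest k l v w e f =>
      Located M g k l v w ∧ (eLS M g).RangeO l v e f ∧ (eLS M g).Pos t l e f
  | .aeNew k l v w e f =>
      Located M g k l v w ∧ (eLS M g).RangeO l v e f ∧ (eLS M g).Ins t l e f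
  | .aeInit k l v w e f n =>
      Located M g k l v w ∧ (eLS M g).RangeO l v e f ∧ (eLS M g).Ins t l e f ∧
        (eLS M g).Priv t n v ⟨key l, null, false⟩ ∧ HasTransit M n
  | .aeLink k l v w e f n =>
      Located M g k l v w ∧ (eLS M g).RangeO l v e f ∧ (eLS M g).Ins t l e f ∧
        (eLS M g).Priv t n v ⟨key l, f, false⟩ ∧ HasTransit M n
  | .aeMark k l v w n e f =>
      Located M g k l v w ∧ InTransit M g t l v n ∧ n = f ∧ ∃ z, (eLS M g).Del t l e f z false
  | .aeRead _ l _ _ n e f => n = f ∧ ∃ z, (eLS M g).Del t l e f z true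
  | .aeUnlink _ l _ _ n e f z => n = f ∧ (eLS M g).Del t l e f z true
  | .aeRel1 k l v w _ _ n | .aeRel2 k l v w _ n | .aeAdded k l v w n
  | .peTest k l v w n _ _ _ _ | .peNext k l v w n _ _ _ _ | .peVal k l v w n _ _ _ _
  | .peMark k l v w n _ _ _ _ | .peHead k l v w n _ _ _ _ | .peEnd k l v w n _ _ _ _
  | .peStatus k l v w n _ _ _ _ | .peEVal k l v w n _ _ _ _ | .peENext k l v w n _ _ _ _
  | .peLoop k l v w n _ _ => Located M g k l v w ∧ (InTransit M g t l v n ∧ True)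
  | .reTest _ l e f => (eLS M g).Pos t l e f ∧ Accepted M g t .del f
  | .reMark _ l e f => (∃ z, (eLS M g).Del t l e f z false) ∧ Accepted M g t .del f
  | .reRead _ l e f => ∃ z, (eLS M g).Del t l e f z true
  | .reUnlink _ l e f z => (eLS M g).Del t l e f z true
  | _ => True

/-- The invariant of the global states. -/
structure Inv (g : Ghost T) (S : State T) : Prop where
  v : LInv (vLS S.mem g)
  e : LInv (eLS S.mem g)
  owner : ∀ e ∈ g.e.pub, ∀ x, S.mem.en e = some x → (∃ l, x.val = key l) → g.e.own e ∈ g.v.pub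
  thread : ∀ t p, S.pc t = some p → TInv S.mem g t p

/-- The changes of edge nodes by an event of thread `t`. -/
def StatusStep (t : T) (g : Ghost T) (M M' : Mem T) : Prop :=
  ∀ e x, M.en e = some x → ∃ x', M'.en e = some x' ∧ x'.val = x.val ∧
    (x'.status = x.status ∨
      (x.status = Status.transit ∧ x'.status = Status.added ∧ g.e.cr e = some t) ∨
      (x'.status = Status.marked ∧ M.elock e = some t ∧
        (x.status = Status.added ∨ g.e.cr e = some t)))

/-- The effect of an event of thread `t` on the memory and the auxiliary variables. -/
structure Effect (t : T) (g : Ghost T) (M : Mem T) (g' : Ghost T) (M' : Mem T) : Prop where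
  v : LStep t (vLS M g) (vLS M' g')
  e : LStep t (eLS M g) (eLS M' g')
  st : StatusStep t g M M'

/-! ### Assertions under events of other threads -/

section stability

variable {t u : T} {g g' : Ghost T} {M M' : Mem T} {k l : ℤ} {v w n e : Addr} {c : LCaller}

theorem vLS_h {x : VNode} (h : M.vn v = some x) :
    (vLS M g).h v = some ⟨x.val, x.vnext, x.marked⟩ := by
  simp [vLS, vHeapOf, h]

theorem eLS_h {x : ENode} (h : M.en e = some x) :
    (eLS M g).h e = some ⟨x.val, x.enext, decide (x.status = Status.marked)⟩ := by
  simp [eLS, eHeapOf, h]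

theorem exists_vn {y : LNode} (h : (vLS M g).h v = some y) :
    ∃ x, M.vn v = some x ∧ x.val = y.val ∧ x.vnext = y.next ∧ x.marked = y.dead := by
  simp only [vLS, vHeapOf, Option.map_eq_some_iff] at h
  obtain ⟨x, hx, rfl⟩ := h
  exact ⟨x, hx, rfl, rfl, rfl⟩

theorem exists_en {y : LNode} (h : (eLS M g).h e = some y) :
    ∃ x, M.en e = some x ∧ x.val = y.val ∧ x.enext = y.next ∧
      decide (x.status = Status.marked) = y.dead := by
  simp only [eLS, eHeapOf, Option.map_eq_some_iff] at h
  obtain ⟨x, hx, rfl⟩ := h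
  exact ⟨x, hx, rfl, rfl, rfl⟩

theorem Located.mono (s : Effect t g M g' M') (h : Located M g k l v w) :
    Located M' g' k l v w := ⟨h.1.mono s.v, h.2.mono s.v⟩

/-- Another thread may mark only nodes that are `added` or its own, and may set `added` only on its
own nodes. A node in transit is thus at the sole disposal of its creator. -/
theorem InTransit.stable (s : Effect t g M g' M') (hu : u ≠ t) (h : InTransit M g u l v n) :
    InTransit M' g' u l v n := by
  obtain ⟨h1, h2, h3, x, h4, h5, h6⟩ := h
  obtain ⟨x', h7, h8, h9⟩ := s.st n x h4
  refine ⟨s.e.pub_mono h1, (s.e.own_eq (eLS_h h4)).trans h2, (s.e.cr_eq (eLS_h h4)).trans h3,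
    x', h7, h8.trans h5, ?_⟩
  have hcr : g.e.cr n ≠ some t := by
    rw [h3]
    simpa using hu
  rcases h9 with h | ⟨-, -, h⟩ | ⟨-, -, h | h⟩
  · exact h.trans h6
  · exact absurd h hcr
  · rw [h6] at h
    cases h
  · exact absurd h hcr

theorem LCaller.Inv.stable (s : Effect t g M g' M') (hu : u ≠ t) (h : c.Inv M g u l v) :
    c.Inv M' g' u l v := by
  cases c with
  | undo n => exact InTransit.stable s hu h
  | _ => trivial

/-- The lock keeps others from marking the node. The one status change left to them, from transit to
`added`, leaves the node acceptable to every caller. -/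
theorem Accepted.stable (s : Effect t g M g' M') (hu : u ≠ t) (h : Accepted M g u c e) :
    Accepted M' g' u c e := by
  obtain ⟨h1, h2, x, h3, h4⟩ := h
  obtain ⟨x', h7, -, h9⟩ := s.st e x h3
  refine ⟨s.e.pub_mono h1, s.e.lock_other hu h2, x', h7, ?_⟩
  rcases h9 with h | ⟨h5, h6, -⟩ | ⟨-, h, -⟩
  · rwa [h]
  · rw [h6]
    cases c <;> rfl
  · rw [h2] at h
    exact absurd (Option.some.inj h) hu

theorem HasTransit.stable (s : Effect t g M g' M') (hu : u ≠ t) (hc : g.e.cr n = some u)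
    (h : HasTransit M n) : HasTransit M' n := by
  obtain ⟨x, h4, h6⟩ := h
  obtain ⟨x', h7, h8, h9⟩ := s.st n x h4
  refine ⟨x', h7, ?_⟩
  have hcr : g.e.cr n ≠ some t := by
    rw [hc]
    simpa using hu
  rcases h9 with h | ⟨-, -, h⟩ | ⟨-, -, h | h⟩
  · exact h.trans h6
  · exact absurd h hcr
  · rw [h6] at h
    cases h
  · exact absurd h hcr

/-- The assertions of other threads are not affected by an event of thread `t`. -/
theorem TInv.stable (s : Effect t g M g' M') (hu : u ≠ t) {p : PC} (h : TInv M g u p) :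
    TInv M' g' u p := by
  have hvl : ∀ a, M.vlock a = some u → M'.vlock a = some u := fun a => s.v.lock_other hu
  have hel : ∀ a, M.elock a = some u → M'.elock a = some u := fun a => s.e.lock_other hu
  cases p
  -- `HasTransit` is stable only because `LS.Priv` names the creator, so this assertion cannot be
  -- treated conjunct by conjunct.
  case aeInit =>
    obtain ⟨h1, h2, h3, h4, h5⟩ := h
    exact ⟨h1.mono s, h2.mono s.e, h3.stable s.e hu, h4.stable s.e hu, h5.stable s hu h4.2.1⟩
  case aeLink =>
    obtain ⟨h1, h2, h3, h4, h5⟩ := h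
    exact ⟨h1.mono s, h2.mono s.e, h3.stable s.e hu, h4.stable s.e hu, h5.stable s hu h4.2.1⟩
  all_goals
    first
      | trivial
      | (simp only [TInv] at h ⊢
         revert h
         repeat'
          first
            | exact id
            | exact hvl _
            | exact hel _
            | exact LS.Has.mono s.v
            | exact LS.HasO.mono s.v
            | exact LS.HasO.mono s.e
            | exact LS.Range.mono s.v
            | exact LS.RangeO.mono s.e
            | exact LS.LockedLive.stable s.v hu
            | exact LS.Pos.stable s.v hu
            | exact LS.Ins.stable s.v hu
            | exact LS.Del.stable s.v hu
            | exact LS.Priv.stable s.v hu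
            | exact LS.Pos.stable s.e hu
            | exact LS.Ins.stable s.e hu
            | exact LS.Del.stable s.e hu
            | exact Located.mono s
            | exact InTransit.stable s hu
            | exact LCaller.Inv.stable s hu
            | exact Accepted.stable s hu
            | refine And.imp ?_ ?_
            | refine Exists.imp fun _ => ?_)

end stability

/-! ### Effects of writes, allocations and locks -/

section effects

variable {t : T} {g g' : Ghost T} {M M' : Mem T} {L : LS T} {a b : Addr} {k : ℤ}

theorem key_ne_top (k : ℤ) : key k ≠ ⊤ := by
  simp only [key]
  exact fun h => WithTop.coe_ne_top (WithBot.coe_injective h)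

theorem key_ne_bot (k : ℤ) : key k ≠ ⊥ := WithBot.coe_ne_bot

theorem bot_lt_key (k : ℤ) : ⊥ < key k := WithBot.bot_lt_coe _

theorem ne_top_of_lt_key {x : Val} (h : x < key k) : x ≠ ⊤ := by
  rintro rfl
  exact not_top_lt h

theorem LInv.next_hasO (I : LInv L) (hp : a ∈ L.pub) {x : LNode} (hx : L.h a = some x)
    (hv : x.val ≠ ⊤) : L.HasO (L.own a) x.next fun _ => True := by
  rcases I.next a hp x hx with ⟨-, h⟩ | ⟨h1, h2, y, hy, -⟩
  · exact absurd h hv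
  · exact ⟨⟨h1, y, hy, trivial⟩, h2⟩

theorem LStep.refl : LStep t L L := .idle L.lock fun _ _ _ h => h

theorem vHeapOf_update (f : Addr → Option VNode) (a : Addr) (x : VNode) :
    vHeapOf (Function.update f a (some x)) =
      Function.update (vHeapOf f) a (some ⟨x.val, x.vnext, x.marked⟩) := by
  funext b
  by_cases h : b = a
  · subst h; simp [vHeapOf]
  · simp [vHeapOf, Function.update_of_ne h]

theorem eHeapOf_update (f : Addr → Option ENode) (a : Addr) (x : ENode) :
    eHeapOf (Function.update f a (some x)) =
      Function.update (eHeapOf f) a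
        (some ⟨x.val, x.enext, decide (x.status = Status.marked)⟩) := by
  funext b
  by_cases h : b = a
  · subst h; simp [eHeapOf]
  · simp [eHeapOf, Function.update_of_ne h]

theorem headOf_update (f : Addr → Option VNode) (a : Addr) (x : VNode) :
    headOf (Function.update f a (some x)) = Function.update (headOf f) a (some x.ehead) := by
  funext b
  by_cases h : b = a
  · subst h; simp [headOf]
  · simp [headOf, Function.update_of_ne h]

theorem StatusStep.of_eq (h : M'.en = M.en) : StatusStep t g M M' :=
  fun e x hx => ⟨x, by rw [h, hx], rfl, Or.inl rfl⟩

theorem Effect.refl : Effect t g M g M := ⟨.refl, .refl, .of_eq rfl⟩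

theorem lock_update {lock : Addr → Option T} {o : Option T}
    (h : lock a = none ∨ lock a = some t) :
    ∀ u ≠ t, ∀ b, lock b = some u → Function.update lock a o b = some u := by
  intro u hu b hb
  rw [Function.update_of_ne, hb]
  rintro rfl
  rw [hb] at h
  rcases h with h | h
  · cases h
  · exact hu (Option.some.inj h)

theorem Effect.vlock {o : Option T} (h : M.vlock a = none ∨ M.vlock a = some t) :
    Effect t g M g { M with vlock := Function.update M.vlock a o } :=
  ⟨LStep.idle (L := vLS M g) _ (lock_update h), .refl, .of_eq rfl⟩

theorem Effect.elock {o : Option T} (h : M.elock a = none ∨ M.elock a = some t) :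
    Effect t g M g { M with elock := Function.update M.elock a o } :=
  ⟨.refl, LStep.idle (L := eLS M g) _ (lock_update h), .of_eq rfl⟩

/-- The set `P` leaves room for a node that the write links; the premise on `ehead` keeps the heads
of the edge lists fixed. -/
theorem Effect.vn {x y : VNode} {P : Set Addr} (h : M.vn a = some x) (hy : y.ehead = x.ehead)
    (s : LStep t (vLS M g) { vLS M g with
      h := Function.update (vLS M g).h a (some ⟨y.val, y.vnext, y.marked⟩)
      pub := P }) :
    Effect t g M { g with v := { g.v with pub := P } }
      { M with vn := Function.update M.vn a (some y) } := by
  refine ⟨?_, ?_, .of_eq rfl⟩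
  · simpa only [vLS, vHeapOf_update] using s
  · have : headOf (Function.update M.vn a (some y)) = headOf M.vn := by
      rw [headOf_update, hy, Function.update_eq_self_iff]
      simp [headOf, h]
    simp only [eLS, this]
    exact .refl

theorem Effect.en {x y : ENode} {P : Set Addr} (h : M.en a = some x) (hv : y.val = x.val)
    (hs : y.status = x.status ∨
      (x.status = Status.transit ∧ y.status = Status.added ∧ g.e.cr a = some t) ∨
      (y.status = Status.marked ∧ M.elock a = some t ∧
        (x.status = Status.added ∨ g.e.cr a = some t)))
    (s : LStep t (eLS M g) { eLS M g with
      h := Function.update (eLS M g).h a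
        (some ⟨y.val, y.enext, decide (y.status = Status.marked)⟩)
      pub := P }) :
    Effect t g M { g with e := { g.e with pub := P } }
      { M with en := Function.update M.en a (some y) } := by
  refine ⟨.refl, ?_, ?_⟩
  · simpa only [eLS, eHeapOf_update] using s
  · intro e z hz
    by_cases he : e = a
    · subst he
      rw [h] at hz
      cases hz
      exact ⟨y, by simp, hv, hs⟩
    · exact ⟨z, by simp [Function.update_of_ne he, hz], rfl, Or.inl rfl⟩

theorem Effect.newE {n : Addr} (o : Addr) (h : M.en n = none) (h0 : n ≠ null) (l : ℤ) :
    Effect t g M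
      { g with e := { g.e with
          own := Function.update g.e.own n o, cr := Function.update g.e.cr n (some t) } }
      { M with en := Function.update M.en n (some ⟨key l, null, Status.transit⟩) } := by
  refine ⟨.refl, ?_, ?_⟩
  · have := LStep.alloc (t := t) (L := eLS M g) n (key l) o (by simp [eLS, eHeapOf, h]) h0
    simpa [eLS, eHeapOf_update] using this
  · intro e z hz
    refine ⟨z, ?_, rfl, Or.inl rfl⟩
    rw [← hz]
    exact Function.update_of_ne (by rintro rfl; simp_all) _ _

/-- To the vertex list this is a mere allocation; to the edge lists it opens a complete new list,
owned by the new address. The status `sent` must not be `marked` because `LStep.sentinels` creates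
live nodes. -/
theorem Effect.newV {sent : Status} (hsent : sent ≠ Status.marked) {a e f : Addr}
    (ha : a ≠ null) (he : e ≠ null) (hf : f ≠ null) (hef : e ≠ f)
    (ha' : M.vn a = none) (he' : M.en e = none) (hf' : M.en f = none) (k : ℤ) :
    Effect t g M
      { v := { g.v with
          own := Function.update g.v.own a 0, cr := Function.update g.v.cr a (some t) }
        e := { g.e with
          pub := insert e (insert f g.e.pub)
          own := Function.update (Function.update g.e.own e a) f a } }
      { M with
        vn := Function.update M.vn a (some ⟨key k, null, e, false⟩)
        en := Function.update (Function.update M.en e (some ⟨⊥, f, sent⟩)) f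
          (some ⟨⊤, null, sent⟩) } := by
  refine ⟨?_, ?_, ?_⟩
  · have := LStep.alloc (t := t) (L := vLS M g) a (key k) 0 (by simp [vLS, vHeapOf, ha']) ha
    simpa [vLS, vHeapOf_update] using this
  · have := LStep.sentinels (t := t) (L := eLS M g) a e f (by simp [eLS, eHeapOf, he'])
      (by simp [eLS, eHeapOf, hf']) he hf hef (by simp [eLS, headOf, ha'])
    simpa [eLS, eHeapOf_update, headOf_update, hsent] using this
  · intro e' z hz
    refine ⟨z, ?_, rfl, Or.inl rfl⟩
    rw [← hz]
    have h1 : e' ≠ e := by rintro rfl; simp_all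
    have h2 : e' ≠ f := by rintro rfl; simp_all
    simp [Function.update_of_ne, h1, h2]

theorem LS.RangeO.range {o : Addr} (h : L.RangeO k o a b) : L.Range k a b := ⟨h.1.1, h.2.1⟩

theorem Accepted.live {c : LCaller} (h : Accepted M g t c a) : (eLS M g).LockedLive t a := by
  obtain ⟨h1, h2, x, h3, h4⟩ := h
  refine ⟨_, ⟨h1, h2, eLS_h h3⟩, ?_⟩
  cases c <;> simp_all [accepts]

/-- The linked nodes that have become so by a step that ends at the control point `p`. -/
def NewPub (g g' : Ghost T) (M' : Mem T) (p : PC) : Prop :=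
  ∀ n ∈ g'.e.pub, n ∈ g.e.pub ∨ (∀ x, M'.en n = some x → ∀ l, x.val ≠ key l) ∨
    ∃ k l v w e f, p = .aeRel1 k l v w e f n

/-- The claim about a step to the control point `p`. -/
def Leads (t : T) (g : Ghost T) (M M' : Mem T) (p : PC) : Prop :=
  ∃ g', Effect t g M g' M' ∧ TInv M' g' t p ∧ NewPub g g' M' p

theorem Leads.read {p : PC} (h : TInv M g t p) : Leads t g M M p :=
  ⟨g, .refl, h, fun _ h => Or.inl h⟩

theorem Leads.of_effect {p : PC} (s : Effect t g M g' M') (he : g'.e.pub = g.e.pub)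
    (h : TInv M' g' t p) : Leads t g M M' p :=
  ⟨g', s, h, fun _ h => Or.inl (he ▸ h)⟩

end effects

/-! ### Assertions after an event of the thread itself -/

section self

variable {t : T} {g : Ghost T} {M M' : Mem T} {L : LS T} {a b z : Addr} {k l : ℤ}
  {sent : Status}

theorem LS.Has.top {P : Val → Prop} (h : L.Has a P) : L.Has a fun _ => True := by
  obtain ⟨hp, x, hx, -⟩ := h
  exact ⟨hp, x, hx, trivial⟩

theorem LS.Del.next_eq {d : Bool} (h : L.Del t k a b z d) {x : LNode} (hx : L.h b = some x) :
    x.next = z ∧ x.val = key k := by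
  obtain ⟨ka, -, -, -, h⟩ := h
  rw [hx] at h
  cases h
  exact ⟨rfl, rfl⟩

/-- An unmarked linked node is reachable from the head of its owner, and in the vertex list only the
owner `0` has a head. -/
theorem LInv.owner_zero {M : Mem T} (I : LInv (vLS M g)) (ha : a ∈ g.v.pub) {x : LNode}
    (hx : (vLS M g).h a = some x) (hd : x.dead = false) : g.v.own a = 0 := by
  obtain ⟨r, hr, -⟩ := I.reach a ha x hx hd
  by_contra hne
  have : (vLS M g).hd ((vLS M g).own a) = none := if_neg hne
  rw [this] at hr
  cases hr

theorem LInv.has_head {M : Mem T} (I : LInv (vLS M g)) (k : ℤ) :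
    (vLS M g).Has vHead (· < key k) := by
  obtain ⟨h1, -, x, hx, hv⟩ := I.root 0 vHead (by simp [vLS])
  exact ⟨h1, x, hx, hv ▸ bot_lt_key k⟩

theorem LInv.has_next (I : LInv L) {P : Val → Prop} (h : L.Has a P) {x : LNode}
    (hx : L.h a = some x) (hv : x.val ≠ ⊤) : L.Has x.next fun _ => True :=
  (I.next_hasO h.1 hx hv).1

/-- Values increase along `next`, so the node to be deleted differs from its predecessor, and
marking it leaves the predecessor intact. -/
theorem LInv.del_next (I : LInv L) (h : L.Del t k a b z false) :
    ∃ xb, L.h b = some xb ∧ a ≠ b := by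
  obtain ⟨ka, ⟨h1, h2, h3⟩, ⟨h4, h5, h6⟩⟩ := h
  refine ⟨_, h6, ?_⟩
  rintro rfl
  rcases I.next a h1 _ h3 with ⟨h, -⟩ | ⟨-, -, y, hy, hlt⟩
  · simp only at h
    rw [h, I.null] at h3
    cases h3
  · simp only at hy
    rw [h3] at hy
    cases hy
    exact lt_irrefl _ hlt

/-- The effect of marking a located vertex node. -/
theorem Leads.markV (I : LInv (vLS M g)) (h : (vLS M g).Del t k a b z false) {x : VNode}
    (hx : M.vn b = some x) {p : PC}
    (hp : ∀ M', (∃ z, (vLS M' g).Del t k a b z true) → TInv M' g t p) :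
    Leads t g M { M with vn := Function.update M.vn b (some { x with marked := true }) } p := by
  obtain ⟨-, -, hab⟩ := I.del_next h
  obtain ⟨ka, ha, hb⟩ := h
  refine .of_effect (g' := g) (Effect.vn (P := (vLS M g).pub) hx rfl
    (LStep.mark b _ hb.1 (vLS_h hx) hb.2.1)) rfl (hp _ ⟨z, ka, ⟨ha.1, ha.2.1, ?_⟩,
      ⟨hb.1, hb.2.1, ?_⟩⟩)
  · simp only [vLS, vHeapOf_update]
    exact (Function.update_of_ne hab _ _).trans ha.2.2
  · have h3 := hb.2.2
    rw [vLS_h hx] at h3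
    simp only [Option.some.injEq, LNode.mk.injEq] at h3
    simp [vLS, vHeapOf_update, h3.1, h3.2.1]

/-- The effect of marking a located edge node. -/
theorem Leads.markE (I : LInv (eLS M g)) (h : (eLS M g).Del t k a b z false) {x : ENode}
    (hx : M.en b = some x) (hs : x.status = Status.added ∨ g.e.cr b = some t) {p : PC}
    (hp : ∀ M', (∃ z, (eLS M' g).Del t k a b z true) → TInv M' g t p) :
    Leads t g M
      { M with en := Function.update M.en b (some { x with status := Status.marked }) } p := by
  obtain ⟨-, -, hab⟩ := I.del_next h
  obtain ⟨ka, ha, hb⟩ := h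
  refine .of_effect (g' := g) (Effect.en (P := (eLS M g).pub) hx rfl (Or.inr (Or.inr ⟨rfl, hb.2.1, hs⟩))
    (by simpa using LStep.mark b _ hb.1 (eLS_h hx) hb.2.1)) rfl (hp _ ⟨z, ka, ⟨ha.1, ha.2.1, ?_⟩,
      ⟨hb.1, hb.2.1, ?_⟩⟩)
  · simp only [eLS, eHeapOf_update]
    exact (Function.update_of_ne hab _ _).trans ha.2.2
  · have h3 := hb.2.2
    rw [eLS_h hx] at h3
    simp only [Option.some.injEq, LNode.mk.injEq] at h3
    simp [eLS, eHeapOf_update, h3.1, h3.2.1]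

theorem Leads.unlinkV (h : (vLS M g).Del t k a b z true) {x : VNode} (hx : M.vn a = some x)
    {p : PC} (hp : ∀ M', TInv M' g t p) :
    Leads t g M { M with vn := Function.update M.vn a (some { x with vnext := z }) } p := by
  obtain ⟨ka, ha, hb⟩ := h
  have h3 := ha.2.2
  rw [vLS_h hx] at h3
  simp only [Option.some.injEq, LNode.mk.injEq] at h3
  refine .of_effect (g' := g) (Effect.vn (P := (vLS M g).pub) hx rfl ?_) rfl (hp _)
  have := LStep.unlink a b z ka (key k) ha.1 ha.2.1 ha.2.2 hb.2.2 (key_ne_top k)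
  simpa [h3.1, h3.2.2] using this

theorem Leads.unlinkE (h : (eLS M g).Del t k a b z true) {x : ENode} (hx : M.en a = some x)
    {p : PC} (hp : ∀ M', TInv M' g t p) :
    Leads t g M { M with en := Function.update M.en a (some { x with enext := z }) } p := by
  obtain ⟨ka, ha, hb⟩ := h
  have h3 := ha.2.2
  rw [eLS_h hx] at h3
  simp only [Option.some.injEq, LNode.mk.injEq] at h3
  refine .of_effect (g' := g) (Effect.en (P := (eLS M g).pub) hx rfl (Or.inl rfl) ?_) rfl (hp _)
  have := LStep.unlink a b z ka (key k) ha.1 ha.2.1 ha.2.2 hb.2.2 (key_ne_top k)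
  simpa [h3.1, h3.2.2] using this

/-- The vertex node is still private, but its edge sentinels count as linked at once. They carry no
integer key, which is the exception that `NewPub` provides for. -/
theorem leads_avNew (hsent : sent ≠ Status.marked) (I : LInv (vLS M g)) {p : PC}
    (hp : TInv M g t (.avNew k a b)) (hx : Exec sent t (code (.avNew k a b)) M M' p) :
    Leads t g M M' p := by
  cases hx with
  | newV ha he hf hef ha' he' hf' =>
    rename_i n e f
    have hn : n ∉ g.v.pub := by
      intro h
      obtain ⟨x, hx⟩ := I.alloc n h
      simp [vLS, vHeapOf, ha'] at hx
    refine ⟨_, Effect.newV (g := g) hsent ha he hf hef ha' he' hf' k, ⟨?_, hn, ?_, ?_, ?_⟩, ?_⟩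
    · refine LS.Ins.congr hp rfl rfl fun c hcp => ?_
      simp only [vLS, vHeapOf_update]
      exact Function.update_of_ne (by rintro rfl; exact hn hcp) _ _
    · simp [vLS]
    · simp [vLS]
    · simp [vLS, vHeapOf_update]
    · rintro m (rfl | rfl | hm)
      · refine Or.inr (Or.inl fun x hx l => ?_)
        simp only [Function.update_of_ne hef, Function.update_self, Option.some.injEq] at hx
        subst hx
        exact (key_ne_bot l).symm
      · refine Or.inr (Or.inl fun x hx l => ?_)
        simp only [Function.update_self, Option.some.injEq] at hx
        subst hx
        exact (key_ne_top l).symm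
      · exact Or.inl hm

theorem leads_avInit {n : Addr} {p : PC} (hp : TInv M g t (.avInit k a b n))
    (hx : Exec sent t (code (.avInit k a b n)) M M' p) : Leads t g M M' p := by
  obtain ⟨hi, hn, hc, ho, hh⟩ := hp
  cases hx with
  | wrVNext h =>
    have h3 := hh
    rw [vLS_h h] at h3
    simp only [Option.some.injEq, LNode.mk.injEq] at h3
    refine .of_effect (g' := g) (Effect.vn (P := (vLS M g).pub) h rfl ?_) rfl ⟨?_, hn, hc, ho, ?_⟩
    · simpa [h3.1, h3.2.2] using LStep.init n b (key k) hc hn hh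
    · refine LS.Ins.congr hi rfl rfl fun c hcp => ?_
      simp only [vLS, vHeapOf_update]
      exact Function.update_of_ne (by rintro rfl; exact hn hcp) _ _
    · simp [vLS, vHeapOf_update, h3.1, h3.2.2]

theorem leads_avLink {n : Addr} (I : LInv (vLS M g)) {p : PC}
    (hp : TInv M g t (.avLink k a b n)) (hx : Exec sent t (code (.avLink k a b n)) M M' p) :
    Leads t g M M' p := by
  obtain ⟨⟨ka, xb, ha, hb, h1, h2⟩, hn, hc, ho, hh⟩ := hp
  cases hx with
  | wrVNext h =>
    have h3 := ha.2.2
    rw [vLS_h h] at h3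
    simp only [Option.some.injEq, LNode.mk.injEq] at h3
    refine .of_effect (Effect.vn (P := insert n (vLS M g).pub) h rfl ?_) rfl trivial
    have := LStep.link a n b ka (key k) xb hc hn hh ha.2.2 ha.1 hb.1 hb.2.2 ha.2.1
      (ho.trans (I.owner_zero ha.1 ha.2.2 rfl).symm) h1 h2
    simpa [h3.1, h3.2.2] using this

theorem leads_aeNew (I : LInv (eLS M g)) {v w e f : Addr} {p : PC}
    (hp : TInv M g t (.aeNew k l v w e f)) (hx : Exec sent t (code (.aeNew k l v w e f)) M M' p) :
    Leads t g M M' p := by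
  obtain ⟨hl, hr, hi⟩ := hp
  cases hx with
  | newE he he' =>
    rename_i n
    have hn : n ∉ g.e.pub := by
      intro h
      obtain ⟨x, hx⟩ := I.alloc n h
      simp [eLS, eHeapOf, he'] at hx
    have s := Effect.newE (t := t) (g := g) v he' he l
    refine .of_effect s rfl ⟨hl.mono s, hr.mono s.e, ?_, ⟨hn, ?_, ?_, ?_⟩, ?_⟩
    · refine LS.Ins.congr hi rfl rfl fun c hcp => ?_
      simp only [eLS, eHeapOf_update]
      exact Function.update_of_ne (by rintro rfl; exact hn hcp) _ _
    · simp [eLS]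
    · simp [eLS]
    · simp [eLS, eHeapOf_update]
    · exact ⟨_, Function.update_self _ _ _, rfl⟩

theorem leads_aeInit {v w e f n : Addr} {p : PC}
    (hp : TInv M g t (.aeInit k l v w e f n))
    (hx : Exec sent t (code (.aeInit k l v w e f n)) M M' p) : Leads t g M M' p := by
  obtain ⟨hl, hr, hi, ⟨hn, hc, ho, hh⟩, y, hy, hst⟩ := hp
  cases hx with
  | wrENext h =>
    have h3 := hh
    rw [eLS_h h] at h3
    simp only [Option.some.injEq, LNode.mk.injEq] at h3
    rename_i x
    have s : Effect t g M g _ := Effect.en (y := { x with enext := f })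
      (P := (eLS M g).pub) h rfl (Or.inl rfl) (by
      simpa [h3.1, h3.2.2] using LStep.init n f (key l) hc hn hh)
    rw [h] at hy
    cases hy
    refine .of_effect s rfl ⟨hl.mono s, hr.mono s.e, ?_, ⟨hn, hc, ho, ?_⟩, ?_⟩
    · refine LS.Ins.congr hi rfl rfl fun c hcp => ?_
      simp only [eLS, eHeapOf_update]
      exact Function.update_of_ne (by rintro rfl; exact hn hcp) _ _
    · simpa [eLS, eHeapOf_update, h3.1] using h3.2.2
    · exact ⟨_, Function.update_self _ _ _, hst⟩

theorem leads_aeLink {v w e f n : Addr} {p : PC}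
    (hp : TInv M g t (.aeLink k l v w e f n))
    (hx : Exec sent t (code (.aeLink k l v w e f n)) M M' p) : Leads t g M M' p := by
  obtain ⟨hl, hr, ⟨ka, xb, ha, hb, h1, h2⟩, ⟨hn, hc, ho, hh⟩, y, hy, hst⟩ := hp
  cases hx with
  | wrENext h =>
    have h3 := ha.2.2
    rw [eLS_h h] at h3
    simp only [Option.some.injEq, LNode.mk.injEq] at h3
    rename_i x
    have s := Effect.en (t := t) (y := { x with enext := n }) (P := insert n (eLS M g).pub) h rfl
      (Or.inl rfl) (by
      have := LStep.link e n f ka (key l) xb hc hn hh ha.2.2 ha.1 hb.1 hb.2.2 ha.2.1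
        (ho.trans hr.1.2.symm) h1 h2
      simpa [h3.1, h3.2.2] using this)
    have hne : n ≠ e := by rintro rfl; exact hn ha.1
    refine ⟨_, s, ⟨hl.mono s, ⟨Or.inl rfl, ho, hc, y,
      (Function.update_of_ne hne _ _).trans hy, ?_, hst⟩, trivial⟩, ?_⟩
    · rw [eLS_h hy] at hh
      simp only [Option.some.injEq, LNode.mk.injEq] at hh
      exact hh.1
    · rintro m (rfl | hm)
      · exact Or.inr (Or.inr ⟨_, _, _, _, _, _, rfl⟩)
      · exact Or.inl hm

/-- In the `undo` case the node to be taken back is unmarked, lies in the same list and has the key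
sought, so `LInv.position_eq` identifies it with the second locked node. Hence the coming mark falls
on a node whose lock is held. -/
theorem leads_leChk3 (I : LInv (eLS M g)) {c : LCaller} {v w e f : Addr} {p : PC}
    (hp : TInv M g t (.leChk3 c k l v w e f))
    (hx : Exec sent t (code (.leChk3 c k l v w e f)) M M' p) : Leads t g M M' p := by
  obtain ⟨hl, hu, hr, he, hf⟩ := hp
  cases hx with
  | rdENext h =>
    refine .read ?_
    dsimp only
    split_ifs with hn
    · have hpos := hr.range.pos he.live hf.live (eLS_h h) hn
      cases c with
      | ins => exact ⟨hl, hr, hpos⟩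
      | del => exact ⟨hpos, hf⟩
      | undo n =>
        have hpos' := hpos
        obtain ⟨ka, xf, h1, h2, h3, h4, h5⟩ := hpos'
        obtain ⟨h6, h7, -, y, h8, h9, h10⟩ := id hu
        have : f = n := I.position_eq h1.1 h6 (hr.1.2.trans h7.symm) h1.2.2 (eLS_h h8) rfl
          (by simp [h10]) h2.2.2 (by simpa [h9] using h4) (by simpa [h9] using h5)
        subst this
        exact ⟨hl, hu, rfl, _, hpos.del (eLS_h h8) h9⟩
    · exact ⟨hl, hu, trivial⟩

theorem leads_aeAdded {v w n : Addr} {p : PC} (hp : TInv M g t (.aeAdded k l v w n))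
    (hx : Exec sent t (code (.aeAdded k l v w n)) M M' p) : Leads t g M M' p := by
  obtain ⟨-, ⟨-, -, h3, y, h4, h5, h6⟩, -⟩ := hp
  cases hx with
  | wrStatus h =>
    rw [h] at h4
    cases h4
    refine .of_effect (g' := g)
      (Effect.en (P := (eLS M g).pub) h rfl (Or.inr (Or.inl ⟨h6, rfl, h3⟩)) ?_) rfl trivial
    -- Both transit and `added` are alive, so the heap of list nodes does not change.
    have h7 : Function.update (eLS M g).h n (some ⟨y.val, y.enext, false⟩) = (eLS M g).h := by
      rw [Function.update_eq_self_iff, eLS_h h]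
      simp [h6]
    simp only [reduceCtorEq, decide_false, h7]
    exact .refl

/-- The node found first has the smaller key, and the test `k < l` restores the order of the
arguments. For equal keys `min` and `max` agree, so the order is immaterial. -/
theorem leads_hsMark2 {c : ECaller} {p : PC} (hp : TInv M g t (.hsMark2 c k l a b))
    (hx : Exec sent t (code (.hsMark2 c k l a b)) M M' p) : Leads t g M M' p := by
  obtain ⟨h1, h2⟩ := hp
  cases hx with
  | rdMarked h =>
    refine .read ?_
    dsimp only
    split_ifs with hm hkl
    · trivial
    · rw [min_eq_left hkl.le] at h1
      rw [max_eq_right hkl.le] at h2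
      cases c
      · exact ⟨⟨h1, h2⟩, trivial, trivial⟩
      · exact ⟨⟨h1, h2⟩, trivial, trivial⟩
      · trivial
    · rw [min_eq_right (not_lt.1 hkl)] at h1
      rw [max_eq_left (not_lt.1 hkl)] at h2
      cases c
      · exact ⟨⟨h2, h1⟩, trivial, trivial⟩
      · exact ⟨⟨h2, h1⟩, trivial, trivial⟩
      · trivial

end self

/-! ### All instructions of the program -/

section step

variable {t : T} {g : Ghost T} {M M' : Mem T} {sent : Status}

theorem Exec.lockV_inv {a : Addr} {c p : PC} (hx : Exec sent t (.lockV a c) M M' p) :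
    M.vlock a = none ∧ M' = { M with vlock := Function.update M.vlock a (some t) } ∧ p = c := by
  cases hx with
  | lockV h hl => exact ⟨hl, rfl, rfl⟩

theorem Exec.lockE_inv {a : Addr} {c p : PC} (hx : Exec sent t (.lockE a c) M M' p) :
    M.elock a = none ∧ M' = { M with elock := Function.update M.elock a (some t) } ∧ p = c := by
  cases hx with
  | lockE h hl => exact ⟨hl, rfl, rfl⟩

theorem Leads.unlockV {a : Addr} {c p : PC} (hx : Exec sent t (.unlockV a c) M M' p)
    (hc : ∀ M', M'.vn = M.vn → M'.en = M.en → TInv M' g t c) : Leads t g M M' p := by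
  cases hx with
  | unlockV hl => exact .of_effect (g' := g) (.vlock (Or.inr hl)) rfl (hc _ rfl rfl)

theorem Leads.unlockE {a : Addr} {c p : PC} (hx : Exec sent t (.unlockE a c) M M' p)
    (hc : TInv { M with elock := Function.update M.elock a none } g t c) :
    Leads t g M M' p := by
  cases hx with
  | unlockE hl => exact .of_effect (g' := g) (.elock (Or.inr hl)) rfl hc

theorem lock_ne {lock : Addr → Option T} {a b : Addr} {o : Option T} (ha : lock a = some t)
    (hb : lock b = none) : Function.update lock b o a = some t := by
  rw [Function.update_of_ne, ha]
  rintro rfl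
  rw [ha] at hb
  cases hb

/-- A step of thread `t` establishes the assertion at the next control point. -/
theorem leads (hsent : sent ≠ Status.marked) (Iv : LInv (vLS M g)) (Ie : LInv (eLS M g)) {p p' : PC}
    (hp : TInv M g t p) (hx : Exec sent t (code p) M M' p') : Leads t g M M' p' := by
  cases p with
  | lvStart c k =>
    cases hx with
    | rdVNext h =>
      have h1 := Iv.has_head k
      exact .read ⟨h1, Iv.has_next h1 (vLS_h h) (ne_top_of_lt_key (h1.val (vLS_h h)))⟩
  | lvTest c k a b =>
    cases hx with
    | rdVVal h =>
      refine .read ?_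
      dsimp only
      split_ifs with hlt
      · exact hp.2.and (vLS_h h) (Q := (· < key k)) hlt
      · exact ⟨hp.1, hp.2.and (vLS_h h) (not_lt.1 hlt)⟩
  | lvNext c k a b =>
    have hp' : (vLS M g).Has b (· < key k) := hp
    cases hx with
    | rdVNext h =>
      exact .read ⟨hp, Iv.has_next hp' (vLS_h h) (ne_top_of_lt_key (hp'.val (vLS_h h)))⟩
  | lvLock1 c k a b =>
    obtain ⟨hl, rfl, rfl⟩ := hx.lockV_inv
    exact .of_effect (g' := g) (.vlock (Or.inl hl)) rfl ⟨hp, Function.update_self _ _ _⟩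
  | lvLock2 c k a b =>
    obtain ⟨hl, rfl, rfl⟩ := hx.lockV_inv
    exact .of_effect (g' := g) (.vlock (Or.inl hl)) rfl
      ⟨hp.1, lock_ne hp.2 hl, Function.update_self _ _ _⟩
  | lvChk1 c k a b =>
    cases hx with
    | rdMarked h =>
      refine .read ?_
      dsimp only
      split_ifs with hm
      · trivial
      · exact ⟨hp.1, ⟨_, ⟨hp.1.1.1, hp.2.1, vLS_h h⟩, by simpa using hm⟩, hp.2.2⟩
  | lvChk2 c k a b =>
    cases hx with
    | rdMarked h =>
      refine .read ?_
      dsimp only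
      split_ifs with hm
      · trivial
      · exact ⟨hp.1, hp.2.1, ⟨_, ⟨hp.1.2.1, hp.2.2, vLS_h h⟩, by simpa using hm⟩⟩
  | lvChk3 c k a b =>
    cases hx with
    | rdVNext h =>
      refine .read ?_
      dsimp only
      split_ifs with hn
      · have := hp.1.pos hp.2.1 hp.2.2 (vLS_h h) hn
        cases c <;> exact this
      · trivial
  | lvFail1 c k a b => exact .unlockV hx fun _ _ _ => trivial
  | lvFail2 c k b => exact .unlockV hx fun _ _ _ => trivial
  | avTest k a b =>
    cases hx with
    | rdVVal h =>
      refine .read ?_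
      dsimp only
      split_ifs with hv
      · exact LS.Pos.ins hp (vLS_h h) hv
      · trivial
  | avNew k a b => exact leads_avNew hsent Iv hp hx
  | avInit k a b n => exact leads_avInit hp hx
  | avLink k a b n => exact leads_avLink Iv hp hx
  | rvTest k a b =>
    cases hx with
    | rdVVal h =>
      refine .read ?_
      dsimp only
      split_ifs with hv
      · exact ⟨_, LS.Pos.del hp (vLS_h h) hv⟩
      · trivial
  | rvMark k a b =>
    obtain ⟨z, hz⟩ := hp
    cases hx with
    | wrMarked h => exact .markV Iv hz h fun _ h => h
  | rvRead k a b =>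
    obtain ⟨z, hz⟩ := hp
    cases hx with
    | rdVNext h =>
      obtain ⟨rfl, -⟩ := hz.next_eq (vLS_h h)
      exact .read hz
  | rvUnlink k a b z =>
    cases hx with
    | wrVNext h => exact .unlinkV hp h fun _ => trivial
  | vRel1 f a b => exact .unlockV hx fun _ _ _ => trivial
  | vRel2 f b => exact .unlockV hx fun _ _ _ => trivial
  | cvTest k a =>
    cases hx with
    | rdVVal h =>
      refine .read ?_
      dsimp only
      split_ifs <;> trivial
  | cvNext k a => cases hx with | rdVNext h => exact .read trivial
  | cvVal k a =>
    cases hx with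
    | rdVVal h =>
      refine .read ?_
      dsimp only
      split_ifs <;> trivial
  | cvMark k a => cases hx with | rdMarked h => exact .read trivial
  | hsTest1 c k l a =>
    have hp' : (vLS M g).Has a fun _ => True := hp
    cases hx with
    | rdVVal h =>
      refine .read ?_
      dsimp only
      split_ifs with hlt
      · exact hp'.and (vLS_h h) (Q := (· < key (min k l))) hlt
      · exact hp
  | hsNext1 c k l a =>
    have hp' : (vLS M g).Has a (· < key (min k l)) := hp
    cases hx with
    | rdVNext h =>
      exact .read (Iv.has_next hp' (vLS_h h) (ne_top_of_lt_key (hp'.val (vLS_h h))))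
  | hsVal1 c k l a =>
    have hp' : (vLS M g).Has a fun _ => True := hp
    cases hx with
    | rdVVal h =>
      refine .read ?_
      dsimp only
      split_ifs with hv
      · trivial
      · exact hp'.and (vLS_h h) (Q := (· = key (min k l))) (not_not.1 hv)
  | hsMark1 c k l a =>
    cases hx with
    | rdMarked h =>
      refine .read ?_
      dsimp only
      split_ifs with hm
      · trivial
      · exact hp
  | hsStart2 c k l a =>
    have hp' : (vLS M g).Has a (· = key (min k l)) := hp
    cases hx with
    | rdVNext h =>
      refine .read ⟨hp, Iv.has_next hp' (vLS_h h) ?_⟩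
      exact (hp'.val (vLS_h h)).trans_ne (key_ne_top _)
  | hsTest2 c k l a b =>
    cases hx with
    | rdVVal h =>
      refine .read ?_
      dsimp only
      split_ifs with hlt
      · exact ⟨hp.1, hp.2.and (vLS_h h) hlt⟩
      · exact hp
  | hsNext2 c k l a b =>
    cases hx with
    | rdVNext h =>
      exact .read ⟨hp.1, Iv.has_next hp.2 (vLS_h h) (ne_top_of_lt_key (hp.2.val (vLS_h h)))⟩
  | hsVal2 c k l a b =>
    cases hx with
    | rdVVal h =>
      refine .read ?_
      dsimp only
      split_ifs with hv
      · trivial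
      · exact ⟨hp.1, hp.2.and (vLS_h h) (not_not.1 hv)⟩
  | hsMark2 c k l a b => exact leads_hsMark2 hp hx
  | alMark1 c k l v w =>
    cases hx with
    | rdMarked h =>
      refine .read ?_
      dsimp only
      split_ifs with hm
      · trivial
      · exact hp
  | alMark2 c k l v w =>
    cases hx with
    | rdMarked h =>
      refine .read ?_
      dsimp only
      split_ifs with hm
      · trivial
      · exact hp
  | leStart c k l v w =>
    cases hx with
    | rdEHead h =>
      refine .read ⟨hp.1, hp.2.1, ?_⟩
      obtain ⟨h1, h2, x, h3, h4⟩ := Ie.root v _ (by simp only [eLS, headOf, h]; rfl)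
      exact ⟨⟨h1, x, h3, h4 ▸ bot_lt_key l⟩, h2⟩
  | leFirst c k l v w e =>
    obtain ⟨h1, h2, h3⟩ := hp
    cases hx with
    | rdENext h =>
      have := Ie.next_hasO h3.1.1 (eLS_h h) (ne_top_of_lt_key (h3.1.val (eLS_h h)))
      exact .read ⟨h1, h2, h3, h3.2 ▸ this⟩
  | leTest c k l v w e f =>
    obtain ⟨h1, h2, h3, h4⟩ := hp
    cases hx with
    | rdEVal h =>
      refine .read ?_
      dsimp only
      split_ifs with hlt
      · exact ⟨h1, h2, h4.1.and (eLS_h h) hlt, h4.2⟩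
      · exact ⟨h1, h2, h3, h4.1.and (eLS_h h) (not_lt.1 hlt), h4.2⟩
  | leNext c k l v w e f =>
    obtain ⟨h1, h2, h3⟩ := hp
    cases hx with
    | rdENext h =>
      have := Ie.next_hasO h3.1.1 (eLS_h h) (ne_top_of_lt_key (h3.1.val (eLS_h h)))
      exact .read ⟨h1, h2, h3, h3.2 ▸ this⟩
  | leLock1 c k l v w e f =>
    obtain ⟨hl, rfl, rfl⟩ := hx.lockE_inv
    obtain ⟨h1, h2, h3⟩ := hp
    exact .of_effect (g' := g) (.elock (Or.inl hl)) rfl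
      -- `LCaller.Inv` unfolds only for a known `c`; it does not depend on locks.
      ⟨h1, by cases c <;> exact h2, h3, Function.update_self _ _ _⟩
  | leLock2 c k l v w e f =>
    obtain ⟨hl, rfl, rfl⟩ := hx.lockE_inv
    obtain ⟨h1, h2, h3, h4⟩ := hp
    exact .of_effect (g' := g) (.elock (Or.inl hl)) rfl
      ⟨h1, by cases c <;> exact h2, h3, lock_ne h4 hl, Function.update_self _ _ _⟩
  | leChk1 c k l v w e f =>
    obtain ⟨h1, h2, h3, h4, h5⟩ := hp
    cases hx with
    | rdStatus h =>
      refine .read ?_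
      dsimp only
      split_ifs with hs
      · exact ⟨h1, h2, h3, ⟨h3.1.1.1, h4, _, h, hs⟩, h5⟩
      · exact ⟨h1, h2, trivial⟩
  | leChk2 c k l v w e f =>
    obtain ⟨h1, h2, h3, h4, h5⟩ := hp
    cases hx with
    | rdStatus h =>
      refine .read ?_
      dsimp only
      split_ifs with hs
      · exact ⟨h1, h2, h3, h4, ⟨h3.2.1.1, h5, _, h, hs⟩⟩
      · exact ⟨h1, h2, trivial⟩
  | leChk3 c k l v w e f => exact leads_leChk3 Ie hp hx
  | leFail1 c k l v w e f => exact .unlockE hx ⟨hp.1, by cases c <;> exact hp.2.1, trivial⟩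
  | leFail2 c k l v w f => exact .unlockE hx ⟨hp.1, by cases c <;> exact hp.2.1, trivial⟩
  | aeTest k l v w e f =>
    obtain ⟨h1, h2, h3⟩ := hp
    cases hx with
    | rdEVal h =>
      refine .read ?_
      dsimp only
      split_ifs with hv
      · exact ⟨h1, h2, h3.ins (eLS_h h) hv⟩
      · trivial
  | aeNew k l v w e f => exact leads_aeNew Ie hp hx
  | aeInit k l v w e f n => exact leads_aeInit hp hx
  | aeLink k l v w e f n => exact leads_aeLink hp hx
  | aeRel1 k l v w e f n => exact .unlockE hx hp
  | aeRel2 k l v w f n => exact .unlockE hx hp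
  | aeAdded k l v w n => exact leads_aeAdded hp hx
  | aeMark k l v w n e f =>
    obtain ⟨h1, h2, rfl, z, hz⟩ := hp
    cases hx with
    | wrStatus h => exact .markE Ie hz h (Or.inr h2.2.2.1) fun _ h => ⟨rfl, h⟩
  | aeRead k l v w n e f =>
    obtain ⟨rfl, z, hz⟩ := hp
    cases hx with
    | rdENext h =>
      obtain ⟨rfl, -⟩ := hz.next_eq (eLS_h h)
      exact .read ⟨rfl, hz⟩
  | aeUnlink k l v w n e f z =>
    cases hx with
    | wrENext h => exact .unlinkE hp.2 h fun _ => trivial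
  | peTest k l v w n x R X a =>
    cases hx with
    | rdVVal h =>
      refine .read ?_
      dsimp only
      split_ifs <;> exact hp
  | peNext k l v w n x R X a => cases hx with | rdVNext h => exact .read hp
  | peVal k l v w n x R X a =>
    cases hx with
    | rdVVal h =>
      refine .read ?_
      dsimp only
      split_ifs <;> exact hp
  | peMark k l v w n x R X a =>
    cases hx with
    | rdMarked h =>
      refine .read ?_
      dsimp only
      split_ifs <;> exact hp
  | peHead k l v w n x R X a => cases hx with | rdEHead h => exact .read hp
  | peEnd k l v w n x R X e =>
    cases hx with
    | rdENext h =>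
      refine .read ?_
      dsimp only
      split_ifs <;> exact hp
  | peStatus k l v w n x R X e =>
    cases hx with
    | rdStatus h =>
      refine .read ?_
      dsimp only
      split_ifs <;> exact hp
  | peEVal k l v w n x R X e => cases hx with | rdEVal h => exact .read hp
  | peENext k l v w n x R X e => cases hx with | rdENext h => exact .read hp
  | peLoop k l v w n R X =>
    cases hx with
    | pick h => exact .read hp
    | pickStop h => exact .read hp
  | reTest k l e f =>
    cases hx with
    | rdEVal h =>
      refine .read ?_
      dsimp only
      split_ifs with hv
      · exact ⟨⟨_, hp.1.del (eLS_h h) hv⟩, hp.2⟩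
      · trivial
  | reMark k l e f =>
    obtain ⟨⟨z, hz⟩, -, -, y, hy, hs⟩ := hp
    cases hx with
    | wrStatus h =>
      rw [h] at hy
      cases hy
      -- The validation of a removal has accepted the status `added`, which permits marking a node
      -- created by any thread.
      exact .markE Ie hz h (Or.inl (by simpa [accepts] using hs)) fun _ h => h
  | reRead k l e f =>
    obtain ⟨z, hz⟩ := hp
    cases hx with
    | rdENext h =>
      obtain ⟨rfl, -⟩ := hz.next_eq (eLS_h h)
      exact .read hz
  | reUnlink k l e f z =>
    cases hx with
    | wrENext h => exact .unlinkE hp h fun _ => trivial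
  | eRel1 b e f => exact .unlockE hx trivial
  | eRel2 b f => exact .unlockE hx trivial
  | ceStart k l v => cases hx with | rdEHead h => exact .read trivial
  | ceTest k l e =>
    cases hx with
    | rdEVal h =>
      refine .read ?_
      dsimp only
      split_ifs <;> trivial
  | ceNext k l e => cases hx with | rdENext h => exact .read trivial
  | ceVal k l e =>
    cases hx with
    | rdEVal h =>
      refine .read ?_
      dsimp only
      split_ifs <;> trivial
  | ceStatus k l e => cases hx with | rdStatus h => exact .read trivial
  | done b => cases hx

end step

/-! ### The global invariant and its preservation -/

section invariant

variable {t : T} {g g' : Ghost T} {S S' : State T} {sent : Status}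

/-- The auxiliary variables of the initial state. -/
def initGhost (T : Type*) : Ghost T where
  v := ⟨{vHead, vTail}, fun _ => 0, fun _ => none⟩
  -- The addresses `1`, `2` are the edge sentinels of `vHead`, and `3`, `4` those of `vTail`.
  e := ⟨{1, 2, 3, 4}, fun a => if a ≤ 2 then vHead else vTail, fun _ => none⟩

theorem inv_init : Inv (initGhost T) (initState T sent) := by
  refine ⟨⟨?_, ?_, ?_, ?_, ?_⟩, ⟨?_, ?_, ?_, ?_, ?_⟩, ?_, ?_⟩
  · rfl
  · rintro a (rfl | rfl) <;> exact ⟨_, rfl⟩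
  · rintro a (rfl | rfl) x hx <;> cases hx
    · exact Or.inr ⟨Or.inr rfl, rfl, _, rfl, bot_lt_top⟩
    · exact Or.inl ⟨rfl, rfl⟩
  · rintro a (rfl | rfl) x - -
    · exact ⟨vHead, rfl, .refl⟩
    · exact ⟨vHead, rfl, .single ⟨_, rfl, rfl⟩⟩
  · intro o r hr
    by_cases ho : o = 0
    · subst ho
      cases hr
      exact ⟨Or.inl rfl, rfl, _, rfl, rfl⟩
    · have : (vLS (initState T sent).mem (initGhost T)).hd o = none := if_neg ho
      rw [this] at hr
      cases hr
  · rfl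
  · rintro a (rfl | rfl | rfl | rfl) <;> exact ⟨_, rfl⟩
  · rintro a (rfl | rfl | rfl | rfl) x hx <;> cases hx
    · exact Or.inr ⟨by simp [eLS, initGhost], rfl, _, rfl, bot_lt_top⟩
    · exact Or.inl ⟨rfl, rfl⟩
    · exact Or.inr ⟨by simp [eLS, initGhost], rfl, _, rfl, bot_lt_top⟩
    · exact Or.inl ⟨rfl, rfl⟩
  · rintro a (rfl | rfl | rfl | rfl) x - -
    · exact ⟨1, rfl, .refl⟩
    · exact ⟨1, rfl, .single ⟨_, rfl, rfl⟩⟩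
    · exact ⟨3, rfl, .refl⟩
    · exact ⟨3, rfl, .single ⟨_, rfl, rfl⟩⟩
  · intro o r hr
    by_cases h1 : o = 1
    · subst h1
      cases hr
      exact ⟨Or.inl rfl, rfl, _, rfl, rfl⟩
    · by_cases h2 : o = 2
      · subst h2
        cases hr
        exact ⟨Or.inr (Or.inr (Or.inl rfl)), rfl, _, rfl, rfl⟩
      · have : (eLS (initState T sent).mem (initGhost T)).hd o = none := by
          simp [eLS, headOf, initState, initMem, vHead, vTail, h1, h2]
        rw [this] at hr
        cases hr
  · intro e _ x _ _
    simp only [initGhost]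
    split_ifs <;> simp
  · intro t p hp
    cases hp

/-- A step preserves the invariant, with suitable new values of the auxiliary variables. -/
theorem Inv.step [DecidableEq T] (hsent : sent ≠ Status.marked) (I : Inv g S)
    (hs : Step sent t S S') : ∃ g', Effect t g S.mem g' S'.mem ∧ Inv g' S' ∧
      ∀ n ∈ g'.e.pub, n ∈ g.e.pub ∨ (∀ x, S'.mem.en n = some x → ∀ l, x.val ≠ key l) ∨
        ∃ k l v w e f, S'.pc t = some (.aeRel1 k l v w e f n) := by
  cases hs with
  | invoke op h =>
    refine ⟨g, .refl, ⟨I.v, I.e, I.owner, ?_⟩, fun _ h => Or.inl h⟩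
    intro u p hp
    dsimp only at hp ⊢
    by_cases hu : u = t
    · subst hu
      simp only [Function.update_self, Option.some.injEq] at hp
      subst hp
      -- The key `0` is arbitrary; only the fact that the head is linked is used.
      cases op <;> first | trivial | exact (I.v.has_head 0).top
    · rw [Function.update_of_ne hu] at hp
      exact I.thread u p hp
  | respond h hb =>
    refine ⟨g, .refl, ⟨I.v, I.e, I.owner, ?_⟩, fun _ h => Or.inl h⟩
    intro u p hp
    dsimp only at hp ⊢
    by_cases hu : u = t
    · subst hu
      simp at hp
    · rw [Function.update_of_ne hu] at hp
      exact I.thread u p hp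
  | exec h hx =>
    rename_i p p' M'
    obtain ⟨g', s, hp', hn⟩ := leads hsent I.v I.e (I.thread t _ h) hx
    refine ⟨g', s, ⟨s.v.inv I.v, s.e.inv I.e, ?_, ?_⟩, ?_⟩
    · intro e he x hx hl
      rcases hn e he with h1 | h1 | ⟨k, l, v, w, e₁, e₂, rfl⟩
      · obtain ⟨y, hy⟩ := I.e.alloc e h1
        obtain ⟨y', hy', -⟩ := exists_en hy
        obtain ⟨x', hx', hv, -⟩ := s.st e y' hy'
        rw [hx] at hx'
        cases hx'
        have : g'.e.own e = g.e.own e := s.e.own_eq hy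
        rw [this]
        exact s.v.pub_mono (I.owner e h1 y' hy' (hv ▸ hl))
      · obtain ⟨l, hl⟩ := hl
        exact absurd hl (h1 x hx l)
      -- The owner of a freshly linked edge node is the vertex node that the call has located.
      · obtain ⟨⟨h2, -⟩, ⟨-, h3, -⟩, -⟩ := hp'
        rw [h3]
        exact h2.1
    · intro u q hq
      dsimp only at hq ⊢
      by_cases hu : u = t
      · subst hu
        simp only [Function.update_self, Option.some.injEq] at hq
        subst hq
        exact hp'
      · rw [Function.update_of_ne hu] at hq
        exact (I.thread u q hq).stable s hu
    · intro n hn'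
      rcases hn n hn' with h1 | h1 | ⟨k, l, v, w, e₁, e₂, rfl⟩
      · exact Or.inl h1
      · exact Or.inr (Or.inl h1)
      · exact Or.inr (Or.inr ⟨k, l, v, w, e₁, e₂, by simp⟩)

end invariant

/-! ## Cycles are noticed -/

section cycles

/-- `e` is an unmarked edge node with value `y` in the list of an unmarked vertex node with value
`x`. -/
structure IsEdge (M : Mem T) (g : Ghost T) (e : Addr) (x y : Val) : Prop where
  pub : e ∈ g.e.pub
  node : ∃ z, M.en e = some z ∧ z.val = y ∧ z.status ≠ Status.marked
  isKey : ∃ l, y = key l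
  src : ∃ v, M.vn (g.e.own e) = some v ∧ v.val = x ∧ v.marked = false

/-- The edge nodes `C`, with sources `s` and targets `τ`, are strongly connected. -/
def Cyclic (C : Set Addr) (s τ : Addr → Val) : Prop :=
  ∀ e ∈ C, ∀ e' ∈ C, Relation.TransGen (fun a b => b ∈ C ∧ τ a = s b) e e'

/-- `c` will be met by a traversal that is at the linked node `a`. -/
def LS.Ahead (L : LS T) (a c : Addr) : Prop := a ∈ L.pub ∧ Reach L.h a c

/-- The search of `PathExists` for the key of `k` from the key of `l` has not missed any of the
edges `C`. -/
def Progress (C : Set Addr) (s τ : Addr → Val) (l : ℤ) (x : Val) (R X : Finset Val) : Prop :=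
  (key l ∈ X ∨ x = key l) ∧ ∀ e ∈ C, s e ∈ X → τ e ∈ R

/-- A call of `AcyclicAddEdge` at the given control point is bound to mark its edge node `n` as long
as the edges `C` exist. -/
def Noticing (M : Mem T) (g : Ghost T) (C : Set Addr) (s τ : Addr → Val) (n : Addr) : PC → Prop
  | .aeRel1 _ _ _ _ _ _ m | .aeRel2 _ _ _ _ _ m | .aeMark _ _ _ _ m _ _ => m = n
  | .leStart c _ _ _ _ | .leFirst c _ _ _ _ _ | .leTest c _ _ _ _ _ _ | .leNext c _ _ _ _ _ _
  | .leLock1 c _ _ _ _ _ _ | .leLock2 c _ _ _ _ _ _ | .leChk1 c _ _ _ _ _ _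
  | .leChk2 c _ _ _ _ _ _ | .leChk3 c _ _ _ _ _ _ | .leFail1 c _ _ _ _ _ _
  | .leFail2 c _ _ _ _ _ => c = .undo n
  | .peTest k l _ _ m x R X a => m = n ∧ Progress C s τ l x R X ∧ key k ∉ R ∧
      ∀ e ∈ C, s e = x → (vLS M g).Ahead a (g.e.own e)
  | .peNext k l _ _ m x R X a => m = n ∧ Progress C s τ l x R X ∧ key k ∉ R ∧
      ∀ e ∈ C, s e = x → (vLS M g).Ahead a (g.e.own e) ∧ a ≠ g.e.own e
  | .peVal k l _ _ m x R X a | .peMark k l _ _ m x R X a | .peHead k l _ _ m x R X a =>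
      m = n ∧ Progress C s τ l x R X ∧ key k ∉ R ∧ ∀ e ∈ C, s e = x → a = g.e.own e
  | .peEnd _ l _ _ m x R X a | .peStatus _ l _ _ m x R X a | .peEVal _ l _ _ m x R X a =>
      m = n ∧ Progress C s τ l x R X ∧ ∀ e ∈ C, s e = x → τ e ∈ R ∨ (eLS M g).Ahead a e
  | .peENext _ l _ _ m x R X a =>
      m = n ∧ Progress C s τ l x R X ∧
        ∀ e ∈ C, s e = x → τ e ∈ R ∨ ((eLS M g).Ahead a e ∧ a ≠ e)
  | .peLoop k l _ _ m R X =>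
      m = n ∧ key l ∈ X ∧ (∀ e ∈ C, s e ∈ X → τ e ∈ R) ∧ key k ∉ R
  | _ => False

/-- Every cycle of unmarked edges is noticed by a call that has contributed one of them. -/
def CyclesNoticed (g : Ghost T) (S : State T) : Prop :=
  ∀ (C : Set Addr) (s τ : Addr → Val), C.Nonempty → Cyclic C s τ →
    (∀ e ∈ C, IsEdge S.mem g e (s e) (τ e)) →
    ∃ n ∈ C, ∃ t p, S.pc t = some p ∧ Noticing S.mem g C s τ n p

variable {t : T} {g g' : Ghost T} {S S' : State T} {M M' : Mem T} {sent : Status}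
  {C : Set Addr} {s τ : Addr → Val} {n : Addr}

theorem LInv.ne_null {L : LS T} (I : LInv L) {c : Addr} (hc : c ∈ L.pub) : c ≠ ConcGraph.null := by
  rintro rfl
  obtain ⟨x, hx⟩ := I.alloc _ hc
  rw [I.null] at hx
  cases hx

theorem LS.Ahead.next {L : LS T} (I : LInv L) {a c : Addr} {x : LNode} (h : L.Ahead a c)
    (hc : c ∈ L.pub) (hne : a ≠ c) (hx : L.h a = some x) : L.Ahead x.next c := by
  have h1 := h.2.tail_of_ne hx hne
  rcases I.next a h.1 x hx with ⟨h2, -⟩ | ⟨h2, -⟩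
  · rw [h2] at h1
    exact absurd (Reach.null_left I.null h1) (I.ne_null hc)
  · exact ⟨h2, h1⟩

/-- A target that stays unmarked never falls behind a traversal, even if the traversal stands on a
node already removed. -/
theorem LS.Ahead.mono {L L' : LS T} (st : LStep t L L') (I : LInv L) {a c : Addr}
    (h : L.Ahead a c) (hc : c ∈ L.pub) (hm : ∀ x, L'.h c = some x → x.dead = false) :
    L'.Ahead a c := ⟨st.pub_mono h.1, st.reach_mono I h.2 hc hm⟩

theorem IsEdge.src_pub (I : Inv g S) {e : Addr} {x y : Val} (h : IsEdge S.mem g e x y) :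
    g.e.own e ∈ g.v.pub := by
  obtain ⟨z, h1, rfl, -⟩ := h.node
  exact I.owner e h.pub z h1 h.isKey

theorem IsEdge.own_eq (st : Effect t g M g' M') {e : Addr} {x y : Val} (h : IsEdge M g e x y) :
    g'.e.own e = g.e.own e := by
  obtain ⟨z, h1, -⟩ := h.node
  exact st.e.own_eq (eLS_h h1)

theorem IsEdge.ahead_head (I : Inv g S) {e : Addr} {x y : Val} (h : IsEdge S.mem g e x y) :
    (vLS S.mem g).Ahead vHead (g.e.own e) := by
  obtain ⟨v, h1, -, h2⟩ := h.src
  obtain ⟨r, hr, hre⟩ := I.v.reach _ (h.src_pub I) _ (vLS_h h1) h2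
  have : r = vHead := by
    simp only [vLS, Option.ite_none_right_eq_some, Option.some.injEq] at hr
    exact hr.2.symm
  subst this
  exact ⟨(I.v.root _ _ hr).1, hre⟩

theorem IsEdge.ahead_edgeHead (I : Inv g S) {e : Addr} {x y : Val} (h : IsEdge S.mem g e x y)
    {v : VNode} (hv : S.mem.vn (g.e.own e) = some v) : (eLS S.mem g).Ahead v.ehead e := by
  obtain ⟨z, h1, -, h2⟩ := h.node
  obtain ⟨r, hr, hre⟩ := I.e.reach _ h.pub _ (eLS_h h1) (by simpa using h2)
  have : v.ehead = r := by simpa [eLS, headOf, hv] using hr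
  rw [this]
  exact ⟨(I.e.root _ _ hr).1, hre⟩

/-- Marks of vertex and edge nodes are never withdrawn, and values and owners are constant. So an
edge on a node linked earlier is an old edge, and new edges require new nodes. -/
theorem IsEdge.of_effect (I : Inv g S) (st : Effect t g S.mem g' M') {e : Addr} {x y : Val}
    (h : IsEdge M' g' e x y) (hp : e ∈ g.e.pub) : IsEdge S.mem g e x y := by
  obtain ⟨z', h1, h2, h3⟩ := h.node
  obtain ⟨ze, hze⟩ := I.e.alloc e hp
  obtain ⟨z, hz, -⟩ := exists_en hze
  obtain ⟨z'', h4, h5, h6⟩ := st.st e z hz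
  rw [h1] at h4
  cases h4
  have ho : g'.e.own e = g.e.own e := st.e.own_eq hze
  obtain ⟨v', h7, h8, h9⟩ := h.src
  rw [ho] at h7
  obtain ⟨ve, hve⟩ := I.v.alloc _ (I.owner e hp z hz (by
    obtain ⟨l, hl⟩ := h.isKey
    exact ⟨l, by rw [← h5, h2, hl]⟩))
  obtain ⟨v, hv, hv1, -, hv2⟩ := exists_vn hve
  obtain ⟨v'', h10, h11, h12⟩ := st.v.val_eq hve
  rw [vLS_h h7] at h10
  cases h10
  refine ⟨hp, ⟨z, hz, by rw [← h5, h2], ?_⟩, h.isKey, ⟨v, hv, ?_, ?_⟩⟩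
  · intro hm
    rcases h6 with h6 | ⟨h6, -⟩ | ⟨h6, -⟩
    · exact h3 (h6.trans hm)
    · rw [hm] at h6
      cases h6
    · exact h3 h6
  · exact (hv1.trans h11.symm).trans h8
  · rw [hv2]
    by_contra hd
    have := h12 (by simpa using hd)
    exact absurd (this.symm.trans h9) (by simp)

/-- The edges exist before and after the event, so their nodes and sources are still unmarked and
whatever was ahead of the search stays ahead. The rest concerns local variables and constant owners.
-/
theorem Noticing.stable (st : Effect t g S.mem g' M') (I : Inv g S)
    (hC : ∀ e ∈ C, IsEdge S.mem g e (s e) (τ e)) (hC' : ∀ e ∈ C, IsEdge M' g' e (s e) (τ e))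
    {p : PC} (h : Noticing S.mem g C s τ n p) : Noticing M' g' C s τ n p := by
  have hv : ∀ a, ∀ e ∈ C, (vLS S.mem g).Ahead a (g.e.own e) →
      (vLS M' g').Ahead a (g'.e.own e) := by
    intro a e he ha
    obtain ⟨v, h1, h2, h3⟩ := (hC' e he).src
    rw [(hC e he).own_eq st] at h1 ⊢
    refine ha.mono st.v I.v ((hC e he).src_pub I) fun x hx => ?_
    rw [vLS_h h1] at hx
    cases hx
    exact h3
  have he : ∀ a, ∀ e ∈ C, (eLS S.mem g).Ahead a e → (eLS M' g').Ahead a e := by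
    intro a e he ha
    obtain ⟨z, h1, h2, h3⟩ := (hC' e he).node
    refine ha.mono st.e I.e (hC e he).pub fun x hx => ?_
    rw [eLS_h h1] at hx
    cases hx
    simpa using h3
  have ho : ∀ e ∈ C, g'.e.own e = g.e.own e := fun e he => (hC e he).own_eq st
  cases p
  case peTest =>
    obtain ⟨h1, h2, h3, h4⟩ := h
    exact ⟨h1, h2, h3, fun e hc hx => hv _ e hc (h4 e hc hx)⟩
  case peNext =>
    obtain ⟨h1, h2, h3, h4⟩ := h
    exact ⟨h1, h2, h3, fun e hc hx => ⟨hv _ e hc (h4 e hc hx).1, ho e hc ▸ (h4 e hc hx).2⟩⟩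
  case peVal | peMark | peHead =>
    obtain ⟨h1, h2, h3, h4⟩ := h
    exact ⟨h1, h2, h3, fun e hc hx => (h4 e hc hx).trans (ho e hc).symm⟩
  case peEnd | peStatus | peEVal =>
    obtain ⟨h1, h2, h3⟩ := h
    exact ⟨h1, h2, fun e hc hx => (h3 e hc hx).imp_right (he _ e hc)⟩
  case peENext =>
    obtain ⟨h1, h2, h3⟩ := h
    exact ⟨h1, h2, fun e hc hx => (h3 e hc hx).imp_right (And.imp_left (he _ e hc))⟩
  all_goals exact h

/-- A search that has come to an end has found the cycle. -/
theorem Cyclic.mem_of_closed (hcyc : Cyclic C s τ) (hn : n ∈ C) {l : ℤ} {R X : Finset Val}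
    (hl : key l = τ n) (hlX : key l ∈ X) (hX : ∀ e ∈ C, s e ∈ X → τ e ∈ R) (hRX : R ⊆ X) :
    s n ∈ R := by
  -- Follow the cycle from `n`, whose target is the start of the search: every edge met has an
  -- explored source, which is the start or has been reached.
  have key : ∀ e, Relation.TransGen (fun a b => b ∈ C ∧ τ a = s b) n e →
      e ∈ C ∧ s e ∈ X ∧ (s e = τ n ∨ s e ∈ R) := by
    intro e he
    induction he with
    | single h => exact ⟨h.1, by rw [← h.2, ← hl]; exact hlX, Or.inl h.2.symm⟩
    | tail _ h ih =>
      have := hX _ ih.1 ih.2.1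
      rw [h.2] at this
      exact ⟨h.1, hRX this, Or.inr this⟩
  -- If the source of `n` is the start key, then `n` is a loop, and exploring that key has put its
  -- target into `R`.
  obtain ⟨-, h1, h2 | h2⟩ := key n (hcyc n hn n hn)
  · rw [h2]
    exact hX n hn h1
  · exact h2

/-- Concludes the exploration of `x`. When its vertex is absent or marked, no edge of `C` starts at
`x` and the premise is vacuous; otherwise the traversal of the edge list supplies it. -/
theorem Progress.loop {l : ℤ} {x : Val} {R X : Finset Val} (h : Progress C s τ l x R X)
    (hx : ∀ e ∈ C, s e = x → τ e ∈ R) :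
    key l ∈ insert x X ∧ ∀ e ∈ C, s e ∈ insert x X → τ e ∈ R := by
  refine ⟨?_, fun e he hs => ?_⟩
  · rcases h.1 with h | rfl
    · exact Finset.mem_insert_of_mem h
    · exact Finset.mem_insert_self _ _
  · rcases Finset.mem_insert.1 hs with hs | hs
    · exact hx e he hs
    · exact h.2 e he hs

/-- Control advances while the assertions still refer to the memory before the event. From the
memory after it only the status of `n` is used, to exclude the event that marks `n`. -/
theorem Noticing.next (I : Inv g S) (hcyc : Cyclic C s τ)
    (hC : ∀ e ∈ C, IsEdge S.mem g e (s e) (τ e)) (hn : n ∈ C) {p p' : PC}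
    (hn' : ∀ x, M'.en n = some x → x.status ≠ Status.marked)
    (ht : TInv S.mem g t p) (h : Noticing S.mem g C s τ n p)
    (hx : Exec sent t (code p) S.mem M' p') : Noticing S.mem g C s τ n p' := by
  have hsrc : ∀ e ∈ C, ∀ z, S.mem.vn (g.e.own e) = some z → z.val = s e ∧ z.marked = false := by
    intro e he z hz
    obtain ⟨z', hz', h1, h2⟩ := (hC e he).src
    rw [hz] at hz'
    cases hz'
    exact ⟨h1, h2⟩
  have hnode : ∀ e ∈ C, ∀ z, S.mem.en e = some z → z.val = τ e ∧ z.status ≠ Status.marked := by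
    intro e he z hz
    obtain ⟨z', hz', h1, h2⟩ := (hC e he).node
    rw [hz] at hz'
    cases hz'
    exact ⟨h1, h2⟩
  have hhead : ∀ e ∈ C, (vLS S.mem g).Ahead vHead (g.e.own e) := fun e he =>
    (hC e he).ahead_head I
  have hown : ∀ e ∈ C, g.e.own e ∈ g.v.pub := fun e he => (hC e he).src_pub I
  cases p
  case aeRel1 => cases hx; exact h
  case aeRel2 =>
    cases hx
    exact ⟨h, ⟨Or.inr rfl, by simp⟩, by simp, fun e he _ => hhead e he⟩
  case aeMark =>
    cases hx
    cases h
    exact absurd rfl (hn' _ (Function.update_self _ _ _))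
  case leStart | leFirst | leNext => cases hx; exact h
  case leLock1 | leLock2 | leFail1 | leFail2 => cases hx; exact h
  case leTest | leChk1 | leChk2 =>
    cases hx
    dsimp only
    split_ifs <;> exact h
  case leChk3 =>
    cases hx
    dsimp only
    split_ifs
    · cases h
      rfl
    · exact h
  case peTest k l v w m x R X a =>
    obtain ⟨h1, h2, h3, h4⟩ := h
    cases hx with
    | rdVVal hr =>
      rename_i z
      dsimp only
      split_ifs with hlt
      · refine ⟨h1, h2, h3, fun e he hs => ⟨h4 e he hs, ?_⟩⟩
        rintro rfl
        rw [(hsrc e he z hr).1, hs] at hlt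
        exact lt_irrefl _ hlt
      -- The source of `e` is at or beyond the current node and has value `x`. Since the current
      -- value is not below `x`, sortedness leaves only the current node.
      · refine ⟨h1, h2, h3, fun e he hs => ?_⟩
        obtain ⟨z', hz', -⟩ := (hC e he).src
        rcases I.v.reach_val (h4 e he hs).1 (h4 e he hs).2 (vLS_h hr) (vLS_h hz') with h | h
        · exact h
        · rw [(hsrc e he z' hz').1, hs] at h
          exact absurd h hlt
  case peNext k l v w m x R X a =>
    obtain ⟨h1, h2, h3, h4⟩ := h
    cases hx with
    | rdVNext hr =>
      exact ⟨h1, h2, h3, fun e he hs =>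
        (h4 e he hs).1.next I.v (hown e he) (h4 e he hs).2 (vLS_h hr)⟩
  case peVal k l v w m x R X a =>
    obtain ⟨h1, h2, h3, h4⟩ := h
    cases hx with
    | rdVVal hr =>
      dsimp only
      split_ifs with hne
      · obtain ⟨h5, h6⟩ := h2.loop fun e he hs => by
          cases h4 e he hs
          exact absurd ((hsrc e he _ hr).1.trans hs) hne
        exact ⟨h1, h5, h6, h3⟩
      · exact ⟨h1, h2, h3, h4⟩
  case peMark k l v w m x R X a =>
    obtain ⟨h1, h2, h3, h4⟩ := h
    cases hx with
    | rdMarked hr =>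
      dsimp only
      split_ifs with hm
      · obtain ⟨h5, h6⟩ := h2.loop fun e he hs => by
          cases h4 e he hs
          rw [(hsrc e he _ hr).2] at hm
          cases hm
        exact ⟨h1, h5, h6, h3⟩
      · exact ⟨h1, h2, h3, h4⟩
  case peHead k l v w m x R X a =>
    obtain ⟨h1, h2, h3, h4⟩ := h
    cases hx with
    | rdEHead hr =>
      refine ⟨h1, h2, fun e he hs => Or.inr ?_⟩
      cases h4 e he hs
      exact (hC e he).ahead_edgeHead I hr
  case peEnd k l v w m x R X a =>
    obtain ⟨h1, h2, h3⟩ := h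
    cases hx with
    | rdENext hr =>
      rename_i z
      dsimp only
      split_ifs with h0 hk
      · exact ⟨h1, h2, h3⟩
      · exact congrArg LCaller.undo h1
      -- The traversal stands on the node without successor, and no node with an integer key can be
      -- ahead of it; so all targets are in `R`.
      · obtain ⟨h5, h6⟩ := h2.loop fun e he hs => by
          rcases h3 e he hs with h | h
          · exact h
          · have hae : a ≠ e := by
              rintro rfl
              rcases I.e.next a h.1 _ (eLS_h hr) with ⟨-, h⟩ | ⟨h, -⟩
              · obtain ⟨l', hl'⟩ := (hC a he).isKey
                rw [← (hnode a he z hr).1] at hl'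
                exact absurd (hl'.symm.trans h) (key_ne_top l')
              · exact absurd (not_not.1 h0) (I.e.ne_null h)
            have := h.next I.e (hC e he).pub hae (eLS_h hr)
            exact absurd (not_not.1 h0) (I.e.ne_null this.1)
        exact ⟨h1, h5, h6, hk⟩
  case peStatus k l v w m x R X a =>
    obtain ⟨h1, h2, h3⟩ := h
    cases hx with
    | rdStatus hr =>
      dsimp only
      split_ifs with hm
      · exact ⟨h1, h2, h3⟩
      · refine ⟨h1, h2, fun e he hs => (h3 e he hs).imp_right fun h => ⟨h, ?_⟩⟩
        rintro rfl
        exact hm (hnode a he _ hr).2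
  case peEVal k l v w m x R X a =>
    obtain ⟨h1, h2, h3⟩ := h
    cases hx with
    | rdEVal hr =>
      refine ⟨h1, ⟨h2.1, fun e he hs => Finset.mem_insert_of_mem (h2.2 e he hs)⟩,
        fun e he hs => ?_⟩
      by_cases hae : a = e
      · subst hae
        rw [(hnode a he _ hr).1]
        exact Or.inl (Finset.mem_insert_self _ _)
      · exact (h3 e he hs).imp Finset.mem_insert_of_mem fun h => ⟨h, hae⟩
  case peENext k l v w m x R X a =>
    obtain ⟨h1, h2, h3⟩ := h
    cases hx with
    | rdENext hr =>
      exact ⟨h1, h2, fun e he hs => (h3 e he hs).imp_right fun h =>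
        h.1.next I.e (hC e he).pub h.2 (eLS_h hr)⟩
  case peLoop k l v w m R X =>
    obtain ⟨h1, h2, h3, h4⟩ := h
    cases hx with
    | pick hx => exact ⟨h1, ⟨Or.inl h2, h3⟩, h4, fun e he _ => hhead e he⟩
    | pickStop hRX =>
      -- The search would end with a negative answer. But `key k` is the value of the source of the
      -- noticed node, and a closed search has reached it.
      exfalso
      subst h1
      obtain ⟨⟨hv, -⟩, ⟨-, ho, -, z, hz, hzl, -⟩, -⟩ := ht
      obtain ⟨y, hy, -⟩ := (hC m hn).src
      have hk : key k = s m := by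
        rw [← (hsrc m hn y hy).1]
        rw [ho] at hy
        exact (hv.val (vLS_h hy)).symm
      rw [hk] at h4
      exact h4 (hcyc.mem_of_closed hn (hzl.symm.trans (hnode m hn z hz).1) h2 h3
        (Finset.sdiff_eq_empty_iff_subset.1 hRX))
  all_goals exact absurd h not_false

/-- Cycles remain noticed. -/
theorem CyclesNoticed.step [DecidableEq T] (I : Inv g S) (h : CyclesNoticed g S)
    (hs : Step sent t S S') (st : Effect t g S.mem g' S'.mem) (I' : Inv g' S')
    (hnew : ∀ n ∈ g'.e.pub, n ∈ g.e.pub ∨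
      (∀ x, S'.mem.en n = some x → ∀ l, x.val ≠ key l) ∨
        ∃ k l v w e f, S'.pc t = some (.aeRel1 k l v w e f n)) :
    CyclesNoticed g' S' := by
  intro C s τ hne hcyc hC'
  -- Either the event links a node of the cycle, whose creator is then just before its search, or
  -- the cycle is an old one and was noticed already.
  by_cases hlink : ∃ n ∈ C, ∃ k l v w e f, S'.pc t = some (.aeRel1 k l v w e f n)
  · obtain ⟨n, hn, k, l, v, w, e, f, hpc⟩ := hlink
    exact ⟨n, hn, t, _, hpc, rfl⟩
  have hpub : ∀ e ∈ C, e ∈ g.e.pub := by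
    intro e he
    rcases hnew e (hC' e he).pub with h1 | h1 | h1
    · exact h1
    · obtain ⟨z, hz, hzv, -⟩ := (hC' e he).node
      obtain ⟨l, hl⟩ := (hC' e he).isKey
      exact absurd (hzv.trans hl) (h1 z hz l)
    · exact absurd ⟨e, he, h1⟩ hlink
  have hC : ∀ e ∈ C, IsEdge S.mem g e (s e) (τ e) := fun e he =>
    (hC' e he).of_effect I st (hpub e he)
  obtain ⟨n, hn, u, p, hp, hno⟩ := h C s τ hne hcyc hC
  refine ⟨n, hn, u, ?_⟩
  by_cases hu : u = t
  · subst hu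
    cases hs with
    | invoke op h =>
      rw [h] at hp
      cases hp
    | respond h hb =>
      rw [h] at hp
      cases hp
      cases p <;> first | exact absurd hno not_false | cases hb
    | exec h hx =>
      rw [h] at hp
      cases hp
      refine ⟨_, Function.update_self _ _ _, ?_⟩
      -- First control advances in the old memory, then the memory changes. As `n` is unmarked
      -- afterwards, the event is not the one that marks it.
      refine Noticing.stable st I hC hC' (hno.next I hcyc hC hn ?_ (I.thread _ _ h) hx)
      intro x hx
      obtain ⟨z, hz, -, hm⟩ := (hC' n hn).node
      dsimp only at hz
      rw [hx] at hz
      cases hz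
      exact hm
  · refine ⟨p, ?_, hno.stable st I hC hC'⟩
    cases hs <;> exact (Function.update_of_ne hu _ _).trans hp

end cycles

/-! ### Acyclicity of the abstract graph -/

section acyclic

variable {t : T} {g g' : Ghost T} {S S' : State T} {sent : Status}

theorem reach_vSucc {M : Mem T} {a b : Addr} :
    Relation.ReflTransGen (vSucc M) a b ↔ Reach (vHeapOf M.vn) a b := by
  have : vSucc M = hSucc (vHeapOf M.vn) := by
    funext a b
    simp [vSucc, hSucc, vHeapOf]
  rw [this]

theorem reach_eSucc {M : Mem T} {a b : Addr} :
    Relation.ReflTransGen (eSucc M) a b ↔ Reach (eHeapOf M.en) a b := by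
  have : eSucc M = hSucc (eHeapOf M.en) := by
    funext a b
    simp [eSucc, hSucc, eHeapOf]
  rw [this]

theorem Inv.pub_of_reach (I : Inv g S) {a : Addr} {x : VNode}
    (h : Relation.ReflTransGen (vSucc S.mem) vHead a) (hx : S.mem.vn a = some x) :
    a ∈ g.v.pub := by
  refine (I.v.reach_closed (I.v.has_head 0).1 (reach_vSucc.1 h) ?_).1
  rintro rfl
  have := I.v.null
  rw [vLS_h hx] at this
  cases this

theorem Inv.reach_of_pub (I : Inv g S) {a : Addr} {x : VNode} (h : a ∈ g.v.pub)
    (hx : S.mem.vn a = some x) (hm : x.marked = false) :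
    Relation.ReflTransGen (vSucc S.mem) vHead a := by
  obtain ⟨r, hr, hre⟩ := I.v.reach a h _ (vLS_h hx) hm
  have : r = vHead := by
    simp only [vLS, Option.ite_none_right_eq_some, Option.some.injEq] at hr
    exact hr.2.symm
  exact reach_vSucc.2 (this ▸ hre)

/-- An edge of the abstract graph comes from an edge node. -/
theorem Inv.exists_isEdge (I : Inv g S) {k l : ℤ} (h : absE S k l) :
    ∃ e, IsEdge S.mem g e (key k) (key l) ∧
      ∃ z, S.mem.en e = some z ∧ z.status = Status.added := by
  obtain ⟨-, x, ⟨a, ha, hx, hm⟩, hk, e, y, he, hy, hl, hs⟩ := h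
  obtain ⟨h1, h2, -⟩ := I.e.root a x.ehead (by simp [eLS, headOf, hx])
  have h3 := I.e.reach_closed h1 (reach_eSucc.1 he) (by
    rintro rfl
    have := I.e.null
    rw [eLS_h hy] at this
    cases this)
  have ho : g.e.own e = a := h3.2.trans h2
  exact ⟨e, ⟨h3.1, ⟨y, hy, hl, by simp [hs]⟩, ⟨l, rfl⟩, ⟨x, by rw [ho, hx], hk, hm⟩⟩, y, hy, hs⟩

/-- Every noticing control point lies after the linking of `n` and before the write that decides its
status. -/
theorem Noticing.inTransit {M : Mem T} {C : Set Addr} {s τ : Addr → Val} {n : Addr} {p : PC}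
    (h : Noticing M g C s τ n p) (ht : TInv M g t p) : ∃ l v, InTransit M g t l v n := by
  cases p
  case aeRel1 | aeRel2 | aeMark => cases h; exact ⟨_, _, ht.2.1⟩
  case leStart | leFirst | leTest | leNext | leLock1 | leLock2 | leChk1 | leChk2 | leChk3
    | leFail1 | leFail2 => cases h; exact ⟨_, _, ht.2.1⟩
  case peTest | peNext | peVal | peMark | peHead | peEnd | peStatus | peEVal | peENext | peLoop =>
    cases h.1; exact ⟨_, _, ht.2.1⟩
  all_goals exact absurd h not_false

/-- A cycle of `r`, as a strongly connected set. -/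
theorem exists_stronglyConnected {α : Type*} {r : α → α → Prop} {a : α}
    (h : Relation.TransGen r a a) : ∃ C : Set α, a ∈ C ∧ (∀ b ∈ C, ∃ c, r c b) ∧
      ∀ b ∈ C, ∀ c ∈ C, Relation.TransGen (fun x y => y ∈ C ∧ r x y) b c := by
  refine ⟨{b | Relation.TransGen r a b ∧ Relation.TransGen r b a}, ⟨h, h⟩, ?_, ?_⟩
  · rintro b ⟨hb, -⟩
    cases hb with
    | single h => exact ⟨_, h⟩
    | tail _ h => exact ⟨_, h⟩
  · rintro b ⟨hb, hba⟩ c ⟨hac, hca⟩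
    -- Whatever lies on a path between two members is itself a member, so the path stays in the set.
    have hbc : ∀ d, Relation.TransGen r b d → Relation.TransGen r d a →
        Relation.TransGen (fun x y => (Relation.TransGen r a y ∧ Relation.TransGen r y a) ∧ r x y)
          b d := by
      intro d h1
      induction h1 with
      | single h2 => exact fun h3 => .single ⟨⟨hb.tail h2, h3⟩, h2⟩
      | tail h2 h4 ih =>
        exact fun h3 => (ih (.head h4 h3)).tail ⟨⟨(hb.trans h2).tail h4, h3⟩, h4⟩
    exact hbc c (hba.trans hac) hca

/-- A cycle of keys lifts to a closed walk of `added` edge nodes. The strongly connected set around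
it would contain a noticed node, which is in transit. -/
theorem absAcyclic_of_noticed (I : Inv g S) (h : CyclesNoticed g S) : AbsAcyclic S := by
  intro k hk
  -- The default `⊥` at unallocated addresses plays no role.
  let s : Addr → Val := fun e => ((S.mem.vn (g.e.own e)).map VNode.val).getD ⊥
  let τ : Addr → Val := fun e => ((S.mem.en e).map ENode.val).getD ⊥
  let A : Addr → Prop := fun e => IsEdge S.mem g e (s e) (τ e) ∧
    ∃ z, S.mem.en e = some z ∧ z.status = Status.added
  have hedge : ∀ k l, absE S k l → ∃ e, A e ∧ s e = key k ∧ τ e = key l := by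
    intro k l hkl
    obtain ⟨e, he, ha⟩ := I.exists_isEdge hkl
    have h1 : s e = key k := by
      obtain ⟨v, hv, hv', -⟩ := he.src
      simp [s, hv, hv']
    have h2 : τ e = key l := by
      obtain ⟨v, hv, hv', -⟩ := he.node
      simp [τ, hv, hv']
    exact ⟨e, ⟨by rw [h1, h2]; exact he, ha⟩, h1, h2⟩
  -- Only the second node is required to satisfy `A`; this suffices because every member of the
  -- strongly connected set has a predecessor.
  let r : Addr → Addr → Prop := fun a b => A b ∧ τ a = s b
  have hpath : ∀ l, Relation.TransGen (absE S) k l →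
      ∃ e e', A e ∧ s e = key k ∧ τ e' = key l ∧ Relation.ReflTransGen r e e' := by
    intro l hl
    induction hl with
    | single h =>
      obtain ⟨e, h1, h2, h3⟩ := hedge _ _ h
      exact ⟨e, e, h1, h2, h3, .refl⟩
    | tail _ h ih =>
      obtain ⟨e, e', h1, h2, h3, h4⟩ := ih
      obtain ⟨f, h5, h6, h7⟩ := hedge _ _ h
      exact ⟨e, f, h1, h2, h7, h4.tail ⟨h5, h3.trans h6.symm⟩⟩
  obtain ⟨e, e', h1, h2, h3, h4⟩ := hpath k hk
  obtain ⟨C, heC, hpre, hC⟩ := exists_stronglyConnected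
    (Relation.TransGen.tail' h4 (show r e' e from ⟨h1, h3.trans h2.symm⟩))
  have hA : ∀ f ∈ C, A f := fun f hf => (hpre f hf).choose_spec.1
  obtain ⟨n, hn, u, p, hp, hno⟩ := h C s τ ⟨e, heC⟩ (fun b hb c hc =>
    Relation.TransGen.mono (fun x y hxy => ⟨hxy.1, hxy.2.2⟩) _ _ (hC b hb c hc))
    fun f hf => (hA f hf).1
  obtain ⟨l, v, -, -, -, z, hz, -, hz'⟩ := hno.inTransit (I.thread u p hp)
  obtain ⟨-, y, hy, hy'⟩ := hA n hn
  rw [hz] at hy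
  cases hy
  rw [hz'] at hy'
  cases hy'

/-- All edge nodes are sentinels, which carry no integer key. -/
theorem cyclesNoticed_init : CyclesNoticed (initGhost T) (initState T sent) := by
  rintro C s τ ⟨e, he⟩ - h
  exfalso
  obtain ⟨hp, ⟨z, hz, hzv, -⟩, ⟨l, hl⟩, -⟩ := h e he
  rw [← hzv] at hl
  rcases hp with rfl | rfl | rfl | rfl <;> cases hz
  · exact key_ne_bot l hl.symm
  · exact key_ne_top l hl.symm
  · exact key_ne_bot l hl.symm
  · exact key_ne_top l hl.symm

variable [DecidableEq T]

theorem Execution.exists_inv (hsent : sent ≠ Status.marked) (E : Execution T sent) :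
    ∀ m ≤ E.len, ∃ g, Inv g (E.st m) ∧ CyclesNoticed g (E.st m) := by
  intro m
  induction m with
  | zero =>
    intro _
    rw [E.init]
    exact ⟨_, inv_init, cyclesNoticed_init⟩
  | succ m ih =>
    intro hm
    obtain ⟨g, I, h⟩ := ih (by omega)
    obtain ⟨g', s, I', hn⟩ := I.step hsent (E.step m hm)
    exact ⟨g', I', h.step I (E.step m hm) s I' hn⟩

end acyclic

/-! ## The marks of the located vertex nodes -/

section marks

variable {t : T} {g g' : Ghost T} {S S' : State T} {sent : Status} {a : Addr} {k : ℤ}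

/-- `a` is an unmarked vertex node. -/
def Unmarked (S : State T) (a : Addr) : Prop := ∃ x, S.mem.vn a = some x ∧ x.marked = false

/-- `a` is a marked vertex node. -/
def Marked (S : State T) (a : Addr) : Prop := ∃ x, S.mem.vn a = some x ∧ x.marked = true

/-- `a` is a vertex node with key `k`, which is in the vertex list unless it is marked. -/
def Listed (S : State T) (a : Addr) (k : ℤ) : Prop :=
  ∃ x, S.mem.vn a = some x ∧ x.val = key k ∧
    (x.marked = false → Relation.ReflTransGen (vSucc S.mem) vHead a)

theorem Unmarked.not_marked (h : Unmarked S a) : ¬ Marked S a := by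
  rintro ⟨x, hx, hm⟩
  obtain ⟨y, hy, hm'⟩ := h
  rw [hx] at hy
  cases hy
  rw [hm] at hm'
  cases hm'

theorem Listed.unmarked_or (h : Listed S a k) : Unmarked S a ∨ Marked S a := by
  obtain ⟨x, hx, -⟩ := h
  cases hm : x.marked
  · exact Or.inl ⟨x, hx, hm⟩
  · exact Or.inr ⟨x, hx, hm⟩

theorem Listed.mem_absV (h : Listed S a k) (hm : Unmarked S a) : k ∈ absV S := by
  obtain ⟨x, hx, hk, hr⟩ := h
  obtain ⟨y, hy, hm⟩ := hm
  rw [hx] at hy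
  cases hy
  exact ⟨x, ⟨a, hr hm, hx, hm⟩, hk⟩

theorem Inv.listed (I : Inv g S) (h : (vLS S.mem g).Has a (· = key k)) : Listed S a k := by
  obtain ⟨hp, y, hy, hk⟩ := h
  obtain ⟨x, hx, hv, -⟩ := exists_vn hy
  exact ⟨x, hx, hv.trans hk, I.reach_of_pub hp hx⟩

theorem Effect.vn_eq (s : Effect t g S.mem g' S'.mem) {x : VNode} (hx : S.mem.vn a = some x) :
    ∃ x', S'.mem.vn a = some x' ∧ x'.val = x.val ∧ (x.marked = true → x'.marked = true) := by
  obtain ⟨y, hy, h1, h2⟩ := s.v.val_eq (vLS_h hx)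
  obtain ⟨x', hx', h3, -, h4⟩ := exists_vn hy
  exact ⟨x', hx', h3.trans h1, fun h => h4.trans (h2 h)⟩

/-- `Listed` mentions no auxiliary variables, so it can be carried along an execution although these
are only known to exist state by state. -/
theorem Listed.step (I : Inv g S) (s : Effect t g S.mem g' S'.mem) (I' : Inv g' S')
    (h : Listed S a k) : Listed S' a k := by
  obtain ⟨x, hx, hk, hr⟩ := h
  obtain ⟨x', hx', hv, hm⟩ := s.vn_eq hx
  refine ⟨x', hx', hv.trans hk, fun hm' => ?_⟩
  have : x.marked = false := by
    cases h : x.marked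
    · rfl
    · rw [hm h] at hm'
      cases hm'
  exact I'.reach_of_pub (s.v.pub_mono (I.pub_of_reach (hr this) hx)) hx' hm'

theorem Marked.step (s : Effect t g S.mem g' S'.mem) (h : Marked S a) : Marked S' a := by
  obtain ⟨x, hx, hm⟩ := h
  obtain ⟨x', hx', -, hm'⟩ := s.vn_eq hx
  exact ⟨x', hx', hm' hm⟩

/-- Allocation uses fresh addresses and the other writes copy the mark, so only `wrMarked` can set
it. -/
theorem Exec.marks {i : Instr} {M M' : Mem T} {p : PC} (h : Exec sent t i M M' p) {x x' : VNode}
    (hx : M.vn a = some x) (hm : x.marked = false) (hx' : M'.vn a = some x')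
    (hm' : x'.marked = true) : ∃ c, i = .wrMarked a c := by
  have hsame : M.vn a = M'.vn a → False := by
    intro he
    rw [← he, hx] at hx'
    cases hx'
    rw [hm] at hm'
    cases hm'
  cases h
  case wrMarked b y hy =>
    by_cases hb : a = b
    · exact ⟨_, by rw [hb]⟩
    · exact absurd (Function.update_of_ne hb _ _).symm hsame
  case wrVNext b b' y hy =>
    by_cases hb : a = b
    · subst hb
      rw [hx] at hy
      cases hy
      simp only [Function.update_self, Option.some.injEq] at hx'
      subst hx'
      rw [hm] at hm'
      cases hm'
    · exact absurd (Function.update_of_ne hb _ _).symm hsame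
  case newV b e f ha he hf hef ha' he' hf' =>
    refine absurd (Function.update_of_ne ?_ _ _).symm hsame
    rintro rfl
    rw [hx] at ha'
    cases ha'
  all_goals exact absurd rfl hsame

theorem eq_rvMark {p c : PC} (h : code p = .wrMarked a c) : ∃ k u, p = .rvMark k u a := by
  cases p <;> cases h
  exact ⟨_, _, rfl⟩

variable [DecidableEq T]

theorem Step.marks (hs : Step sent t S S') (h : Unmarked S a) (h' : Marked S' a) :
    ∃ k u, S.pc t = some (.rvMark k u a) := by
  cases hs with
  | invoke op h0 => exact absurd h' h.not_marked
  | respond h0 hb => exact absurd h' h.not_marked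
  | exec h0 hx =>
    obtain ⟨x, hx1, hm⟩ := h
    obtain ⟨x', hx', hm'⟩ := h'
    obtain ⟨c, hc⟩ := hx.marks hx1 hm hx' hm'
    obtain ⟨k, u, rfl⟩ := eq_rvMark hc
    exact ⟨k, u, h0⟩

theorem Step.marked_of_rvMark (hs : Step sent t S S') {u : Addr}
    (h : S.pc t = some (.rvMark k u a)) : Marked S' a := by
  cases hs with
  | invoke op h0 =>
    rw [h] at h0
    cases h0
  | respond h0 hb =>
    rw [h] at h0
    cases h0
    cases hb
  | exec h0 hx =>
    rw [h] at h0
    cases h0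
    cases hx
    exact ⟨_, Function.update_self _ _ _, rfl⟩

variable {E : Execution T sent}

theorem Execution.exists_effect (hsent : sent ≠ Status.marked) {m : ℕ} (hm : m < E.len) :
    ∃ g g', Inv g (E.st m) ∧ Effect (E.who m) g (E.st m).mem g' (E.st (m + 1)).mem ∧
      Inv g' (E.st (m + 1)) := by
  obtain ⟨g, I, -⟩ := E.exists_inv hsent m hm.le
  obtain ⟨g', s, I', -⟩ := I.step hsent (E.step m hm)
  exact ⟨g, g', I, s, I'⟩

theorem Listed.later (hsent : sent ≠ Status.marked) {m m' : ℕ} (hm : m ≤ m') (hl : m' ≤ E.len)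
    (h : Listed (E.st m) a k) : Listed (E.st m') a k := by
  induction m', hm using Nat.le_induction with
  | base => exact h
  | succ n _ ih =>
    obtain ⟨g, g', I, s, I'⟩ := E.exists_effect hsent hl
    exact (ih (by omega)).step I s I'

theorem Marked.later (hsent : sent ≠ Status.marked) {m m' : ℕ} (hm : m ≤ m') (hl : m' ≤ E.len)
    (h : Marked (E.st m) a) : Marked (E.st m') a := by
  induction m', hm using Nat.le_induction with
  | base => exact h
  | succ n _ ih =>
    obtain ⟨g, g', I, s, I'⟩ := E.exists_effect hsent hl
    exact (ih (by omega)).step s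

/-- A listed vertex node stays unmarked until it is removed. -/
theorem Unmarked.later (hsent : sent ≠ Status.marked) {m m' : ℕ} (hm : m ≤ m') (hl : m' ≤ E.len)
    (h : Listed (E.st m) a k) (hu : Unmarked (E.st m) a)
    (hr : ∀ r, m ≤ r → r < m' → ¬ IsRemoval E r a) : Unmarked (E.st m') a := by
  induction m', hm using Nat.le_induction with
  | base => exact hu
  | succ n hmn ih =>
    have h1 := ih (by omega) fun r h1 h2 => hr r h1 (by omega)
    rcases (h.later hsent (Nat.le_succ_of_le hmn) hl).unmarked_or with h2 | h2
    · exact h2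
    · exact absurd ((E.step n hl).marks h1 h2) (hr n hmn (by omega))

theorem IsRemoval.marked {r : ℕ} (h : IsRemoval E r a) (hr : r < E.len) :
    Marked (E.st (r + 1)) a := by
  obtain ⟨k, u, h⟩ := h
  exact (E.step r hr).marked_of_rvMark h

end marks

/-! ## Calls of `AcyclicAddEdge` -/

section calls

variable [DecidableEq T] {sent : Status} {E : Execution T sent} {t : T} {i j m : ℕ}
  {k l : ℤ}

/-- Between the events `i` and `m`, the call has read that `v` and then `w` is unmarked. -/
def SeenUnmarked (E : Execution T sent) (i m : ℕ) (k l : ℤ) (v w : Addr) : Prop :=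
  ∃ m₁ m₂, i < m₁ ∧ m₁ ≤ m₂ ∧ m₂ < m ∧ Listed (E.st m₁) v k ∧ Listed (E.st m₁) w l ∧
    Unmarked (E.st m₁) v ∧ Unmarked (E.st m₂) w

/-- What holds at a control point of a call `AcyclicAddEdge(k, l)` invoked at event `i`. -/
def CallInv (E : Execution T sent) (t : T) (i : ℕ) (k l : ℤ) (m : ℕ) : PC → Prop
  | .hsTest1 c k' l' _ | .hsNext1 c k' l' _ | .hsVal1 c k' l' _ | .hsMark1 c k' l' _
  | .hsStart2 c k' l' _ | .hsTest2 c k' l' _ _ | .hsNext2 c k' l' _ _ | .hsVal2 c k' l' _ _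
  | .hsMark2 c k' l' _ _ => c = .add ∧ k' = k ∧ l' = l
  | .alMark1 c k' l' _ _ => c = .ins ∧ k' = k ∧ l' = l
  | .alMark2 c k' l' v w => c = .ins ∧ (k' = k ∧ l' = l ∧
      ∃ m₁, i < m₁ ∧ m₁ < m ∧ Listed (E.st m₁) v k ∧ Listed (E.st m₁) w l ∧
        Unmarked (E.st m₁) v)
  | .leStart c k' l' v w | .leFirst c k' l' v w _ | .leTest c k' l' v w _ _
  | .leNext c k' l' v w _ _ | .leLock1 c k' l' v w _ _ | .leLock2 c k' l' v w _ _
  | .leChk1 c k' l' v w _ _ | .leChk2 c k' l' v w _ _ | .leChk3 c k' l' v w _ _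
  | .leFail1 c k' l' v w _ _ | .leFail2 c k' l' v w _ =>
      c ≠ .del ∧ (k' = k ∧ l' = l ∧ SeenUnmarked E i m k l v w)
  | .aeTest k' l' v w _ _ | .aeNew k' l' v w _ _ | .aeInit k' l' v w _ _ _
  | .aeLink k' l' v w _ _ _ | .aeRel1 k' l' v w _ _ _ | .aeRel2 k' l' v w _ _
  | .aeAdded k' l' v w _ | .aeMark k' l' v w _ _ _ | .aeRead k' l' v w _ _ _
  | .aeUnlink k' l' v w _ _ _ _ | .peTest k' l' v w _ _ _ _ _ | .peNext k' l' v w _ _ _ _ _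
  | .peVal k' l' v w _ _ _ _ _ | .peMark k' l' v w _ _ _ _ _ | .peHead k' l' v w _ _ _ _ _
  | .peEnd k' l' v w _ _ _ _ _ | .peStatus k' l' v w _ _ _ _ _ | .peEVal k' l' v w _ _ _ _ _
  | .peENext k' l' v w _ _ _ _ _ | .peLoop k' l' v w _ _ _ =>
      k' = k ∧ l' = l ∧ SeenUnmarked E i m k l v w
  | .eRel1 b _ _ | .eRel2 b _ | .done b =>
      b = true → ∃ c v w, i < c ∧ c < m ∧ IsCodePoint E t c v w
  | _ => False

theorem SeenUnmarked.succ {v w : Addr} (h : SeenUnmarked E i m k l v w) :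
    SeenUnmarked E i (m + 1) k l v w := by
  obtain ⟨m₁, m₂, h1, h2, h3, h4⟩ := h
  exact ⟨m₁, m₂, h1, h2, by omega, h4⟩

theorem CallInv.succ {p : PC} (h : CallInv E t i k l m p) : CallInv E t i k l (m + 1) p := by
  cases p
  case alMark2 =>
    obtain ⟨h1, h2, h3, m₁, h4, h5, h6⟩ := h
    exact ⟨h1, h2, h3, m₁, h4, by omega, h6⟩
  case eRel1 | eRel2 | done =>
    intro hb
    obtain ⟨c, v, w, h1, h2, h3⟩ := h hb
    exact ⟨c, v, w, h1, by omega, h3⟩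
  all_goals
    first
    | exact h
    | exact ⟨h.1, h.2.1, h.2.2.succ⟩
    | exact ⟨h.1, h.2.1, h.2.2.1, h.2.2.2.succ⟩

/-- The reads at `alMark1` and `alMark2` are the witnesses `m₁` and `m₂` of `SeenUnmarked`. Every
way to return `true` passes through `aeTest` or `aeAdded`; all other exits return `false`. -/
theorem CallInv.next {g : Ghost T} (I : Inv g (E.st m)) (him : i < m) (hw : E.who m = t)
    {p p' : PC} (hp : (E.st m).pc t = some p) {M' : Mem T}
    (hx : Exec sent t (code p) (E.st m).mem M' p') (h : CallInv E t i k l m p) :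
    CallInv E t i k l (m + 1) p' := by
  have hI := I.thread t p hp
  cases p
  case hsMark2 =>
    obtain ⟨rfl, rfl, rfl⟩ := h
    cases hx
    dsimp only
    split_ifs
    · exact fun h => absurd h (by simp)
    · exact ⟨rfl, rfl, rfl⟩
    · exact ⟨rfl, rfl, rfl⟩
  case alMark1 =>
    obtain ⟨rfl, rfl, rfl⟩ := h
    obtain ⟨⟨h1, h2⟩, -⟩ := hI
    cases hx with
    | rdMarked hr =>
      dsimp only
      split_ifs with hm
      · exact fun h => absurd h (by simp)
      · exact ⟨rfl, rfl, rfl, m, him, by omega, I.listed h1, I.listed h2, _, hr, by simpa using hm⟩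
  case alMark2 =>
    obtain ⟨rfl, rfl, rfl, m₁, h1, h2, h3, h4, h5⟩ := h
    cases hx with
    | rdMarked hr =>
      dsimp only
      split_ifs with hm
      · exact fun h => absurd h (by simp)
      · exact ⟨by simp, rfl, rfl, m₁, m, h1, h2.le, by omega, h3, h4, h5, _, hr, by simpa using hm⟩
  case leChk3 c _ _ _ _ _ _ =>
    cases hx
    dsimp only
    split_ifs
    · cases c
      · exact h.succ.2
      · exact absurd rfl h.1
      · exact h.succ.2
    · exact h.succ
  case aeTest =>
    have hcp := h
    cases hx
    dsimp only
    split_ifs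
    · exact CallInv.succ h
    · exact fun _ => ⟨m, _, _, him, by omega, hw, Or.inl ⟨_, _, _, _, hp⟩⟩
  case aeAdded =>
    cases hx
    exact fun _ => ⟨m, _, _, him, by omega, hw, Or.inr ⟨_, _, _, hp⟩⟩
  case aeUnlink =>
    cases hx
    exact fun h => absurd h (by simp)
  case peEnd =>
    cases hx
    dsimp only
    split_ifs
    · exact h.succ
    · exact ⟨by simp, h.succ⟩
    · exact h.succ
  case done => cases hx
  all_goals
    first
    | exact absurd h not_false
    | (cases hx <;>
        first
        | exact h.succ
        | (dsimp only
           split_ifs <;> first | exact h.succ | exact fun h => absurd h (by simp)))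

theorem IsAddEdgeCall.callInv (hsent : sent ≠ Status.marked) {b : Bool}
    (hc : IsAddEdgeCall E t k l b i j) (him : i < m) (hmj : m ≤ j) :
    ∃ p, (E.st m).pc t = some p ∧ CallInv E t i k l m p := by
  obtain ⟨-, hj, -, -, hstart, hnone, -, -⟩ := hc
  induction m, him using Nat.le_induction with
  | base => exact ⟨_, hstart, rfl, rfl, rfl⟩
  | succ m him ih =>
    obtain ⟨p, hp, h⟩ := ih (by omega)
    obtain ⟨g, I, -⟩ := E.exists_inv hsent m (by omega)
    have hs := E.step m (by omega)
    have hn := hnone (m + 1) (by omega) hmj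
    by_cases hw : E.who m = t
    · rw [hw] at hs
      generalize hS : E.st (m + 1) = S' at hs hn ⊢
      cases hs with
      | invoke op h0 =>
        rw [hp] at h0
        cases h0
      | respond h0 hb => exact absurd (Function.update_self _ _ _) hn
      | exec h0 hx =>
        rw [hp] at h0
        cases h0
        exact ⟨_, Function.update_self _ _ _, h.next I him hw hp hx⟩
    · refine ⟨p, ?_, h.succ⟩
      rw [← hp]
      generalize hS : E.st (m + 1) = S' at hs
      cases hs <;> exact Function.update_of_ne (Ne.symm hw) _ _

theorem IsAddEdgeCall.seenUnmarked (hsent : sent ≠ Status.marked) {b : Bool}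
    (hc : IsAddEdgeCall E t k l b i j) {c : ℕ} {v w : Addr} (hic : i < c) (hcj : c < j)
    (hcp : IsCodePoint E t c v w) : SeenUnmarked E i c k l v w := by
  obtain ⟨p, hp, h⟩ := hc.callInv hsent hic hcj.le
  rcases hcp.2 with ⟨k', l', e₁, e₂, h1⟩ | ⟨k', l', e₃, h1⟩
  all_goals
    rw [hp] at h1
    cases h1
    exact h.2.2

/-- A successful call has a linearization point. -/
theorem IsAddEdgeCall.exists_isLinPoint (hsent : sent ≠ Status.marked)
    (hc : IsAddEdgeCall E t k l true i j) : ∃ p q, IsLinPoint E t i j p q := by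
  classical
  obtain ⟨p, hp, h⟩ := hc.callInv hsent hc.1 le_rfl
  rw [hc.2.2.2.2.2.2.2] at hp
  cases hp
  obtain ⟨c₀, v₀, w₀, h1, h2, h3⟩ := h rfl
  let P : ℕ → Prop := fun c => i < c ∧ c < j ∧ ∃ v w, IsCodePoint E t c v w
  -- The last code point before the response; it also determines the two vertex nodes.
  obtain ⟨hic, hcj, v, w, hcp⟩ : P (Nat.findGreatest P j) :=
    Nat.findGreatest_spec (P := P) h2.le ⟨h1, h2, v₀, w₀, h3⟩
  have hlast : ∀ m, Nat.findGreatest P j < m → m < j → ∀ v w, ¬ IsCodePoint E t m v w :=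
    fun m hm hmj v w hv =>
      Nat.findGreatest_is_greatest hm hmj.le ⟨hic.trans hm, hmj, v, w, hv⟩
  generalize Nat.findGreatest P j = c at *
  by_cases hr : ∃ r, i < r ∧ r < c ∧ (IsRemoval E r v ∨ IsRemoval E r w)
  · obtain ⟨h4, h5, h6⟩ := Nat.find_spec hr
    refine ⟨Nat.find hr, Nat.find hr, c, v, w, hic, hcj, hcp, hlast,
      Or.inr ⟨rfl, h4, h5, h6, fun r hir hrp hrem => ?_⟩⟩
    exact Nat.find_min hr hrp ⟨hir, hrp.trans h5, hrem⟩
  · exact ⟨c, c + 1, c, v, w, hic, hcj, hcp, hlast,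
      Or.inl ⟨rfl, rfl, fun r hir hrc hrem => hr ⟨r, hir, hrc, hrem⟩⟩⟩

/-- Both vertex nodes are listed and unmarked at `c`, or before the first removal of one of them if
that removal comes earlier. -/
theorem SeenUnmarked.unmarked (hsent : sent ≠ Status.marked) {c p : ℕ} {v w : Addr}
    (h : SeenUnmarked E i c k l v w) (hc : c ≤ E.len) (hpc : p ≤ c)
    (hp : p < c → IsRemoval E p v ∨ IsRemoval E p w)
    (hr : ∀ r, i < r → r < p → ¬ (IsRemoval E r v ∨ IsRemoval E r w)) :
    (Listed (E.st p) v k ∧ Unmarked (E.st p) v) ∧ (Listed (E.st p) w l ∧ Unmarked (E.st p) w) := by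
  obtain ⟨m₁, m₂, h1, h2, h3, h4, h5, h6, h7⟩ := h
  -- Otherwise `p` would be a removal before both reads, and one of them would have seen its mark.
  have hmp : m₁ ≤ p := by
    by_contra hlt
    rcases hp (by omega) with h | h
    · exact h6.not_marked ((h.marked (by omega)).later hsent (by omega) (by omega))
    · exact h7.not_marked ((h.marked (by omega)).later hsent (by omega) (by omega))
  have hw := h5.later hsent hmp (hpc.trans hc)
  refine ⟨⟨h4.later hsent hmp (hpc.trans hc), h6.later hsent hmp (hpc.trans hc) h4 fun r hr1 hr2 h =>
    hr r (by omega) hr2 (Or.inl h)⟩, hw, ?_⟩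
  rcases hw.unmarked_or with h | h
  · exact h
  -- The mark of `w` is read only at `m₂`, possibly after `p`; in that case the permanence of marks
  -- gives the claim backwards in time.
  · rcases le_total p m₂ with h8 | h8
    · exact absurd (h.later hsent h8 (by omega)) h7.not_marked
    · exact h7.later hsent h8 (hpc.trans hc) (h5.later hsent h2 (by omega)) fun r hr1 hr2 h =>
        hr r (by omega) hr2 (Or.inr h)

theorem IsCodePoint.not_isRemoval {c : ℕ} {v w a : Addr} (h : IsCodePoint E t c v w) :
    ¬ IsRemoval E c a := by
  rintro ⟨k, u, hr⟩
  rw [h.1] at hr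
  rcases h.2 with ⟨k', l', e₁, e₂, h1⟩ | ⟨k', l', e₃, h1⟩
  all_goals
    rw [hr] at h1
    cases h1

/-- The two keys are vertices at the linearization point. -/
theorem IsLinPoint.mem_absV (hsent : sent ≠ Status.marked) (hc : IsAddEdgeCall E t k l true i j)
    {p q : ℕ} (h : IsLinPoint E t i j p q) :
    (k ∈ absV (E.st p) ∧ l ∈ absV (E.st p)) ∧ (k ∈ absV (E.st q) ∧ l ∈ absV (E.st q)) := by
  obtain ⟨c, v, w, hic, hcj, hcp, -, h⟩ := h
  have hs := hc.seenUnmarked hsent hic hcj hcp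
  have hj := hc.2.1
  rcases h with ⟨rfl, rfl, hr⟩ | ⟨rfl, hip, hpc, hrem, hr⟩
  · obtain ⟨⟨h1, h2⟩, h3, h4⟩ := hs.unmarked hsent (by omega) le_rfl (fun h => absurd h (by simp)) hr
    -- A code point marks no vertex node, so the post-state inherits both vertices from the
    -- pre-state.
    have hno : ∀ a r, p ≤ r → r < p + 1 → ¬ IsRemoval E r a := fun a r hr1 hr2 => by
      obtain rfl : r = p := by omega
      exact hcp.not_isRemoval
    have hle : p + 1 ≤ E.len := by omega
    exact ⟨⟨h1.mem_absV h2, h3.mem_absV h4⟩,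
      (h1.later hsent p.le_succ hle).mem_absV (h2.later hsent p.le_succ hle h1 (hno v)),
      (h3.later hsent p.le_succ hle).mem_absV (h4.later hsent p.le_succ hle h3 (hno w))⟩
  · obtain ⟨⟨h1, h2⟩, h3, h4⟩ := hs.unmarked hsent (by omega) hpc.le (fun _ => hrem) hr
    exact ⟨⟨h1.mem_absV h2, h3.mem_absV h4⟩, h1.mem_absV h2, h3.mem_absV h4⟩

theorem IsLinPoint.le_len (hc : IsAddEdgeCall E t k l true i j) {p q : ℕ}
    (h : IsLinPoint E t i j p q) : p ≤ E.len ∧ q ≤ E.len := by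
  obtain ⟨c, v, w, hic, hcj, hcp, -, h⟩ := h
  have hj := hc.2.1
  rcases h with ⟨rfl, rfl, -⟩ | ⟨rfl, -, h, -⟩ <;> omega

theorem Execution.absAcyclic (hsent : sent ≠ Status.marked) (E : Execution T sent) {m : ℕ}
    (hm : m ≤ E.len) : AbsAcyclic (E.st m) := by
  obtain ⟨g, I, h⟩ := E.exists_inv hsent m hm
  exact absAcyclic_of_noticed I h

end calls

end ConcGraph

theorem mainTheorem4 {T : Type*} [DecidableEq T] (sent : ConcGraph.Status)
    (hsent : sent ≠ ConcGraph.Status.marked) (E : ConcGraph.Execution T sent)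
    (t : T) (key₁ key₂ : ℤ) (i j : ℕ)
    (hcall : ConcGraph.IsAddEdgeCall E t key₁ key₂ true i j) :
    (∃ p q, ConcGraph.IsLinPoint E t i j p q) ∧
    ∀ p q, ConcGraph.IsLinPoint E t i j p q →
      (key₁ ∈ ConcGraph.absV (E.st p) ∧ key₂ ∈ ConcGraph.absV (E.st p) ∧
        ConcGraph.AbsAcyclic (E.st p)) ∧
      (key₁ ∈ ConcGraph.absV (E.st q) ∧ key₂ ∈ ConcGraph.absV (E.st q) ∧
        ConcGraph.AbsAcyclic (E.st q)) := by
  refine ⟨hcall.exists_isLinPoint hsent, fun p q h => ?_⟩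
  obtain ⟨⟨h1, h2⟩, h3, h4⟩ := h.mem_absV hsent hcall
  obtain ⟨hp, hq⟩ := h.le_len hcall
  exact ⟨⟨h1, h2, E.absAcyclic hsent hp⟩, h3, h4, E.absAcyclic hsent hq⟩
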